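/- **Theorem 1.10 (Anomalous magnetic potentials).** Let $d\ge 3$, $N=2^{\lfloor (d+1)/2\rfloor}$, $m\ge 0$, and let $\alpha_1,\dots,\alpha_d,\beta$ be Dirac matrices, i.e. Hermitian $N\times N$ matrices with $\alpha_j\alpha_k+\alpha_k\alpha_j=2\delta_{jk}\mathbb I_N$, $\alpha_j\beta+\beta\alpha_j=0$, $\beta^2=\mathbb I_N$. Write $H^1=H^1(\mathbb R^d;\mathbb C^N)$. For a magnetic potential $A\in L^2_{\rm loc}(\mathbb R^d;\mathbb R^d)$ put $\nabla_A=\nabla-iA$, let $B_{jk}=\partial_jA_k-\partial_kA_j$ (distributional derivatives) and assume $B\in L^2_{\rm loc}$; $|B(x)|$ is the operator norm of the matrix $B(x)$. For $V:\mathbb R^d\to\mathbb C^{N\times N}$ let $H_m(A,V)=-i\boldsymbol\alpha\cdot\nabla_A+m\beta+V$ in $L^2(\mathbb R^d;\mathbb C^N)$, acting on those $\psi\in H^1$ for which $-i\boldsymbol\alpha\cdot\nabla_A\psi+m\beta\psi+V\psi\in L^2$. Assume that $H_m(A,0)$ has domain $H^1$ and is self-adjoint. Let $\phi_{\rm am}\in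 L^2_{\rm loc}(\mathbb R^d;\mathbb R)$ be $C^\infty$ on $\mathbb R^d\setminus\{0\}$ and let $V_{\rm am}=i\beta(\boldsymbol\alpha\cdot\nabla)\phi_{\rm am}$. Assume that there are constants $\varepsilon_1,\varepsilon_2,\varepsilon_3\ge 0$ with $$\frac{4d-6}{d-2}\,\varepsilon_1+\frac{16d-16}{d-2}\,\varepsilon_2+\frac{8d-8}{(d-2)^2}\,\varepsilon_2^2+\frac{4d-4}{d-2}\,\varepsilon_3<2,$$ such that $$\sup_{x\ne 0}|x|\,|\nabla\phi_{\rm am}(x)|\le\varepsilon_2$$ and, for every $\psi\in H^1$, $$\int|x|^2|B|^2|\psi|^2\le\varepsilon_1^2\|\nabla_A\psi\|^2,\qquad \int|x|^2|\Delta\phi_{\rm am}|^2|\psi|^2\le\varepsilon_3^2\|\nabla_A\psi\|^2 .$$ Then $H_m(A,V_{\rm am})$ has no eigenvalues: there are no $\lambda\in\mathbb C$ and $\psi\neq 0$ in its domain with $H_m(A,V_{\rm am})\psi=\lambda\psi$. -/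

import Mathlib

open MeasureTheory
open scoped ContDiff ENNReal

noncomputable section

namespace AnomalousDirac

/-- The Euclidean space `ℝ^d`. -/
abbrev Space (d : ℕ) := EuclideanSpace ℝ (Fin d)

/-- The number of components `N = 2^⌊(d+1)/2⌋` of a spinor in dimension `d`. -/
abbrev spinorDim (d : ℕ) : ℕ := 2 ^ ((d + 1) / 2)

/-- The spinor space `ℂ^N` with its Euclidean norm. -/
abbrev Spinor (d : ℕ) := EuclideanSpace ℂ (Fin (spinorDim d))

/-- Complex `N × N` matrices. -/
abbrev SpinMatrix (d : ℕ) := Matrix (Fin (spinorDim d)) (Fin (spinorDim d)) ℂ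

/-- The Hilbert space `L²(ℝ^d; ℂ^N)`. -/
abbrev L2Spinor (d : ℕ) := Lp (Spinor d) 2 (volume : Measure (Space d))

/-- The Dirac matrices: Hermitian `N × N` matrices `α₁, …, α_d, β` with
`α_j α_k + α_k α_j = 2 δ_{jk}`, `α_j β + β α_j = 0`, `β² = 1`. -/
structure IsDiracMatrices (d : ℕ) (α : Fin d → SpinMatrix d) (β : SpinMatrix d) : Prop where
  hermitian_alpha : ∀ j, (α j).IsHermitian
  hermitian_beta : β.IsHermitian
  anticomm_alpha : ∀ j k, α j * α k + α k * α j = if j = k then 2 else 0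
  anticomm_alpha_beta : ∀ j, α j * β + β * α j = 0
  beta_sq : β * β = 1

/-- The action of an `N × N` matrix on a spinor. -/
def act {d : ℕ} (M : SpinMatrix d) (v : Spinor d) : Spinor d := Matrix.toEuclideanLin M v

/-- The classical partial derivative `∂_j η` at `x`. -/
def pderiv {d : ℕ} (j : Fin d) (η : Space d → ℝ) (x : Space d) : ℝ :=
  fderiv ℝ η x (EuclideanSpace.single j 1)

/-- `f ∈ L²_loc(ℝ^d)`. -/
def MemL2loc {d : ℕ} {F : Type*} [NormedAddCommGroup F] (f : Space d → F) : Prop :=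
  ∀ K : Set (Space d), IsCompact K → MemLp f 2 (volume.restrict K)

/-- `B` is the distributional magnetic field `B_{jk} = ∂_j A_k - ∂_k A_j` of the magnetic
potential `A`: it is tested against all `η ∈ C_c^∞(ℝ^d)`. -/
def IsMagneticField {d : ℕ} (A : Space d → Space d)
    (B : Space d → Matrix (Fin d) (Fin d) ℝ) : Prop :=
  ∀ j k : Fin d, ∀ η : Space d → ℝ, ContDiff ℝ ∞ η → HasCompactSupport η →
    ∫ x, B x j k * η x = - ∫ x, (A x k * pderiv j η x - A x j * pderiv k η x)

/-- `g` is the weak partial derivative `∂_j f` on `ℝ^d`. -/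
def HasWeakPartial {d : ℕ} (j : Fin d) (f g : Space d → Spinor d) : Prop :=
  ∀ η : Space d → ℝ, ContDiff ℝ ∞ η → HasCompactSupport η →
    ∫ x, pderiv j η x • f x = - ∫ x, η x • g x

variable {d : ℕ}

theorem integrable_test_smul (f : L2Spinor d) {η : Space d → ℝ} (hη : Continuous η)
    (hs : HasCompactSupport η) : Integrable (fun x => η x • f x) :=
  ((Lp.memLp f).locallyIntegrable (by norm_num)).integrable_smul_left_of_hasCompactSupport hη hs

theorem continuous_pderiv {η : Space d → ℝ} (hη : ContDiff ℝ ∞ η) (j : Fin d) :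
    Continuous (pderiv j η) :=
  (hη.continuous_fderiv (by simp)).clm_apply continuous_const

theorem hasCompactSupport_pderiv {η : Space d → ℝ} (hs : HasCompactSupport η) (j : Fin d) :
    HasCompactSupport (pderiv j η) :=
  hs.fderiv_apply ℝ _

theorem HasWeakPartial.unique {j : Fin d} {f : Space d → Spinor d} {g g' : L2Spinor d}
    (h : HasWeakPartial j f g) (h' : HasWeakPartial j f g') : g = g' := by
  apply Lp.ext
  refine ae_eq_of_integral_contDiff_smul_eq ((Lp.memLp g).locallyIntegrable (by norm_num))
    ((Lp.memLp g').locallyIntegrable (by norm_num)) ?_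
  intro η hη hs
  exact neg_injective ((h η hη hs).symm.trans (h' η hη hs))

theorem HasWeakPartial.zero (j : Fin d) :
    HasWeakPartial j ((0 : L2Spinor d) : Space d → Spinor d) (0 : L2Spinor d) := by
  intro η _ _
  have h0 := Lp.coeFn_zero (Spinor d) 2 (volume : Measure (Space d))
  have e1 : ∫ x, pderiv j η x • ((0 : L2Spinor d) : Space d → Spinor d) x = 0 := by
    refine integral_eq_zero_of_ae ?_
    filter_upwards [h0] with x hx
    rw [hx, Pi.zero_apply, smul_zero]
  have e2 : ∫ x, η x • ((0 : L2Spinor d) : Space d → Spinor d) x = 0 := by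
    refine integral_eq_zero_of_ae ?_
    filter_upwards [h0] with x hx
    rw [hx, Pi.zero_apply, smul_zero]
  rw [e1, e2, neg_zero]

theorem HasWeakPartial.add {j : Fin d} {f f' g g' : L2Spinor d}
    (h : HasWeakPartial j f g) (h' : HasWeakPartial j f' g') :
    HasWeakPartial j (f + f' : L2Spinor d) (g + g' : L2Spinor d) := by
  intro η hη hs
  have e1 : ∫ x, pderiv j η x • (f + f' : L2Spinor d) x
      = ∫ x, (pderiv j η x • f x + pderiv j η x • f' x) := by
    refine integral_congr_ae ?_
    filter_upwards [Lp.coeFn_add f f'] with x hx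
    rw [hx, Pi.add_apply, smul_add]
  have e2 : ∫ x, η x • (g + g' : L2Spinor d) x = ∫ x, (η x • g x + η x • g' x) := by
    refine integral_congr_ae ?_
    filter_upwards [Lp.coeFn_add g g'] with x hx
    rw [hx, Pi.add_apply, smul_add]
  rw [e1, e2, integral_add, integral_add, h η hη hs, h' η hη hs, neg_add]
  · exact integrable_test_smul g hη.continuous hs
  · exact integrable_test_smul g' hη.continuous hs
  · exact integrable_test_smul f (continuous_pderiv hη j) (hasCompactSupport_pderiv hs j)
  · exact integrable_test_smul f' (continuous_pderiv hη j) (hasCompactSupport_pderiv hs j)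

theorem HasWeakPartial.smul {j : Fin d} {f g : L2Spinor d} (c : ℂ) (h : HasWeakPartial j f g) :
    HasWeakPartial j (c • f : L2Spinor d) (c • g : L2Spinor d) := by
  intro η hη hs
  have e1 : ∫ x, pderiv j η x • (c • f : L2Spinor d) x = ∫ x, c • (pderiv j η x • f x) := by
    refine integral_congr_ae ?_
    filter_upwards [Lp.coeFn_smul c f] with x hx
    rw [hx, Pi.smul_apply, smul_comm]
  have e2 : ∫ x, η x • (c • g : L2Spinor d) x = ∫ x, c • (η x • g x) := by
    refine integral_congr_ae ?_
    filter_upwards [Lp.coeFn_smul c g] with x hx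
    rw [hx, Pi.smul_apply, smul_comm]
  rw [e1, e2, integral_smul, integral_smul, h η hη hs, smul_neg]

/-- The Sobolev space `H¹(ℝ^d; ℂ^N)`: the elements of `L²` all of whose weak first partial
derivatives are in `L²`. -/
def H1 (d : ℕ) : Submodule ℂ (L2Spinor d) where
  carrier := {ψ | ∀ j : Fin d, ∃ g : L2Spinor d, HasWeakPartial j ψ g}
  zero_mem' := fun j => ⟨0, HasWeakPartial.zero j⟩
  add_mem' := fun hf hg j => by
    obtain ⟨a, ha⟩ := hf j
    obtain ⟨b, hb⟩ := hg j
    exact ⟨a + b, ha.add hb⟩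
  smul_mem' := fun c _ hf j => by
    obtain ⟨a, ha⟩ := hf j
    exact ⟨c • a, ha.smul c⟩

/-- The weak partial derivative `∂_j ψ ∈ L²` of `ψ ∈ H¹`. -/
def weakPartial (j : Fin d) (ψ : H1 d) : L2Spinor d := Classical.choose (ψ.2 j)

theorem hasWeakPartial_weakPartial (j : Fin d) (ψ : H1 d) :
    HasWeakPartial j (ψ : L2Spinor d) (weakPartial j ψ) := Classical.choose_spec (ψ.2 j)

theorem weakPartial_add (j : Fin d) (ψ χ : H1 d) :
    weakPartial j (ψ + χ) = weakPartial j ψ + weakPartial j χ :=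
  (hasWeakPartial_weakPartial j (ψ + χ)).unique
    ((hasWeakPartial_weakPartial j ψ).add (hasWeakPartial_weakPartial j χ))

theorem weakPartial_smul (j : Fin d) (c : ℂ) (ψ : H1 d) :
    weakPartial j (c • ψ) = c • weakPartial j ψ :=
  (hasWeakPartial_weakPartial j (c • ψ)).unique ((hasWeakPartial_weakPartial j ψ).smul c)

/-- The magnetic derivative `∂_j^A ψ = ∂_j ψ - i A_j ψ`. -/
def magPartial (A : Space d → Space d) (j : Fin d) (ψ : H1 d) (x : Space d) : Spinor d :=
  weakPartial j ψ x - (Complex.I * (A x j : ℂ)) • (ψ : L2Spinor d) x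

/-- The magnetic Dirichlet energy `‖∇_A ψ‖² = ∫ ∑_j |∂_j^A ψ|²`, with values in `[0, ∞]`. -/
def magEnergy (A : Space d → Space d) (ψ : H1 d) : ℝ≥0∞ :=
  ∫⁻ x, ∑ j : Fin d, ‖magPartial A j ψ x‖ₑ ^ 2

/-- The function `-i α·∇_A ψ + m β ψ + V ψ`, for `ψ ∈ H¹`. -/
def diracExpr (m : ℝ) (α : Fin d → SpinMatrix d) (β : SpinMatrix d) (A : Space d → Space d)
    (V : Space d → SpinMatrix d) (ψ : H1 d) (x : Space d) : Spinor d :=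
  (-Complex.I) • (∑ j : Fin d, act (α j) (magPartial A j ψ x))
    + (m : ℂ) • act β ((ψ : L2Spinor d) x) + act (V x) ((ψ : L2Spinor d) x)

section linearity

variable (m : ℝ) (α : Fin d → SpinMatrix d) (β : SpinMatrix d) (A : Space d → Space d)
  (V : Space d → SpinMatrix d)

theorem magPartial_add (j : Fin d) (ψ χ : H1 d) :
    magPartial A j (ψ + χ) =ᵐ[volume] fun x => magPartial A j ψ x + magPartial A j χ x := by
  have h1 := Lp.coeFn_add (weakPartial j ψ) (weakPartial j χ)
  have h2 := Lp.coeFn_add (ψ : L2Spinor d) (χ : L2Spinor d)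
  filter_upwards [h1, h2] with x h1 h2
  simp only [magPartial, weakPartial_add, Submodule.coe_add, h1, h2, Pi.add_apply, smul_add]
  abel

theorem magPartial_smul (j : Fin d) (c : ℂ) (ψ : H1 d) :
    magPartial A j (c • ψ) =ᵐ[volume] fun x => c • magPartial A j ψ x := by
  have h1 := Lp.coeFn_smul c (weakPartial j ψ)
  have h2 := Lp.coeFn_smul c (ψ : L2Spinor d)
  filter_upwards [h1, h2] with x h1 h2
  simp only [magPartial, weakPartial_smul, Submodule.coe_smul, h1, h2, Pi.smul_apply, smul_sub]
  rw [smul_comm c]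

theorem diracExpr_add (ψ χ : H1 d) :
    diracExpr m α β A V (ψ + χ) =ᵐ[volume]
      diracExpr m α β A V ψ + diracExpr m α β A V χ := by
  have h1 : ∀ᵐ x, ∀ j : Fin d,
      magPartial A j (ψ + χ) x = magPartial A j ψ x + magPartial A j χ x :=
    ae_all_iff.2 fun j => magPartial_add A j ψ χ
  have h2 := Lp.coeFn_add (ψ : L2Spinor d) (χ : L2Spinor d)
  filter_upwards [h1, h2] with x h1 h2
  simp only [diracExpr, act, h1, Submodule.coe_add, h2, Pi.add_apply, map_add,
    Finset.sum_add_distrib, smul_add]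
  abel

theorem diracExpr_smul (c : ℂ) (ψ : H1 d) :
    diracExpr m α β A V (c • ψ) =ᵐ[volume] c • diracExpr m α β A V ψ := by
  have h1 : ∀ᵐ x, ∀ j : Fin d, magPartial A j (c • ψ) x = c • magPartial A j ψ x :=
    ae_all_iff.2 fun j => magPartial_smul A j c ψ
  have h2 := Lp.coeFn_smul c (ψ : L2Spinor d)
  filter_upwards [h1, h2] with x h1 h2
  simp only [diracExpr, act, h1, Submodule.coe_smul, h2, Pi.smul_apply, map_smul,
    ← Finset.smul_sum, smul_add]
  rw [smul_comm c, smul_comm c (m : ℂ)]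

/-- The domain of `H_m(A,V)`: those `ψ ∈ H¹` for which `-i α·∇_A ψ + m β ψ + V ψ` is in `L²`. -/
def diracDomain : Submodule ℂ (L2Spinor d) where
  carrier := {ψ | ∃ h : ψ ∈ H1 d, MemLp (diracExpr m α β A V ⟨ψ, h⟩) 2 volume}
  zero_mem' := by
    refine ⟨(H1 d).zero_mem, ?_⟩
    have h := diracExpr_smul m α β A V 0 (0 : H1 d)
    rw [zero_smul, zero_smul] at h
    exact (memLp_congr_ae h).2 MemLp.zero
  add_mem' := by
    rintro ψ χ ⟨hψ, h1⟩ ⟨hχ, h2⟩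
    exact ⟨(H1 d).add_mem hψ hχ,
      (memLp_congr_ae (diracExpr_add m α β A V ⟨ψ, hψ⟩ ⟨χ, hχ⟩)).2 (h1.add h2)⟩
  smul_mem' := by
    rintro c ψ ⟨hψ, h1⟩
    exact ⟨(H1 d).smul_mem c hψ,
      (memLp_congr_ae (diracExpr_smul m α β A V c ⟨ψ, hψ⟩)).2 (h1.const_smul c)⟩

/-- The electromagnetic Dirac operator `H_m(A,V) = -i α·∇_A + m β + V` as an unbounded operator
in `L²(ℝ^d; ℂ^N)`. -/
def diracOp : L2Spinor d →ₗ.[ℂ] L2Spinor d where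
  domain := diracDomain m α β A V
  toFun :=
    { toFun := fun ψ => MemLp.toLp (diracExpr m α β A V ⟨ψ.1, ψ.2.1⟩) ψ.2.2
      map_add' := fun ψ χ => by
        rw [← MemLp.toLp_add ψ.2.2 χ.2.2, MemLp.toLp_eq_toLp_iff]
        exact diracExpr_add m α β A V ⟨ψ.1, ψ.2.1⟩ ⟨χ.1, χ.2.1⟩
      map_smul' := fun c ψ => by
        rw [RingHom.id_apply, ← MemLp.toLp_const_smul c ψ.2.2, MemLp.toLp_eq_toLp_iff]
        exact diracExpr_smul m α β A V c ⟨ψ.1, ψ.2.1⟩ }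

end linearity

/-- The point spectrum (set of eigenvalues) of an unbounded operator. -/
def pointSpectrum {H : Type*} [AddCommGroup H] [Module ℂ H] (T : H →ₗ.[ℂ] H) : Set ℂ :=
  {z | ∃ ψ : T.domain, (ψ : H) ≠ 0 ∧ T ψ = z • (ψ : H)}

/-- The anomalous magnetic potential `V_am = i β (α·∇) φ`. -/
def anomalousPotential (α : Fin d → SpinMatrix d) (β : SpinMatrix d) (φ : Space d → ℝ)
    (x : Space d) : SpinMatrix d :=
  Complex.I • (β * ∑ j : Fin d, (pderiv j φ x : ℂ) • α j)

/-- The operator norm `|M|` of a real `d × d` matrix with respect to the Euclidean norm. -/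
def opNorm (M : Matrix (Fin d) (Fin d) ℝ) : ℝ := ‖Matrix.toEuclideanCLM (𝕜 := ℝ) M‖

end AnomalousDirac

end

/-! The proof is a virial argument for the squared Dirac equation. Let `ψ` be an eigenfunction for
`z`, and write `D = ∇_A`, `η = -iα·Dψ`, `p = ∇φ`, `X = ‖Dψ‖`, `Y = ‖η‖`. Since `-iα·∇_A` is
symmetric and the matrices `β` and `iβ(α·p)` are Hermitian, `z` is real. The eigenvalue equation
reads `η = (z - mβ - iβ α·p)ψ`. Away from the origin the right side is locally in `H¹`, so `-iα·∇_A`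
can be applied once more, and the Clifford relations give `(-iα·∇_A)η = (z² - m²)ψ - Kψ`, with `Kψ =
|p|²ψ - (Δφ)βψ + 2β(i α·p η - p·Dψ)`. Neither `z` nor `m` occurs in the coefficients of `K`
(`IsDiracMatrices.diracField_eq`).

Pair this with the dilation generator `Λψ = x·Dψ + (d/2)ψ` and take real parts. `Λ` is
skew-symmetric, so the term `(z² - m²)ψ` drops out (`MagSobolev.integral_dilation`). Commuting the
Dirac operator with `Λ` produces its own scaling and a magnetic term (`integral_virialIntegrand`),
whence `Y² = Re⟨α·(Bx)η, ψ⟩ - Re⟨Kψ, Λψ⟩`. The right side is estimated by the magnetic Hardy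
inequality `‖ψ/|x|‖ ≤ 2/(d-2) X`, by `‖Λψ/|x|‖ ≤ ρX` with `ρ = 2` for `d = 3` and `ρ = 1` for `d ≥
4`, and by the three smallness hypotheses; this is `MagSobolev.virial_le`. In the other direction,
the square of the magnetic Dirac operator differs from the magnetic Laplacian only by a spin term in
`B`, so `X² ≤ Y² + κε₁X²` with `κ = 2` for `d = 3` and `κ = d/(d-2)` for `d ≥ 4`
(`MagSobolev.energy_sq_le`). The Hardy inequality forces `X > 0`, and the two inequalities for `Y/X`
contradict each other under the smallness condition (`absurd_of_virial_le`).

The analytic difficulty is that `A` is only in `L²_loc` and `φ` may be singular at the origin. The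
hypothesis on the domain of `H_m(A,0)` says that each `A_j` multiplies `H¹` into `L²`; by the closed
graph theorem this multiplication is bounded, so test functions are dense for the magnetic norm and
every identity need only be checked on them. The commutator of two magnetic derivatives is used in
an integrated form without second derivatives (`MagSobolev.integral_commutator`), where `B` enters
through its distributional definition. Weights are first localized to annuli; their gradients are of
size `C/|x|` uniformly, so the Hardy inequality dominates the error terms and they vanish in the
limit. -/

namespace AnomalousDirac

open Filter Topology

/-! ### Square integrable functions and their norms -/

section SquareIntegrable

variable {X : Type*} [MeasurableSpace X] {μ : Measure X}
  {F : Type*} [NormedAddCommGroup F] {G : Type*} [NormedAddCommGroup G]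

theorem integrable_norm_mul_norm {f : X → F} {g : X → G} (hf : MemLp f 2 μ) (hg : MemLp g 2 μ) :
    Integrable (fun x => ‖f x‖ * ‖g x‖) μ :=
  hf.norm.integrable_mul hg.norm

theorem integrable_norm_sq {f : X → F} (hf : MemLp f 2 μ) :
    Integrable (fun x => ‖f x‖ ^ 2) μ :=
  hf.norm.integrable_sq

theorem integrable_inner_of_memLp [InnerProductSpace ℂ F] {f g : X → F} (hf : MemLp f 2 μ)
    (hg : MemLp g 2 μ) : Integrable (fun x => inner ℂ (f x) (g x)) μ :=
  (integrable_norm_mul_norm hf hg).mono' (hf.1.inner hg.1)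
    (Eventually.of_forall fun _ => norm_inner_le_norm _ _)

theorem memLp_smul_of_bdd [NormedSpace ℝ F] {w : X → ℝ} {f : X → F}
    (hw : AEStronglyMeasurable w μ) {C : ℝ} (hC : ∀ x, |w x| ≤ C) (hf : MemLp f 2 μ) :
    MemLp (fun x => w x • f x) 2 μ :=
  hf.of_le_mul (hw.smul hf.1) (c := C) (Eventually.of_forall fun x => by
    rw [norm_smul, Real.norm_eq_abs]; gcongr; exact hC x)

/-- The `L²` norm, as a real number. -/
noncomputable def l2norm (μ : Measure X) (f : X → F) : ℝ := √(∫ x, ‖f x‖ ^ 2 ∂μ)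

theorem l2norm_nonneg (f : X → F) : 0 ≤ l2norm μ f := Real.sqrt_nonneg _

theorem l2norm_sq (f : X → F) : l2norm μ f ^ 2 = ∫ x, ‖f x‖ ^ 2 ∂μ :=
  Real.sq_sqrt (integral_nonneg fun _ => by positivity)

theorem integral_norm_mul_norm_le {f : X → F} {g : X → G} (hf : MemLp f 2 μ) (hg : MemLp g 2 μ) :
    ∫ x, ‖f x‖ * ‖g x‖ ∂μ ≤ l2norm μ f * l2norm μ g := by
  have h := integral_mul_le_Lp_mul_Lq_of_nonneg (μ := μ) (p := 2) (q := 2)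
    ⟨by norm_num, by norm_num, by norm_num⟩ (f := fun x => ‖f x‖) (g := fun x => ‖g x‖)
    (Eventually.of_forall fun _ => norm_nonneg _) (Eventually.of_forall fun _ => norm_nonneg _)
    (by simpa using hf.norm) (by simpa using hg.norm)
  simpa [l2norm, Real.sqrt_eq_rpow] using h

theorem l2norm_le_of_sq_le {f : X → F} {C : ℝ} (hC : 0 ≤ C) (h : ∫ x, ‖f x‖ ^ 2 ∂μ ≤ C ^ 2) :
    l2norm μ f ≤ C := by
  rw [l2norm]; exact (Real.sqrt_le_left hC).2 h

theorem l2norm_mono {f : X → F} {g : X → G} (hf : MemLp f 2 μ) (hg : MemLp g 2 μ)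
    (h : ∀ᵐ x ∂μ, ‖f x‖ ≤ ‖g x‖) : l2norm μ f ≤ l2norm μ g := by
  refine Real.sqrt_le_sqrt (integral_mono_ae (integrable_norm_sq hf) (integrable_norm_sq hg) ?_)
  filter_upwards [h] with x hx
  gcongr

theorem tendsto_eLpNorm_of_le {P : ℕ → X → F} {Q : ℕ → X → G} (C : ℝ)
    (h : ∀ n, ∀ᵐ x ∂μ, ‖P n x‖ ≤ C * ‖Q n x‖)
    (hQ : Tendsto (fun n => eLpNorm (Q n) 2 μ) atTop (𝓝 0)) :
    Tendsto (fun n => eLpNorm (P n) 2 μ) atTop (𝓝 0) := by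
  have h2 : Tendsto (fun n => ENNReal.ofReal C * eLpNorm (Q n) 2 μ) atTop (𝓝 0) := by
    have := ENNReal.Tendsto.const_mul (a := ENNReal.ofReal C) hQ (Or.inr ENNReal.ofReal_ne_top)
    simpa using this
  exact tendsto_of_tendsto_of_tendsto_of_le_of_le tendsto_const_nhds h2 (fun _ => zero_le)
    fun n => eLpNorm_le_mul_eLpNorm_of_ae_le_mul (h n) 2

/-- Joint continuity of the `L²` inner product. It carries the integral identities from test
functions to `H¹`. -/
theorem tendsto_integral_inner [InnerProductSpace ℂ F] {P Q : ℕ → X → F} {P' Q' : X → F}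
    (hP : ∀ n, MemLp (P n) 2 μ) (hQ : ∀ n, MemLp (Q n) 2 μ) (hP' : MemLp P' 2 μ)
    (hQ' : MemLp Q' 2 μ) (h1 : Tendsto (fun n => eLpNorm (P n - P') 2 μ) atTop (𝓝 0))
    (h2 : Tendsto (fun n => eLpNorm (Q n - Q') 2 μ) atTop (𝓝 0)) :
    Tendsto (fun n => ∫ x, inner ℂ (P n x) (Q n x) ∂μ) atTop
      (𝓝 (∫ x, inner ℂ (P' x) (Q' x) ∂μ)) := by
  have key : ∀ {f g : X → F} (hf : MemLp f 2 μ) (hg : MemLp g 2 μ),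
      inner ℂ (hf.toLp f) (hg.toLp g) = ∫ x, inner ℂ (f x) (g x) ∂μ := by
    intro f g hf hg
    rw [L2.inner_def]
    refine integral_congr_ae ?_
    filter_upwards [hf.coeFn_toLp, hg.coeFn_toLp] with x h1 h2
    rw [h1, h2]
  have e1 := (Lp.tendsto_Lp_iff_tendsto_eLpNorm'' P hP P' hP').2 h1
  have e2 := (Lp.tendsto_Lp_iff_tendsto_eLpNorm'' Q hQ Q' hQ').2 h2
  have := e1.inner (𝕜 := ℂ) e2
  simpa only [key] using this

end SquareIntegrable

/-! ### Dirac matrices acting on spinors -/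

section Matrices

variable {d : ℕ}

theorem act_add (M : SpinMatrix d) (u v : Spinor d) : act M (u + v) = act M u + act M v :=
  map_add _ _ _

theorem act_sub (M : SpinMatrix d) (u v : Spinor d) : act M (u - v) = act M u - act M v :=
  map_sub _ _ _

theorem act_neg (M : SpinMatrix d) (u : Spinor d) : act M (-u) = -act M u :=
  map_neg _ _

theorem act_smul (M : SpinMatrix d) (c : ℂ) (u : Spinor d) : act M (c • u) = c • act M u :=
  map_smul _ _ _

theorem act_real_smul (M : SpinMatrix d) (c : ℝ) (u : Spinor d) : act M (c • u) = c • act M u :=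
  LinearMap.map_smul_of_tower _ _ _

theorem act_sum {ι : Type*} (s : Finset ι) (M : SpinMatrix d) (u : ι → Spinor d) :
    act M (∑ i ∈ s, u i) = ∑ i ∈ s, act M (u i) := map_sum _ _ _

theorem add_act (M N : SpinMatrix d) (u : Spinor d) : act (M + N) u = act M u + act N u := by
  simp [act]

theorem zero_act (u : Spinor d) : act (0 : SpinMatrix d) u = 0 := by
  simp [act]

theorem smul_act (c : ℂ) (M : SpinMatrix d) (u : Spinor d) : act (c • M) u = c • act M u := by
  simp [act]

theorem sum_act {ι : Type*} (s : Finset ι) (M : ι → SpinMatrix d) (u : Spinor d) :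
    act (∑ i ∈ s, M i) u = ∑ i ∈ s, act (M i) u := by
  simp [act, map_sum]

theorem one_act (u : Spinor d) : act (1 : SpinMatrix d) u = u := by
  simp [act, Matrix.toLpLin_one]

theorem mul_act (M N : SpinMatrix d) (u : Spinor d) : act (M * N) u = act M (act N u) := by
  simp [act, Matrix.toLpLin_apply]

theorem inner_act_left (M : SpinMatrix d) (u v : Spinor d) :
    inner ℂ (act M u) v = inner ℂ u (act M.conjTranspose v) := by
  rw [act, act, Matrix.toEuclideanLin_conjTranspose_eq_adjoint, LinearMap.adjoint_inner_right]

theorem _root_.Matrix.IsHermitian.inner_act {M : SpinMatrix d} (h : M.IsHermitian)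
    (u v : Spinor d) : inner ℂ (act M u) v = inner ℂ u (act M v) := by
  rw [inner_act_left, h]

/-- The action of a matrix on spinors as a continuous linear map. -/
noncomputable def actCLM (M : SpinMatrix d) : Spinor d →L[ℂ] Spinor d :=
  LinearMap.toContinuousLinearMap (Matrix.toEuclideanLin M)

theorem actCLM_apply (M : SpinMatrix d) (u : Spinor d) : actCLM M u = act M u := rfl

theorem memLp_act (M : SpinMatrix d) {f : Space d → Spinor d} (hf : MemLp f 2 volume) :
    MemLp (fun x => act M (f x)) 2 volume :=
  (actCLM M).comp_memLp' hf

variable {α : Fin d → SpinMatrix d} {β : SpinMatrix d}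

theorem IsDiracMatrices.anticomm_act (h : IsDiracMatrices d α β) (j k : Fin d) (u : Spinor d) :
    act (α j) (act (α k) u) + act (α k) (act (α j) u) = if j = k then (2 : ℂ) • u else 0 := by
  rw [← mul_act, ← mul_act, ← add_act, h.anticomm_alpha]
  split_ifs
  · rw [show (2 : SpinMatrix d) = (2 : ℂ) • 1 from by
      rw [← Matrix.diagonal_one, ← Matrix.diagonal_smul]
      ext
      simp [Matrix.diagonal_apply, Matrix.ofNat_apply], smul_act, one_act]
  · exact zero_act u

theorem IsDiracMatrices.act_act_self (h : IsDiracMatrices d α β) (j : Fin d) (u : Spinor d) :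
    act (α j) (act (α j) u) = u := by
  have := h.anticomm_act j j u
  rw [if_pos rfl, ← two_smul ℂ] at this
  exact smul_right_injective _ (two_ne_zero (α := ℂ)) this

theorem IsDiracMatrices.act_beta_alpha (h : IsDiracMatrices d α β) (j : Fin d) (u : Spinor d) :
    act β (act (α j) u) = -act (α j) (act β u) := by
  have := congrArg (fun M => act M u) (h.anticomm_alpha_beta j)
  simp only [add_act, mul_act, zero_act] at this
  exact eq_neg_of_add_eq_zero_right this

theorem IsDiracMatrices.act_beta_beta (h : IsDiracMatrices d α β) (u : Spinor d) :
    act β (act β u) = u := by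
  rw [← mul_act, h.beta_sq, one_act]

theorem IsDiracMatrices.norm_act_beta (h : IsDiracMatrices d α β) (u : Spinor d) :
    ‖act β u‖ = ‖u‖ := by
  have : inner ℂ (act β u) (act β u) = inner ℂ u u := by
    rw [h.hermitian_beta.inner_act, h.act_beta_beta]
  rw [inner_self_eq_norm_sq_to_K, inner_self_eq_norm_sq_to_K] at this
  have h2 : ‖act β u‖ ^ 2 = ‖u‖ ^ 2 := by exact_mod_cast this
  exact (pow_left_inj₀ (norm_nonneg _) (norm_nonneg _) two_ne_zero).1 h2

theorem IsDiracMatrices.norm_act_alpha (h : IsDiracMatrices d α β) (j : Fin d) (u : Spinor d) :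
    ‖act (α j) u‖ = ‖u‖ := by
  have : inner ℂ (act (α j) u) (act (α j) u) = inner ℂ u u := by
    rw [(h.hermitian_alpha j).inner_act, h.act_act_self]
  rw [inner_self_eq_norm_sq_to_K, inner_self_eq_norm_sq_to_K] at this
  have h2 : ‖act (α j) u‖ ^ 2 = ‖u‖ ^ 2 := by exact_mod_cast this
  exact (pow_left_inj₀ (norm_nonneg _) (norm_nonneg _) two_ne_zero).1 h2

/-- The Clifford action `α·w` of a real vector. -/
noncomputable def clifford (α : Fin d → SpinMatrix d) (w : Fin d → ℝ) (u : Spinor d) : Spinor d :=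
  ∑ j, (w j : ℂ) • act (α j) u

theorem IsDiracMatrices.inner_clifford (h : IsDiracMatrices d α β) (w : Fin d → ℝ)
    (u v : Spinor d) : inner ℂ (clifford α w u) v = inner ℂ u (clifford α w v) := by
  simp only [clifford, sum_inner, inner_sum, inner_smul_left, inner_smul_right,
    (h.hermitian_alpha _).inner_act, Complex.conj_ofReal]

/-- Adding the double sum to itself with the indices exchanged leaves only anticommutators, which
are diagonal. Consequently `α·w` is `|w|` times an isometry, so later estimates lose nothing in the
spinor variable. -/
theorem IsDiracMatrices.clifford_clifford (h : IsDiracMatrices d α β) (w : Fin d → ℝ)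
    (u : Spinor d) : clifford α w (clifford α w u) = ((∑ j, w j ^ 2 : ℝ) : ℂ) • u := by
  have e : clifford α w (clifford α w u)
      = ∑ j, ∑ k, ((w j * w k : ℝ) : ℂ) • act (α j) (act (α k) u) := by
    simp only [clifford, act_sum, act_smul, Finset.smul_sum, smul_smul, Complex.ofReal_mul]
  have e' : clifford α w (clifford α w u)
      = ∑ j, ∑ k, ((w j * w k : ℝ) : ℂ) • act (α k) (act (α j) u) := by
    rw [e, Finset.sum_comm]
    simp only [mul_comm]
  have hs : (2 : ℂ) • clifford α w (clifford α w u)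
      = (2 : ℂ) • ((∑ j, w j ^ 2 : ℝ) : ℂ) • u := by
    rw [two_smul]
    nth_rw 1 [e]
    rw [e', ← Finset.sum_add_distrib]
    simp only [← Finset.sum_add_distrib, ← smul_add, h.anticomm_act]
    simp only [smul_ite, smul_zero, Finset.sum_ite_eq, Finset.mem_univ, if_true]
    rw [Complex.ofReal_sum, Finset.sum_smul, Finset.smul_sum]
    refine Finset.sum_congr rfl fun j _ => ?_
    rw [smul_comm, pow_two]
  exact smul_right_injective _ (two_ne_zero (α := ℂ)) hs

theorem IsDiracMatrices.norm_clifford_sq (h : IsDiracMatrices d α β) (w : Fin d → ℝ)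
    (u : Spinor d) : ‖clifford α w u‖ ^ 2 = (∑ j, w j ^ 2) * ‖u‖ ^ 2 := by
  have : inner ℂ (clifford α w u) (clifford α w u) = ((∑ j, w j ^ 2 : ℝ) : ℂ) * inner ℂ u u := by
    rw [h.inner_clifford, h.clifford_clifford, inner_smul_right]
  rw [inner_self_eq_norm_sq_to_K, inner_self_eq_norm_sq_to_K] at this
  refine Complex.ofReal_injective ?_
  rw [Complex.ofReal_mul, Complex.ofReal_pow, Complex.ofReal_pow]
  exact this

theorem IsDiracMatrices.norm_clifford (h : IsDiracMatrices d α β) (w : Space d)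
    (u : Spinor d) : ‖clifford α w u‖ = ‖w‖ * ‖u‖ := by
  have h1 := h.norm_clifford_sq w u
  have h2 : ‖w‖ ^ 2 = ∑ j, w j ^ 2 := by
    rw [EuclideanSpace.norm_sq_eq]; simp
  rw [← h2, ← mul_pow] at h1
  exact (pow_left_inj₀ (norm_nonneg _) (by positivity) two_ne_zero).1 h1

end Matrices

/-! ### Density of test functions in `H¹` -/

section Mollification

theorem eLpNorm_two_sq {X F : Type*} [MeasurableSpace X] {μ : Measure X} [NormedAddCommGroup F]
    (f : X → F) : eLpNorm f 2 μ ^ 2 = ∫⁻ x, ‖f x‖ₑ ^ 2 ∂μ := by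
  have := eLpNorm_nnreal_pow_eq_lintegral (f := f) (μ := μ) (p := 2) (by norm_num)
  simpa using this

/-- Cauchy–Schwarz for the measure with density `p`, after the splitting `p g = √p · √p g`. -/
theorem lintegral_mul_sq_le {X : Type*} [MeasurableSpace X] {μ : Measure X} {p g : X → ℝ≥0∞}
    (hp : AEMeasurable p μ) (hg : AEMeasurable g μ) :
    (∫⁻ x, p x * g x ∂μ) ^ 2 ≤ (∫⁻ x, p x ∂μ) * ∫⁻ x, p x * g x ^ 2 ∂μ := by
  have h := ENNReal.lintegral_mul_le_Lp_mul_Lq μ (p := 2) (q := 2)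
    ⟨by norm_num, by norm_num, by norm_num⟩ (f := fun x => p x ^ (1 / 2 : ℝ))
    (g := fun x => p x ^ (1 / 2 : ℝ) * g x) (hp.pow_const _) ((hp.pow_const _).mul hg)
  have e1 : ∀ a : ℝ≥0∞, (a ^ (1 / 2 : ℝ)) ^ (2 : ℝ) = a := fun a => by
    rw [← ENNReal.rpow_mul]; norm_num
  have e2 : ∀ a : ℝ≥0∞, a ^ (1 / 2 : ℝ) * a ^ (1 / 2 : ℝ) = a := fun a => by
    rw [← pow_two, ← ENNReal.rpow_two, e1]
  simp only [Pi.mul_apply, ENNReal.mul_rpow_of_nonneg _ _ (zero_le_two : (0 : ℝ) ≤ 2), e1,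
    ← mul_assoc, e2, ENNReal.rpow_two] at h
  calc _ ≤ _ := pow_le_pow_left' h 2
    _ = _ := by rw [mul_pow, ← ENNReal.rpow_two, ← ENNReal.rpow_two, e1, e1]

variable {d : ℕ}

theorem tendsto_eLpNorm_translate_sub {f : Space d → Spinor d} (hf : MemLp f 2 volume) :
    Tendsto (fun y : Space d => eLpNorm (fun x => f (x - y) - f x) 2 volume) (𝓝 0) (𝓝 0) := by
  let g : C(Space d, C(Space d, Space d)) :=
    ContinuousMap.curry ⟨fun p : Space d × Space d => p.2 - p.1, by fun_prop⟩
  have hg : ∀ y, MeasurePreserving (g y) (volume : Measure (Space d)) volume :=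
    fun y => measurePreserving_sub_right volume y
  have h := Filter.Tendsto.compMeasurePreservingLp (l := 𝓝 (0 : Space d)) (p := 2)
    (f := fun _ => hf.toLp f) (f₀ := hf.toLp f) tendsto_const_nhds (g.continuous.tendsto 0) hg (hg 0)
    (by norm_num)
  rw [Lp.tendsto_Lp_iff_tendsto_eLpNorm'] at h
  refine h.congr fun y => eLpNorm_congr_ae ?_
  have h1 := Lp.coeFn_compMeasurePreserving (hf.toLp f) (hg y)
  have h2 := Lp.coeFn_compMeasurePreserving (hf.toLp f) (hg 0)
  have h3 := (hg y).quasiMeasurePreserving.ae_eq_comp hf.coeFn_toLp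
  have h4 := (hg 0).quasiMeasurePreserving.ae_eq_comp hf.coeFn_toLp
  filter_upwards [h1, h2, h3, h4] with x h1 h2 h3 h4
  rw [Pi.sub_apply, h1, h2, h3, h4]
  simp [g]

open scoped Convolution

/-- The kernel is a probability density, so the difference is an average of `f(· - t) - f` over `‖t‖
< rOut`. Cauchy–Schwarz moves the square inside the average, and Tonelli exchanges the integrals. -/
theorem eLpNorm_convolution_sub_le {f : Space d → Spinor d} (hf : MemLp f 2 volume)
    (ρ : ContDiffBump (0 : Space d)) {ε : ℝ≥0∞}
    (h : ∀ y : Space d, ‖y‖ < ρ.rOut → eLpNorm (fun x => f (x - y) - f x) 2 volume ≤ ε) :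
    eLpNorm ((ρ.normed volume ⋆[ContinuousLinearMap.lsmul ℝ ℝ, volume] f) - f) 2 volume ≤ ε := by
  set r : Space d → ℝ := ρ.normed volume with hr
  have hrc : Continuous r := ρ.continuous_normed
  have hrs : HasCompactSupport r := ρ.hasCompactSupport_normed
  have hri : Integrable r volume := hrc.integrable_of_hasCompactSupport hrs
  have hr1 : ∫⁻ t, ‖r t‖ₑ = 1 := by
    have := ofReal_integral_norm_eq_lintegral_enorm hri
    rw [← this]
    have e : ∀ t, ‖r t‖ = r t := fun t => Real.norm_of_nonneg (ρ.nonneg_normed t)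
    simp only [e]
    rw [hr, ρ.integral_normed, ENNReal.ofReal_one]
  have hloc : LocallyIntegrable f volume := hf.locallyIntegrable (by norm_num)
  have hconv := hrs.convolutionExists_left (ContinuousLinearMap.lsmul ℝ ℝ) (f := r) (g := f)
    (μ := volume) hrc hloc
  have pw : ∀ x, ((r ⋆[ContinuousLinearMap.lsmul ℝ ℝ, volume] f) - f) x
      = ∫ t, r t • (f (x - t) - f x) := by
    intro x
    have i1 : Integrable (fun t => r t • f (x - t)) volume := hconv x
    have i2 : Integrable (fun t => r t • f x) volume := hri.smul_const _
    simp only [smul_sub]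
    rw [integral_sub i1 i2, integral_smul_const, Pi.sub_apply]
    simp [convolution_def, hr, ρ.integral_normed]
  have hm : AEStronglyMeasurable (fun p : Space d × Space d => f (p.1 - p.2) - f p.1)
      (volume.prod volume) := by
    refine AEStronglyMeasurable.sub ?_ hf.1.comp_fst
    exact hf.1.comp_quasiMeasurePreserving (quasiMeasurePreserving_sub_of_right_invariant _ _)
  have hms : ∀ x, AEMeasurable (fun t => ‖f (x - t) - f x‖ₑ) volume := by
    intro x
    refine AEStronglyMeasurable.enorm (AEStronglyMeasurable.sub ?_ aestronglyMeasurable_const)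
    exact hf.1.comp_quasiMeasurePreserving (quasiMeasurePreserving_sub_left volume x)
  have hrm : AEMeasurable (fun t => ‖r t‖ₑ) volume := hrc.measurable.enorm.aemeasurable
  refine (ENNReal.pow_le_pow_left_iff two_ne_zero).1 ?_
  rw [eLpNorm_two_sq]
  calc ∫⁻ x, ‖((r ⋆[ContinuousLinearMap.lsmul ℝ ℝ, volume] f) - f) x‖ₑ ^ 2
      ≤ ∫⁻ x, ∫⁻ t, ‖r t‖ₑ * ‖f (x - t) - f x‖ₑ ^ 2 := by
        refine lintegral_mono fun x => ?_
        rw [pw x]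
        have h1 : ‖∫ t, r t • (f (x - t) - f x)‖ₑ ≤ ∫⁻ t, ‖r t‖ₑ * ‖f (x - t) - f x‖ₑ := by
          refine (enorm_integral_le_lintegral_enorm _).trans (le_of_eq ?_)
          simp only [enorm_smul]
        refine (pow_le_pow_left' h1 2).trans ((lintegral_mul_sq_le hrm (hms x)).trans ?_)
        rw [hr1, one_mul]
    _ = ∫⁻ t, ∫⁻ x, ‖r t‖ₑ * ‖f (x - t) - f x‖ₑ ^ 2 := by
        refine lintegral_lintegral_swap ?_
        exact (hrm.comp_snd).mul (hm.enorm.pow_const 2)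
    _ ≤ ∫⁻ t, ‖r t‖ₑ * ε ^ 2 := by
        refine lintegral_mono fun t => ?_
        rw [lintegral_const_mul' _ _ enorm_ne_top]
        by_cases ht : ‖t‖ < ρ.rOut
        · gcongr
          rw [← eLpNorm_two_sq (fun x => f (x - t) - f x)]
          exact pow_le_pow_left' (h t ht) 2
        · have : r t = 0 := by
            have := ρ.support_normed_eq (μ := volume)
            by_contra h0
            have h2 : t ∈ Function.support r := h0
            rw [hr, this, Metric.mem_ball, dist_zero_right] at h2
            exact ht h2
          simp [this]
    _ = ε ^ 2 := by rw [lintegral_mul_const'' _ hrm, hr1, one_mul]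

/-- Standard mollifiers: normed bump functions of radius `1 / (n + 1)`. -/
noncomputable def mollifier (d n : ℕ) : ContDiffBump (0 : Space d) where
  rIn := 1 / (n + 2)
  rOut := 1 / (n + 1)
  rIn_pos := by positivity
  rIn_lt_rOut := one_div_lt_one_div_of_lt (by positivity) (by linarith)

/-- The mollification of a function. -/
noncomputable def mollify (n : ℕ) (f : Space d → Spinor d) : Space d → Spinor d :=
  (mollifier d n).normed volume ⋆[ContinuousLinearMap.lsmul ℝ ℝ, volume] f

theorem tendsto_eLpNorm_mollify_sub {f : Space d → Spinor d} (hf : MemLp f 2 volume) :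
    Tendsto (fun n => eLpNorm (mollify n f - f) 2 volume) atTop (𝓝 0) := by
  rw [ENNReal.tendsto_nhds_zero]
  intro ε hε
  have h1 := (ENNReal.tendsto_nhds_zero.1 (tendsto_eLpNorm_translate_sub hf)) ε hε
  obtain ⟨δ, hδ, hb⟩ := Metric.eventually_nhds_iff.1 h1
  have h2 : ∀ᶠ n : ℕ in atTop, (1 / ((n : ℝ) + 1)) < δ :=
    (tendsto_one_div_add_atTop_nhds_zero_nat (𝕜 := ℝ)).eventually (gt_mem_nhds hδ)
  filter_upwards [h2] with n hn
  refine eLpNorm_convolution_sub_le hf _ fun y hy => hb ?_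
  rw [dist_zero_right]
  exact lt_trans hy hn

theorem contDiff_mollify (n : ℕ) {f : Space d → Spinor d} (hf : MemLp f 2 volume) :
    ContDiff ℝ ∞ (mollify n f) :=
  HasCompactSupport.contDiff_convolution_left _ (mollifier d n).hasCompactSupport_normed
    (mollifier d n).contDiff_normed (hf.locallyIntegrable (by norm_num))

theorem memLp_mollify (n : ℕ) {f : Space d → Spinor d} (hf : MemLp f 2 volume) :
    MemLp (mollify n f) 2 volume := by
  have h1 : MemLp (mollify n f - f) 2 volume := by
    refine ⟨(contDiff_mollify n hf).continuous.aestronglyMeasurable.sub hf.1, ?_⟩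
    -- Only finiteness is wanted, so each translation difference is bounded crudely by twice the
    -- norm of `f`.
    refine (eLpNorm_convolution_sub_le hf (mollifier d n)
      (ε := eLpNorm f 2 volume + eLpNorm f 2 volume) fun y _ => ?_).trans_lt
      (ENNReal.add_lt_top.2 ⟨hf.2, hf.2⟩)
    have hp := measurePreserving_sub_right (volume : Measure (Space d)) y
    have e := eLpNorm_comp_measurePreserving (p := 2) hf.1 hp
    refine (eLpNorm_sub_le (f := fun x => f (x - y)) (g := f)
      (hf.1.comp_measurePreserving hp) hf.1 (by norm_num)).trans ?_
    rw [← e]; rfl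
  simpa using h1.add hf

/-- The derivative falls on the kernel. As a function of the integration variable, the kernel `t ↦ r
(x - t)` is a test function whose derivative carries a minus sign, which cancels the one in the weak
derivative. -/
theorem fderiv_mollify (n : ℕ) {f g : Space d → Spinor d} {j : Fin d} (hf : MemLp f 2 volume)
    (h : HasWeakPartial j f g) (x : Space d) :
    fderiv ℝ (mollify n f) x (EuclideanSpace.single j 1) = mollify n g x := by
  set r : Space d → ℝ := (mollifier d n).normed volume with hr
  have hrs : HasCompactSupport r := (mollifier d n).hasCompactSupport_normed
  have hrd : ContDiff ℝ ∞ r := (mollifier d n).contDiff_normed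
  have hloc : LocallyIntegrable f volume := hf.locallyIntegrable (by norm_num)
  have h1 := hrs.hasFDerivAt_convolution_left (ContinuousLinearMap.lsmul ℝ ℝ) (μ := volume)
    (hrd.of_le (by simp)) hloc x
  have e1 : fderiv ℝ (mollify n f) x = _ := h1.fderiv
  rw [e1, convolution_def]
  have hex := (hrs.fderiv ℝ).convolutionExists_left
    ((ContinuousLinearMap.lsmul ℝ ℝ : ℝ →L[ℝ] Spinor d →L[ℝ] Spinor d).precompL (Space d))
    (μ := volume) (hrd.continuous_fderiv (by simp)) hloc x
  rw [ContinuousLinearMap.integral_apply hex]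
  have e2 : ∀ t, ((ContinuousLinearMap.lsmul ℝ ℝ : ℝ →L[ℝ] Spinor d →L[ℝ] Spinor d).precompL
      (Space d) (fderiv ℝ r t) (f (x - t))) (EuclideanSpace.single j 1)
      = pderiv j r t • f (x - t) := by
    intro t
    simp [pderiv]
  simp only [e2]
  have e3 : ∫ t, pderiv j r t • f (x - t) = ∫ t, pderiv j r (x - t) • f t := by
    rw [← integral_sub_left_eq_self _ volume x]
    simp
  rw [e3, mollify, convolution_lsmul_swap]
  have ht : ContDiff ℝ ∞ (fun t => r (x - t)) := hrd.comp (contDiff_const.sub contDiff_id)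
  have hts : HasCompactSupport (fun t => r (x - t)) :=
    hrs.comp_homeomorph (Homeomorph.subLeft x)
  have hp : ∀ t, pderiv j (fun t => r (x - t)) t = -pderiv j r (x - t) := by
    intro t
    have hd : HasFDerivAt (fun t => r (x - t)) ((fderiv ℝ r (x - t)).comp
        (-ContinuousLinearMap.id ℝ (Space d))) t := by
      refine HasFDerivAt.comp t ((hrd.differentiable (by simp)) (x - t)).hasFDerivAt ?_
      simpa using (hasFDerivAt_id t).const_sub x
    rw [pderiv, hd.fderiv]
    simp [pderiv]
  have := h _ ht hts
  simp only [hp, neg_smul, integral_neg] at this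
  exact neg_injective this

/-- A smooth cutoff, equal to one on the unit ball and supported in the ball of radius two. -/
noncomputable def cutoff (d : ℕ) : ContDiffBump (0 : Space d) where
  rIn := 1
  rOut := 2
  rIn_pos := one_pos
  rIn_lt_rOut := one_lt_two

theorem hasCompactSupport_cutoff_smul {c : ℝ} (hc : 0 < c) (f : Space d → Spinor d) :
    HasCompactSupport (fun x => cutoff d (c • x) • f x) := by
  refine HasCompactSupport.smul_right (f := fun x => cutoff d (c • x)) ?_
  exact (cutoff d).hasCompactSupport.comp_homeomorph (Homeomorph.smulOfNeZero c hc.ne')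

theorem contDiff_cutoff (c : ℝ) : ContDiff ℝ ∞ (fun x : Space d => cutoff d (c • x)) :=
  (cutoff d).contDiff.comp (contDiff_const_smul c)

theorem abs_cutoff_le (x : Space d) : |cutoff d x| ≤ 1 := by
  rw [abs_of_nonneg (cutoff d).nonneg]; exact (cutoff d).le_one

/-- The second bound is invariant under dilations: it gives `‖x‖ ‖∇(cutoff (c • ·))(x)‖ ≤ C` with
the same `C` for every `c > 0`. -/
theorem exists_norm_fderiv_cutoff_le (d : ℕ) :
    ∃ C, 0 ≤ C ∧ ∀ x : Space d, ‖fderiv ℝ (cutoff d) x‖ ≤ C ∧ ‖x‖ * ‖fderiv ℝ (cutoff d) x‖ ≤ C := by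
  have hd : ContDiff ℝ ∞ (cutoff d : Space d → ℝ) := (cutoff d).contDiff
  have hs : HasCompactSupport (fderiv ℝ (cutoff d : Space d → ℝ)) :=
    (cutoff d).hasCompactSupport.fderiv ℝ
  obtain ⟨C, hC⟩ := hs.exists_bound_of_continuous (hd.continuous_fderiv (by simp))
  obtain ⟨C', hC'⟩ := (hs.smul_left (f := fun x : Space d => ‖x‖)).exists_bound_of_continuous
    (continuous_norm.smul (hd.continuous_fderiv (by simp)))
  refine ⟨max C C', le_max_of_le_left ((norm_nonneg _).trans (hC 0)), fun x =>
    ⟨(hC x).trans (le_max_left _ _), ?_⟩⟩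
  have := hC' x
  simp only [Pi.smul_apply', norm_smul, norm_norm] at this
  exact this.trans (le_max_right _ _)

theorem fderiv_cutoff_smul (c : ℝ) (x : Space d) :
    fderiv ℝ (fun x : Space d => cutoff d (c • x)) x = c • fderiv ℝ (cutoff d) (c • x) :=
  fderiv_comp_smul c 

theorem tendsto_eLpNorm_cutoff_sub {f : Space d → Spinor d} (hf : MemLp f 2 volume) :
    Tendsto (fun n : ℕ => eLpNorm (fun x => cutoff d ((1 / ((n : ℝ) + 1)) • x) • f x - f x) 2 volume)
      atTop (𝓝 0) := by
  have hm : ∀ n : ℕ, MemLp (fun x => cutoff d ((1 / ((n : ℝ) + 1)) • x) • f x) 2 volume := fun n =>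
    memLp_smul_of_bdd (contDiff_cutoff _).continuous.aestronglyMeasurable
      (fun x => abs_cutoff_le _) hf
  have : ∀ n : ℕ, eLpNorm (fun x => cutoff d ((1 / ((n : ℝ) + 1)) • x) • f x - f x) 2 volume ^ 2
      = ∫⁻ x, ‖cutoff d ((1 / ((n : ℝ) + 1)) • x) • f x - f x‖ₑ ^ 2 := fun n => eLpNorm_two_sq _
  have h2 : Tendsto (fun n : ℕ => ∫⁻ x, ‖cutoff d ((1 / ((n : ℝ) + 1)) • x) • f x - f x‖ₑ ^ 2)
      atTop (𝓝 (∫⁻ _ : Space d, 0)) := by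
    refine tendsto_lintegral_of_dominated_convergence' (fun x => (2 * ‖f x‖ₑ) ^ 2) ?_ ?_ ?_ ?_
    · exact fun n => ((hm n).1.sub hf.1).enorm.pow_const 2
    · refine fun n => Eventually.of_forall fun x => ?_
      refine pow_le_pow_left' ?_ 2
      refine (enorm_sub_le).trans ?_
      rw [two_mul, enorm_smul]
      gcongr
      refine mul_le_of_le_one_left zero_le ?_
      rw [← ofReal_norm, Real.norm_eq_abs]
      exact ENNReal.ofReal_le_one.2 (abs_cutoff_le _)
    · simp only [mul_pow]
      rw [lintegral_const_mul' _ _ (by norm_num), ← eLpNorm_two_sq]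
      exact ENNReal.mul_ne_top (by norm_num) (ENNReal.pow_ne_top hf.2.ne)
    · refine Eventually.of_forall fun x => ?_
      refine tendsto_const_nhds.congr' ?_
      have ht : Tendsto (fun n : ℕ => (1 / ((n : ℝ) + 1)) • x) atTop (𝓝 ((0 : ℝ) • x)) :=
        (tendsto_one_div_add_atTop_nhds_zero_nat (𝕜 := ℝ)).smul_const x
      rw [zero_smul] at ht
      filter_upwards [ht.eventually (Metric.ball_mem_nhds 0 one_pos)] with n hn
      rw [(cutoff d).one_of_mem_closedBall (Metric.ball_subset_closedBall hn)]
      simp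
  rw [lintegral_zero] at h2
  simp only [← this] at h2
  have h3 := (ENNReal.continuous_rpow_const (y := (1 / 2 : ℝ))).tendsto 0 |>.comp h2
  rw [ENNReal.zero_rpow_of_pos (by norm_num)] at h3
  refine h3.congr fun n => ?_
  rw [Function.comp_apply, ← ENNReal.rpow_two, ← ENNReal.rpow_mul]
  norm_num

theorem tendsto_eLpNorm_add {X F : Type*} [MeasurableSpace X] {μ : Measure X}
    [NormedAddCommGroup F] {P Q : ℕ → X → F} (hP : ∀ n, AEStronglyMeasurable (P n) μ)
    (hQ : ∀ n, AEStronglyMeasurable (Q n) μ)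
    (h1 : Tendsto (fun n => eLpNorm (P n) 2 μ) atTop (𝓝 0))
    (h2 : Tendsto (fun n => eLpNorm (Q n) 2 μ) atTop (𝓝 0)) :
    Tendsto (fun n => eLpNorm (P n + Q n) 2 μ) atTop (𝓝 0) := by
  have h3 := h1.add h2
  rw [add_zero] at h3
  exact tendsto_of_tendsto_of_tendsto_of_le_of_le tendsto_const_nhds h3 (fun _ => zero_le)
    fun n => eLpNorm_add_le (hP n) (hQ n) (by norm_num)

/-- Test functions are dense in `H¹`. -/
theorem exists_contDiff_approx {f : Space d → Spinor d} {g : Fin d → Space d → Spinor d}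
    (hf : MemLp f 2 volume) (hg : ∀ j, MemLp (g j) 2 volume)
    (h : ∀ j, HasWeakPartial j f (g j)) :
    ∃ φ : ℕ → Space d → Spinor d, (∀ n, ContDiff ℝ ∞ (φ n)) ∧ (∀ n, HasCompactSupport (φ n)) ∧
      Tendsto (fun n => eLpNorm (φ n - f) 2 volume) atTop (𝓝 0) ∧
      ∀ j, Tendsto (fun n => eLpNorm ((fun x => fderiv ℝ (φ n) x (EuclideanSpace.single j 1)) - g j)
        2 volume) atTop (𝓝 0) := by
  have hc : ∀ n : ℕ, (0 : ℝ) < 1 / ((n : ℝ) + 1) := fun n => by positivity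
  have hsplit : ∀ {u : Space d → Spinor d}, MemLp u 2 volume →
      Tendsto (fun n : ℕ => eLpNorm ((fun x => cutoff d ((1 / ((n : ℝ) + 1)) • x) • mollify n u x)
        - u) 2 volume) atTop (𝓝 0) := by
    intro u hu
    have h1 : Tendsto (fun n : ℕ => eLpNorm
        (fun x => cutoff d ((1 / ((n : ℝ) + 1)) • x) • (mollify n u x - u x)) 2 volume)
        atTop (𝓝 0) := by
      refine tendsto_eLpNorm_of_le 1 (fun n => Eventually.of_forall fun x => ?_)
        (tendsto_eLpNorm_mollify_sub hu)
      rw [norm_smul, Real.norm_eq_abs]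
      exact mul_le_mul_of_nonneg_right (abs_cutoff_le _) (norm_nonneg _)
    have hcm : ∀ n : ℕ, AEStronglyMeasurable (fun x : Space d => cutoff d ((1 / ((n : ℝ) + 1)) • x))
      volume := fun n => (contDiff_cutoff _).continuous.aestronglyMeasurable
    have h2 := tendsto_eLpNorm_add
      (fun n => (hcm n).smul ((memLp_mollify n hu).1.sub hu.1))
      (fun n => ((hcm n).smul hu.1).sub hu.1) h1 (tendsto_eLpNorm_cutoff_sub hu)
    refine h2.congr fun n => ?_
    congr 1
    ext1 x
    simp [smul_sub]
  -- Mollification gives smoothness and the cutoff at scale `n + 1` compact support. In the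
  -- derivative, the term where the cutoff is differentiated is `O(1/(n+1))` times a bounded
  -- sequence.
  refine ⟨fun n x => cutoff d ((1 / ((n : ℝ) + 1)) • x) • mollify n f x, fun n => ?_, fun n => ?_,
    hsplit hf, fun j => ?_⟩
  · exact (contDiff_cutoff _).smul (contDiff_mollify n hf)
  · exact hasCompactSupport_cutoff_smul (hc n) _
  · obtain ⟨C, hC0, hC⟩ := exists_norm_fderiv_cutoff_le d
    have hder : ∀ (n : ℕ) (x : Space d),
        fderiv ℝ (fun x => cutoff d ((1 / ((n : ℝ) + 1)) • x) • mollify n f x) x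
          (EuclideanSpace.single j 1)
        = cutoff d ((1 / ((n : ℝ) + 1)) • x) • mollify n (g j) x
          + (1 / ((n : ℝ) + 1)) • (fderiv ℝ (cutoff d) ((1 / ((n : ℝ) + 1)) • x)
            (EuclideanSpace.single j 1) • mollify n f x) := by
      intro n x
      rw [fderiv_fun_smul ((contDiff_cutoff _).differentiable (by simp) x)
        ((contDiff_mollify n hf).differentiable (by simp) x), fderiv_cutoff_smul]
      simp [fderiv_mollify n hf (h j), smul_smul]
    have hB : Tendsto (fun n : ℕ => eLpNorm (fun x => (1 / ((n : ℝ) + 1)) •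
        (fderiv ℝ (cutoff d) ((1 / ((n : ℝ) + 1)) • x)
            (EuclideanSpace.single j 1) • mollify n f x)) 2 volume) atTop (𝓝 0) := by
      have hbd : ∀ n : ℕ, eLpNorm (fun x => (1 / ((n : ℝ) + 1)) •
        (fderiv ℝ (cutoff d) ((1 / ((n : ℝ) + 1)) • x)
            (EuclideanSpace.single j 1) • mollify n f x)) 2 volume
          ≤ ENNReal.ofReal (1 / ((n : ℝ) + 1) * C) *
            (eLpNorm (mollify n f - f) 2 volume + eLpNorm f 2 volume) := by
        intro n
        refine (eLpNorm_le_mul_eLpNorm_of_ae_le_mul (g := mollify n f)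
          (c := 1 / ((n : ℝ) + 1) * C) (Eventually.of_forall fun x => ?_) 2).trans ?_
        · rw [norm_smul, norm_smul, Real.norm_of_nonneg (hc n).le, mul_assoc]
          have : ‖fderiv ℝ (cutoff d) ((1 / ((n : ℝ) + 1)) • x) (EuclideanSpace.single j 1)‖ ≤ C := by
            refine (ContinuousLinearMap.le_opNorm _ _).trans ?_
            simpa using (hC _).1
          have := hc n
          gcongr
        · gcongr
          have := eLpNorm_add_le (f := mollify n f - f) (g := f) (p := 2)
            ((memLp_mollify n hf).1.sub hf.1) hf.1 (by norm_num)
          simpa using this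
      have hz : Tendsto (fun n : ℕ => ENNReal.ofReal (1 / ((n : ℝ) + 1) * C) *
            (eLpNorm (mollify n f - f) 2 volume + eLpNorm f 2 volume)) atTop (𝓝 0) := by
        have z1 : Tendsto (fun n : ℕ => ENNReal.ofReal (1 / ((n : ℝ) + 1) * C)) atTop (𝓝 0) := by
          have := (tendsto_one_div_add_atTop_nhds_zero_nat (𝕜 := ℝ)).mul_const C
          rw [zero_mul] at this
          simpa using ENNReal.tendsto_ofReal this
        have z2 := (tendsto_eLpNorm_mollify_sub hf).add_const (eLpNorm f 2 volume)
        have := ENNReal.Tendsto.mul z1 (Or.inr (by simpa using hf.2.ne)) z2 (Or.inr (by simp))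
        simpa using this
      exact tendsto_of_tendsto_of_tendsto_of_le_of_le tendsto_const_nhds hz (fun _ => zero_le) hbd
    have hmD : Continuous (fun x : Space d => fderiv ℝ (cutoff d) x (EuclideanSpace.single j 1)) :=
      ((cutoff d).contDiff.continuous_fderiv (n := 1) (by simp)).clm_apply continuous_const
    have h2 := tendsto_eLpNorm_add
      (fun n => ((contDiff_cutoff _).continuous.aestronglyMeasurable.smul
        (memLp_mollify n (hg j)).1).sub (hg j).1)
      (fun n => ((hmD.comp (continuous_const_smul _)).aestronglyMeasurable.smul
        (memLp_mollify n hf).1).const_smul (1 / ((n : ℝ) + 1))) (hsplit (hg j)) hB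
    refine h2.congr fun n => ?_
    congr 1
    ext1 x
    simp only [Pi.add_apply, Pi.sub_apply, Pi.smul_apply, Pi.smul_apply', Function.comp_apply, hder]
    abel

end Mollification

/-! ### Weak derivatives and multipliers on `H¹` -/

section WeakDerivatives

variable {d : ℕ}

theorem integrable_continuous_smul {f : Space d → Spinor d} (hf : MemLp f 2 volume)
    {η : Space d → ℝ} (hη : Continuous η) (hs : HasCompactSupport η) :
    Integrable (fun x => η x • f x) :=
  (hf.locallyIntegrable (by norm_num)).integrable_smul_left_of_hasCompactSupport hη hs

theorem HasWeakPartial.congr {j : Fin d} {f f' g g' : Space d → Spinor d}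
    (h : HasWeakPartial j f g) (hf : f =ᵐ[volume] f') (hg : g =ᵐ[volume] g') :
    HasWeakPartial j f' g' := by
  intro η hη hs
  have e1 : ∫ x, pderiv j η x • f' x = ∫ x, pderiv j η x • f x :=
    integral_congr_ae (by filter_upwards [hf] with x hx; rw [hx])
  have e2 : ∫ x, η x • g' x = ∫ x, η x • g x :=
    integral_congr_ae (by filter_upwards [hg] with x hx; rw [hx])
  rw [e1, e2, h η hη hs]

theorem HasWeakPartial.act (M : SpinMatrix d) {j : Fin d} {f g : Space d → Spinor d}
    (hf : MemLp f 2 volume) (hg : MemLp g 2 volume) (h : HasWeakPartial j f g) :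
    HasWeakPartial j (fun x => AnomalousDirac.act M (f x)) (fun x => AnomalousDirac.act M (g x)) := by
  intro η hη hs
  have key : ∀ {u : Space d → Spinor d} {ζ : Space d → ℝ}, Integrable (fun x => ζ x • u x) →
      ∫ x, ζ x • AnomalousDirac.act M (u x) = actCLM M (∫ x, ζ x • u x) := by
    intro u ζ hu
    rw [← ContinuousLinearMap.integral_comp_comm _ hu]
    simp only [actCLM_apply, act_real_smul]
  rw [key (integrable_continuous_smul hf (continuous_pderiv hη j) (hasCompactSupport_pderiv hs j)),
    key (integrable_continuous_smul hg hη.continuous hs), h η hη hs, map_neg]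

theorem pderiv_mul {η ζ : Space d → ℝ} (hη : ContDiff ℝ ∞ η) (hζ : ContDiff ℝ ∞ ζ) (j : Fin d)
    (x : Space d) : pderiv j (fun x => η x * ζ x) x = η x * pderiv j ζ x + pderiv j η x * ζ x := by
  rw [pderiv, fderiv_fun_mul (hη.differentiable (by simp) x) (hζ.differentiable (by simp) x)]
  simp [pderiv, mul_comm]

theorem HasWeakPartial.mul {j : Fin d} {f g : Space d → Spinor d}
    (hf : MemLp f 2 volume) (hg : MemLp g 2 volume) (h : HasWeakPartial j f g) {w : Space d → ℝ}
    (hw : ContDiff ℝ ∞ w) :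
    HasWeakPartial j (fun x => w x • f x) (fun x => w x • g x + pderiv j w x • f x) := by
  intro η hη hs
  have h1 := h (fun x => w x * η x) (hw.mul hη) hs.mul_left
  simp only [pderiv_mul hw hη, add_smul] at h1
  have i1 : Integrable (fun x => (w x * pderiv j η x) • f x) :=
    integrable_continuous_smul hf (hw.continuous.mul (continuous_pderiv hη j))
      (hasCompactSupport_pderiv hs j).mul_left
  have i2 : Integrable (fun x => (pderiv j w x * η x) • f x) :=
    integrable_continuous_smul hf ((continuous_pderiv hw j).mul hη.continuous) hs.mul_left
  have i3 : Integrable (fun x => (w x * η x) • g x) :=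
    integrable_continuous_smul hg (hw.continuous.mul hη.continuous) hs.mul_left
  rw [integral_add i1 i2] at h1
  have e1 : ∫ x, pderiv j η x • w x • f x = ∫ x, (w x * pderiv j η x) • f x := by
    simp only [smul_smul, mul_comm]
  have e2 : ∫ x, η x • (w x • g x + pderiv j w x • f x)
      = (∫ x, (w x * η x) • g x) + ∫ x, (pderiv j w x * η x) • f x := by
    rw [← integral_add i3 i2]
    simp only [smul_add, smul_smul, mul_comm]
  rw [e1, e2, neg_add, ← h1]
  abel

theorem hasWeakPartial_of_contDiff {f : Space d → Spinor d} (hf : ContDiff ℝ ∞ f) (j : Fin d) :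
    HasWeakPartial j f (fun x => fderiv ℝ f x (EuclideanSpace.single j 1)) := by
  intro η hη hs
  have hfd : Continuous fun x => fderiv ℝ f x (EuclideanSpace.single j 1) :=
    (hf.continuous_fderiv (by simp)).clm_apply continuous_const
  have h := integral_smul_fderiv_eq_neg_fderiv_smul_of_integrable (μ := (volume : Measure (Space d)))
    (f := η) (g := f) (v := EuclideanSpace.single j 1)
    (((continuous_pderiv hη j).smul hf.continuous).integrable_of_hasCompactSupport
      (hasCompactSupport_pderiv hs j).smul_right)
    ((hη.continuous.smul hfd).integrable_of_hasCompactSupport hs.smul_right)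
    ((hη.continuous.smul hf.continuous).integrable_of_hasCompactSupport hs.smul_right)
    (fun x _ => hη.differentiable (by simp) x) (fun x _ => hf.differentiable (by simp) x)
  rw [h, neg_neg]
  rfl

/-- After pairing with a fixed spinor `c`, both sides of the weak identity are `L²` inner products
against a compactly supported field, hence continuous. -/
theorem hasWeakPartial_of_tendsto {j : Fin d} {f g : ℕ → Space d → Spinor d}
    {f' g' : Space d → Spinor d} (hf : ∀ n, MemLp (f n) 2 volume) (hg : ∀ n, MemLp (g n) 2 volume)
    (hf' : MemLp f' 2 volume) (hg' : MemLp g' 2 volume) (h : ∀ n, HasWeakPartial j (f n) (g n))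
    (h1 : Tendsto (fun n => eLpNorm (f n - f') 2 volume) atTop (𝓝 0))
    (h2 : Tendsto (fun n => eLpNorm (g n - g') 2 volume) atTop (𝓝 0)) :
    HasWeakPartial j f' g' := by
  intro η hη hs
  refine ext_inner_left ℂ fun c => ?_
  have key : ∀ {ζ : Space d → ℝ} (_ : Continuous ζ) (_ : HasCompactSupport ζ)
      {u : Space d → Spinor d} (_ : MemLp u 2 volume),
      inner ℂ c (∫ x, ζ x • u x) = ∫ x, inner ℂ (ζ x • c) (u x) := by
    intro ζ h1 h2 u hu
    rw [← integral_inner (integrable_continuous_smul hu h1 h2)]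
    refine integral_congr_ae (Eventually.of_forall fun x => ?_)
    simp only [RCLike.real_smul_eq_coe_smul (K := ℂ), inner_smul_left, inner_smul_right]
    simp
  have hmem : ∀ {ζ : Space d → ℝ} (_ : Continuous ζ) (_ : HasCompactSupport ζ),
      MemLp (fun x => ζ x • c) 2 volume := fun h1 h2 =>
    (h1.smul continuous_const).memLp_of_hasCompactSupport h2.smul_right
  have c1 := continuous_pderiv hη j
  have s1 := hasCompactSupport_pderiv hs j
  have t1 := tendsto_integral_inner (fun _ => hmem c1 s1) hf (hmem c1 s1) hf' (by simp) h1
  have t2 := tendsto_integral_inner (fun _ => hmem hη.continuous hs) hg (hmem hη.continuous hs) hg'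
    (by simp) h2
  rw [inner_neg_right, key c1 s1 hf', key hη.continuous hs hg']
  refine tendsto_nhds_unique t1 (t2.neg.congr fun n => ?_)
  rw [← key c1 s1 (hf n), ← key hη.continuous hs (hg n), h n η hη hs, inner_neg_right]

/-- The graph of the weak gradient on `H¹`. -/
noncomputable def gradientGraph (d : ℕ) : Submodule ℂ (L2Spinor d × (Fin d → L2Spinor d)) where
  carrier := {p | ∀ j, HasWeakPartial j p.1 (p.2 j)}
  zero_mem' := fun j => HasWeakPartial.zero j
  add_mem' := fun hf hg j => (hf j).add (hg j)
  smul_mem' := fun c _ hf j => (hf j).smul c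

theorem isClosed_gradientGraph (d : ℕ) :
    IsClosed (gradientGraph d : Set (L2Spinor d × (Fin d → L2Spinor d))) := by
  refine IsSeqClosed.isClosed ?_
  intro u p hu hp j
  have h1 := (continuous_fst.tendsto p).comp hp
  have h2 := (((continuous_apply j).comp continuous_snd).tendsto p).comp hp
  exact hasWeakPartial_of_tendsto (fun n => Lp.memLp (u n).1) (fun n => Lp.memLp ((u n).2 j))
    (Lp.memLp p.1) (Lp.memLp (p.2 j)) (fun n => hu n j)
    ((Lp.tendsto_Lp_iff_tendsto_eLpNorm' _ _).1 h1) ((Lp.tendsto_Lp_iff_tendsto_eLpNorm' _ _).1 h2)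

/-- The graph plays the role of `H¹` with its Sobolev norm. Completeness is what the closed graph
theorem requires of it. -/
instance : CompleteSpace (gradientGraph d) := (isClosed_gradientGraph d).completeSpace_coe

/-- A function that multiplies `H¹` into `L²`. -/
def IsMultiplier (a : Space d → ℝ) : Prop :=
  ∀ (f : Space d → Spinor d) (g : Fin d → Space d → Spinor d), MemLp f 2 volume →
    (∀ j, MemLp (g j) 2 volume) → (∀ j, HasWeakPartial j f (g j)) →
      MemLp (fun x => (a x : ℂ) • f x) 2 volume

theorem IsMultiplier.memLp_fst {a : Space d → ℝ} (ha : IsMultiplier a) (p : gradientGraph d) :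
    MemLp (fun x => (a x : ℂ) • p.1.1 x) 2 volume :=
  ha p.1.1 (fun j => p.1.2 j) (Lp.memLp _) (fun _ => Lp.memLp _) p.2

/-- Multiplication by a multiplier, on the graph of the weak gradient. -/
noncomputable def mulOnGraph {a : Space d → ℝ} (ha : IsMultiplier a) :
    gradientGraph d →ₗ[ℂ] L2Spinor d where
  toFun p := (ha.memLp_fst p).toLp _
  map_add' p q := by
    refine Lp.ext ?_
    have h0 : (p + q).1.1 = p.1.1 + q.1.1 := rfl
    filter_upwards [(ha.memLp_fst (p + q)).coeFn_toLp, (ha.memLp_fst p).coeFn_toLp,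
      (ha.memLp_fst q).coeFn_toLp, Lp.coeFn_add p.1.1 q.1.1,
      Lp.coeFn_add ((ha.memLp_fst p).toLp _) ((ha.memLp_fst q).toLp _)] with x h1 h2 h3 h4 h5
    rw [h1, h5, Pi.add_apply, h2, h3, h0, h4, Pi.add_apply, smul_add]
  map_smul' c p := by
    refine Lp.ext ?_
    have h0 : (c • p).1.1 = c • p.1.1 := rfl
    filter_upwards [(ha.memLp_fst (c • p)).coeFn_toLp, (ha.memLp_fst p).coeFn_toLp,
      Lp.coeFn_smul c p.1.1, Lp.coeFn_smul c ((ha.memLp_fst p).toLp _)] with x h1 h2 h3 h4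
    rw [h1, RingHom.id_apply, h4, Pi.smul_apply, h2, h0, h3, Pi.smul_apply, smul_comm]

theorem coeFn_mulOnGraph {a : Space d → ℝ} (ha : IsMultiplier a) (p : gradientGraph d) :
    mulOnGraph ha p =ᵐ[volume] fun x => (a x : ℂ) • p.1.1 x :=
  (ha.memLp_fst p).coeFn_toLp

/-- A multiplier is assumed to map into `L²` without any estimate; the closed graph theorem supplies
one. The graph is closed because `L²` limits are almost everywhere limits along a subsequence, and
pointwise multiplication respects those. -/
theorem continuous_mulOnGraph {a : Space d → ℝ} (ha : IsMultiplier a) :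
    Continuous (mulOnGraph ha) := by
  refine LinearMap.continuous_of_seq_closed_graph _ fun u p y hu hy => ?_
  have h1 : Tendsto (fun n => (u n).1.1) atTop (𝓝 p.1.1) :=
    ((continuous_fst.comp continuous_subtype_val).tendsto p).comp hu
  obtain ⟨ns, hns, hns1⟩ := (tendstoInMeasure_of_tendsto_Lp h1).exists_seq_tendsto_ae
  obtain ⟨ms, hms, hms1⟩ := (tendstoInMeasure_of_tendsto_Lp
    (hy.comp hns.tendsto_atTop)).exists_seq_tendsto_ae
  refine Lp.ext ?_
  have hall : ∀ᵐ x, ∀ n, mulOnGraph ha (u n) x = (a x : ℂ) • (u n).1.1 x :=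
    ae_all_iff.2 fun n => coeFn_mulOnGraph ha (u n)
  filter_upwards [hns1, hms1, hall, coeFn_mulOnGraph ha p] with x a1 a2 a3 a4
  rw [a4]
  refine tendsto_nhds_unique a2 ?_
  simp only [Function.comp_apply, a3]
  exact (a1.comp hms.tendsto_atTop).const_smul _

theorem IsMultiplier.tendsto {a : Space d → ℝ} (ha : IsMultiplier a)
    {f : ℕ → Space d → Spinor d} {g : ℕ → Fin d → Space d → Spinor d} {f' : Space d → Spinor d}
    {g' : Fin d → Space d → Spinor d} (hf : ∀ n, MemLp (f n) 2 volume)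
    (hg : ∀ n j, MemLp (g n j) 2 volume) (hf' : MemLp f' 2 volume) (hg' : ∀ j, MemLp (g' j) 2 volume)
    (h : ∀ n j, HasWeakPartial j (f n) (g n j)) (h' : ∀ j, HasWeakPartial j f' (g' j))
    (h1 : Tendsto (fun n => eLpNorm (f n - f') 2 volume) atTop (𝓝 0))
    (h2 : ∀ j, Tendsto (fun n => eLpNorm (g n j - g' j) 2 volume) atTop (𝓝 0)) :
    Tendsto (fun n => eLpNorm ((fun x => (a x : ℂ) • f n x) - fun x => (a x : ℂ) • f' x) 2 volume)
      atTop (𝓝 0) := by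
  have mk : ∀ {u : Space d → Spinor d} {v : Fin d → Space d → Spinor d} (hu : MemLp u 2 volume)
      (hv : ∀ j, MemLp (v j) 2 volume), (∀ j, HasWeakPartial j u (v j)) →
      ((hu.toLp u, fun j => (hv j).toLp (v j)) : L2Spinor d × (Fin d → L2Spinor d))
        ∈ gradientGraph d := fun hu hv hw j =>
    (hw j).congr hu.coeFn_toLp.symm (hv j).coeFn_toLp.symm
  let p : ℕ → gradientGraph d := fun n => ⟨_, mk (hf n) (hg n) (h n)⟩
  let p' : gradientGraph d := ⟨_, mk hf' hg' h'⟩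
  have hp : Tendsto p atTop (𝓝 p') := by
    rw [tendsto_subtype_rng]
    refine Tendsto.prodMk_nhds ?_ (tendsto_pi_nhds.2 fun j => ?_)
    · exact (Lp.tendsto_Lp_iff_tendsto_eLpNorm'' _ _ _ _).2 h1
    · exact (Lp.tendsto_Lp_iff_tendsto_eLpNorm'' _ _ _ _).2 (h2 j)
  have := ((continuous_mulOnGraph ha).tendsto p').comp hp
  have t := (Lp.tendsto_Lp_iff_tendsto_eLpNorm' _ _).1 this
  refine t.congr fun n => eLpNorm_congr_ae ?_
  filter_upwards [coeFn_mulOnGraph ha (p n), coeFn_mulOnGraph ha p', (hf n).coeFn_toLp,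
    hf'.coeFn_toLp] with x a1 a2 a3 a4
  simp only [Pi.sub_apply, Function.comp_apply]
  rw [a1, a2]
  change (a x : ℂ) • ((hf n).toLp _ : L2Spinor d) x - (a x : ℂ) • (hf'.toLp _ : L2Spinor d) x = _
  rw [a3, a4]

end WeakDerivatives

/-! ### The magnetic Sobolev space -/

section MagneticSobolev

variable {d : ℕ}

/-- `f` is in `H¹`, with magnetic derivatives `D j = ∂_j f - i A_j f` and `A f` in `L²`. -/
structure MagSobolev (A : Space d → Space d) (f : Space d → Spinor d)
    (D : Fin d → Space d → Spinor d) : Prop where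
  memLp : MemLp f 2 volume
  memLp_deriv : ∀ j, MemLp (D j) 2 volume
  memLp_pot : ∀ j, MemLp (fun x => (A x j : ℂ) • f x) 2 volume
  weak : ∀ j, HasWeakPartial j f (fun x => D j x + Complex.I • (A x j : ℂ) • f x)

variable {A : Space d → Space d} {f f₂ : Space d → Spinor d} {D D₂ : Fin d → Space d → Spinor d}

theorem MagSobolev.memLp_weak (h : MagSobolev A f D) (j : Fin d) :
    MemLp (fun x => D j x + Complex.I • (A x j : ℂ) • f x) 2 volume :=
  (h.memLp_deriv j).add ((h.memLp_pot j).const_smul Complex.I)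

theorem _root_.MeasureTheory.MemLp.hasWeakPartial_toLp {j : Fin d} {g : Space d → Spinor d}
    (hf : MemLp f 2 volume) (hg : MemLp g 2 volume) (h : HasWeakPartial j f g) :
    HasWeakPartial j (hf.toLp f) (hg.toLp g) :=
  h.congr hf.coeFn_toLp.symm hg.coeFn_toLp.symm

theorem HasWeakPartial.fun_add {j : Fin d} {g g₂ : Space d → Spinor d}
    (hf : MemLp f 2 volume) (hg : MemLp g 2 volume) (hf₂ : MemLp f₂ 2 volume)
    (hg₂ : MemLp g₂ 2 volume) (h : HasWeakPartial j f g) (h₂ : HasWeakPartial j f₂ g₂) :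
    HasWeakPartial j (fun x => f x + f₂ x) (fun x => g x + g₂ x) := by
  have := (hf.hasWeakPartial_toLp hg h).add (hf₂.hasWeakPartial_toLp hg₂ h₂)
  rw [← MemLp.toLp_add, ← MemLp.toLp_add] at this
  exact this.congr (MemLp.coeFn_toLp _) (MemLp.coeFn_toLp _)

theorem HasWeakPartial.fun_smul {j : Fin d} {g : Space d → Spinor d}
    (hf : MemLp f 2 volume) (hg : MemLp g 2 volume) (c : ℂ) (h : HasWeakPartial j f g) :
    HasWeakPartial j (fun x => c • f x) (fun x => c • g x) := by
  have := (hf.hasWeakPartial_toLp hg h).smul c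
  rw [← MemLp.toLp_const_smul, ← MemLp.toLp_const_smul] at this
  exact this.congr (MemLp.coeFn_toLp _) (MemLp.coeFn_toLp _)

theorem MagSobolev.add (h : MagSobolev A f D) (h₂ : MagSobolev A f₂ D₂) :
    MagSobolev A (fun x => f x + f₂ x) (fun j x => D j x + D₂ j x) where
  memLp := h.memLp.add h₂.memLp
  memLp_deriv j := (h.memLp_deriv j).add (h₂.memLp_deriv j)
  memLp_pot j := by
    simp only [smul_add]
    exact (h.memLp_pot j).add (h₂.memLp_pot j)
  weak j := by
    have := (h.weak j).fun_add h.memLp (h.memLp_weak j) h₂.memLp (h₂.memLp_weak j) (h₂.weak j)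
    convert this using 2
    simp only [smul_add]
    abel

theorem MagSobolev.const_smul (h : MagSobolev A f D) (c : ℂ) :
    MagSobolev A (fun x => c • f x) (fun j x => c • D j x) where
  memLp := h.memLp.const_smul c
  memLp_deriv j := (h.memLp_deriv j).const_smul c
  memLp_pot j := by
    simp only [smul_comm _ c]
    exact (h.memLp_pot j).const_smul c
  weak j := by
    have := (h.weak j).fun_smul h.memLp (h.memLp_weak j) c
    convert this using 2
    simp only [smul_add, smul_comm _ c]

theorem MagSobolev.sub (h : MagSobolev A f D) (h₂ : MagSobolev A f₂ D₂) :
    MagSobolev A (fun x => f x - f₂ x) (fun j x => D j x - D₂ j x) := by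
  simpa [sub_eq_add_neg] using h.add (h₂.const_smul (-1))

theorem MagSobolev.act (h : MagSobolev A f D) (M : SpinMatrix d) :
    MagSobolev A (fun x => AnomalousDirac.act M (f x)) (fun j x => AnomalousDirac.act M (D j x)) where
  memLp := memLp_act M h.memLp
  memLp_deriv j := memLp_act M (h.memLp_deriv j)
  memLp_pot j := by
    simp only [← act_smul]
    exact memLp_act M (h.memLp_pot j)
  weak j := by
    have := (h.weak j).act M h.memLp (h.memLp_weak j)
    simpa only [act_add, act_smul] using this

theorem MagSobolev.mul (h : MagSobolev A f D) {w : Space d → ℝ} (hw : ContDiff ℝ ∞ w)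
    {C C' : ℝ} (hC : ∀ x, |w x| ≤ C) (hC' : ∀ j x, |pderiv j w x| ≤ C') :
    MagSobolev A (fun x => w x • f x) (fun j x => w x • D j x + pderiv j w x • f x) where
  memLp := memLp_smul_of_bdd hw.continuous.aestronglyMeasurable hC h.memLp
  memLp_deriv j := (memLp_smul_of_bdd hw.continuous.aestronglyMeasurable hC (h.memLp_deriv j)).add
    (memLp_smul_of_bdd (continuous_pderiv hw j).aestronglyMeasurable (hC' j) h.memLp)
  memLp_pot j := by
    simp only [smul_comm _ (w _)]
    exact memLp_smul_of_bdd hw.continuous.aestronglyMeasurable hC (h.memLp_pot j)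
  weak j := by
    have := (h.weak j).mul h.memLp (h.memLp_weak j) hw
    convert this using 2
    simp only [smul_add, smul_comm _ (w _)]
    abel

theorem MagSobolev.zero : MagSobolev A (fun _ => 0) (fun _ _ => 0) where
  memLp := MemLp.zero'
  memLp_deriv j := MemLp.zero'
  memLp_pot j := by simp
  weak j := by
    intro η _ _
    simp

theorem MagSobolev.sum {ι : Type*} (s : Finset ι) {f : ι → Space d → Spinor d}
    {D : ι → Fin d → Space d → Spinor d} (h : ∀ i, MagSobolev A (f i) (D i)) :
    MagSobolev A (fun x => ∑ i ∈ s, f i x) (fun j x => ∑ i ∈ s, D i j x) := by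
  classical
  induction s using Finset.induction_on with
  | empty => simpa using MagSobolev.zero
  | insert i s hi ih =>
    simp only [Finset.sum_insert hi]
    exact (h i).add ih

/-- The magnetic derivative of a smooth function. -/
noncomputable def magDeriv (A : Space d → Space d) (f : Space d → Spinor d) (j : Fin d)
    (x : Space d) : Spinor d :=
  fderiv ℝ f x (EuclideanSpace.single j 1) - Complex.I • (A x j : ℂ) • f x

theorem continuous_fderiv_single (hf : ContDiff ℝ ∞ f) (j : Fin d) :
    Continuous fun x => fderiv ℝ f x (EuclideanSpace.single j 1) :=
  (hf.continuous_fderiv (by simp)).clm_apply continuous_const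

theorem memLp_of_contDiff (hf : ContDiff ℝ ∞ f) (hs : HasCompactSupport f) : MemLp f 2 volume :=
  hf.continuous.memLp_of_hasCompactSupport hs

theorem memLp_fderiv_of_contDiff (hf : ContDiff ℝ ∞ f) (hs : HasCompactSupport f) (j : Fin d) :
    MemLp (fun x => fderiv ℝ f x (EuclideanSpace.single j 1)) 2 volume :=
  (continuous_fderiv_single hf j).memLp_of_hasCompactSupport (hs.fderiv_apply ℝ _)

theorem MagSobolev.of_contDiff (hA : ∀ j, IsMultiplier fun x => A x j) (hf : ContDiff ℝ ∞ f)
    (hs : HasCompactSupport f) : MagSobolev A f (magDeriv A f) := by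
  have hp : ∀ j, MemLp (fun x => (A x j : ℂ) • f x) 2 volume := fun j =>
    hA j f _ (memLp_of_contDiff hf hs) (fun k => memLp_fderiv_of_contDiff hf hs k)
      (hasWeakPartial_of_contDiff hf)
  refine ⟨memLp_of_contDiff hf hs, fun j => ?_, hp, fun j => ?_⟩
  · exact (memLp_fderiv_of_contDiff hf hs j).sub ((hp j).const_smul Complex.I)
  · simpa only [magDeriv, sub_add_cancel] using hasWeakPartial_of_contDiff hf j

/-- Test functions are dense in the magnetic Sobolev space. -/
theorem MagSobolev.exists_approx (hA : ∀ j, IsMultiplier fun x => A x j) (h : MagSobolev A f D) :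
    ∃ φ : ℕ → Space d → Spinor d, (∀ n, ContDiff ℝ ∞ (φ n)) ∧ (∀ n, HasCompactSupport (φ n)) ∧
      Tendsto (fun n => eLpNorm (φ n - f) 2 volume) atTop (𝓝 0) ∧
      ∀ j, Tendsto (fun n => eLpNorm (magDeriv A (φ n) j - D j) 2 volume) atTop (𝓝 0) := by
  obtain ⟨φ, h1, h2, h3, h4⟩ := exists_contDiff_approx h.memLp h.memLp_weak h.weak
  refine ⟨φ, h1, h2, h3, fun j => ?_⟩
  have hM := fun n => MagSobolev.of_contDiff hA (h1 n) (h2 n)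
  -- Convergence in the ordinary Sobolev norm entails convergence of `A_j φ_n`, hence of the
  -- magnetic derivatives.
  have h5 := (hA j).tendsto (fun n => memLp_of_contDiff (h1 n) (h2 n))
    (fun n k => memLp_fderiv_of_contDiff (h1 n) (h2 n) k) h.memLp h.memLp_weak
    (fun n => hasWeakPartial_of_contDiff (h1 n)) h.weak h3 h4
  have h6 : Tendsto (fun n => eLpNorm (fun x => (-Complex.I) •
      ((A x j : ℂ) • φ n x - (A x j : ℂ) • f x)) 2 volume) atTop (𝓝 0) :=
    tendsto_eLpNorm_of_le 1 (fun n => Eventually.of_forall fun x => by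
      rw [norm_smul, norm_neg, Complex.norm_I, Pi.sub_apply]) h5
  have h7 := tendsto_eLpNorm_add
    (fun n => ((memLp_fderiv_of_contDiff (h1 n) (h2 n) j).sub (h.memLp_weak j)).1)
    (fun n => ((((hM n).memLp_pot j).sub (h.memLp_pot j)).const_smul (-Complex.I)).1) (h4 j) h6
  refine h7.congr fun n => ?_
  congr 1
  ext1 x
  rw [Pi.add_apply, Pi.smul_apply]
  simp only [Pi.sub_apply, magDeriv, neg_smul, smul_sub]
  abel

end MagneticSobolev

/-! ### Integration by parts and the commutator of magnetic derivatives -/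

section IntegrationByParts

theorem integral_add_add {X : Type*} [MeasurableSpace X] {μ : Measure X} {f g h : X → ℂ}
    (hf : Integrable f μ) (hg : Integrable g μ) (hh : Integrable h μ) :
    ∫ x, (f x + g x + h x) ∂μ = ∫ x, f x ∂μ + ∫ x, g x ∂μ + ∫ x, h x ∂μ := by
  have h1 := integral_add (hf.add hg) hh
  simp only [Pi.add_apply] at h1
  rw [h1, integral_add hf hg]

theorem integral_sub_add_sub_sub {X : Type*} [MeasurableSpace X] {μ : Measure X}
    {f g h k l : X → ℂ} (hf : Integrable f μ) (hg : Integrable g μ) (hh : Integrable h μ)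
    (hk : Integrable k μ) (hl : Integrable l μ) :
    ∫ x, (f x - g x + h x - k x - l x) ∂μ
      = ∫ x, f x ∂μ - ∫ x, g x ∂μ + ∫ x, h x ∂μ - ∫ x, k x ∂μ - ∫ x, l x ∂μ := by
  have h1 := integral_sub (((hf.sub hg).add hh).sub hk) hl
  have h2 := integral_sub ((hf.sub hg).add hh) hk
  have h3 := integral_add (hf.sub hg) hh
  simp only [Pi.add_apply, Pi.sub_apply] at h1 h2 h3
  rw [h1, h2, h3, integral_sub hf hg]

variable {d : ℕ}

theorem inner_real_smul_right (u v : Spinor d) (c : ℝ) :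
    inner ℂ u (c • v) = (c : ℂ) * inner ℂ u v := by
  rw [RCLike.real_smul_eq_coe_smul (K := ℂ), inner_smul_right]; rfl

theorem inner_real_smul_left (u v : Spinor d) (c : ℝ) :
    inner ℂ (c • u) v = (c : ℂ) * inner ℂ u v := by
  rw [RCLike.real_smul_eq_coe_smul (K := ℂ), inner_smul_left]; simp

theorem integrable_mul_inner {u v : Space d → Spinor d} (hu : MemLp u 2 volume)
    (hv : MemLp v 2 volume) {w : Space d → ℝ} (hw : AEStronglyMeasurable w volume) {C : ℝ}
    (hC : ∀ x, |w x| ≤ C) : Integrable (fun x => (w x : ℂ) * inner ℂ (u x) (v x)) := by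
  simp only [← inner_real_smul_right]
  exact integrable_inner_of_memLp hu (memLp_smul_of_bdd hw hC hv)

theorem tendsto_integral_mul_inner {u v : ℕ → Space d → Spinor d} {u' v' : Space d → Spinor d}
    (hu : ∀ n, MemLp (u n) 2 volume) (hv : ∀ n, MemLp (v n) 2 volume) (hu' : MemLp u' 2 volume)
    (hv' : MemLp v' 2 volume) {w : Space d → ℝ} (hw : AEStronglyMeasurable w volume) {C : ℝ}
    (hC : ∀ x, |w x| ≤ C)
    (h1 : Tendsto (fun n => eLpNorm (u n - u') 2 volume) atTop (𝓝 0))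
    (h2 : Tendsto (fun n => eLpNorm (v n - v') 2 volume) atTop (𝓝 0)) :
    Tendsto (fun n => ∫ x, (w x : ℂ) * inner ℂ (u n x) (v n x)) atTop
      (𝓝 (∫ x, (w x : ℂ) * inner ℂ (u' x) (v' x))) := by
  simp only [← inner_real_smul_right]
  refine tendsto_integral_inner hu (fun n => memLp_smul_of_bdd hw hC (hv n)) hu'
    (memLp_smul_of_bdd hw hC hv') h1 (tendsto_eLpNorm_of_le C (fun n => ?_) h2)
  refine Eventually.of_forall fun x => ?_
  simp only [Pi.sub_apply]
  rw [← smul_sub, norm_smul]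
  exact mul_le_mul_of_nonneg_right (hC x) (norm_nonneg _)

theorem integral_fderiv_eq_zero {ζ : Space d → ℂ} (h : ContDiff ℝ ∞ ζ) (hs : HasCompactSupport ζ)
    (v : Space d) : ∫ x, fderiv ℝ ζ x v = 0 := by
  have hd : Continuous fun x => fderiv ℝ ζ x v :=
    (h.continuous_fderiv (by simp)).clm_apply continuous_const
  have := integral_mul_fderiv_eq_neg_fderiv_mul_of_integrable (μ := (volume : Measure (Space d)))
    (f := fun _ => (1 : ℂ)) (g := ζ) (v := v) (by simp)
    (by simpa using hd.integrable_of_hasCompactSupport (hs.fderiv_apply ℝ v))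
    (by simpa using h.continuous.integrable_of_hasCompactSupport hs)
    (fun x _ => differentiableAt_const _) (fun x _ => h.differentiable (by simp) x)
  simpa using this

/-- The product `w ⟨φ, χ⟩` of a weight and a pair of spinor fields. -/
noncomputable def weighted (w : Space d → ℝ) (φ χ : Space d → Spinor d) (x : Space d) : ℂ :=
  (w x : ℂ) * inner ℂ (φ x) (χ x)

theorem contDiff_weighted {w : Space d → ℝ} {φ χ : Space d → Spinor d} (hw : ContDiff ℝ ∞ w)
    (hφ : ContDiff ℝ ∞ φ) (hχ : ContDiff ℝ ∞ χ) : ContDiff ℝ ∞ (weighted w φ χ) :=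
  (Complex.ofRealCLM.contDiff.comp hw).mul (hφ.inner ℂ hχ)

theorem hasCompactSupport_weighted (w : Space d → ℝ) {φ : Space d → Spinor d}
    (χ : Space d → Spinor d) (hφ : HasCompactSupport φ) : HasCompactSupport (weighted w φ χ) := by
  refine hφ.mono fun x hx => ?_
  contrapose! hx
  simp only [Function.mem_support, not_not] at hx
  simp [weighted, hx]

theorem fderiv_weighted {w : Space d → ℝ} {φ χ : Space d → Spinor d} (hw : ContDiff ℝ ∞ w)
    (hφ : ContDiff ℝ ∞ φ) (hχ : ContDiff ℝ ∞ χ) (x v : Space d) :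
    fderiv ℝ (weighted w φ χ) x v = (w x : ℂ) * inner ℂ (fderiv ℝ φ x v) (χ x)
      + (w x : ℂ) * inner ℂ (φ x) (fderiv ℝ χ x v)
      + (fderiv ℝ w x v : ℂ) * inner ℂ (φ x) (χ x) := by
  have h1 : HasFDerivAt (fun x => (w x : ℂ)) (Complex.ofRealCLM.comp (fderiv ℝ w x)) x :=
    Complex.ofRealCLM.hasFDerivAt.comp x (hw.differentiable (by simp) x).hasFDerivAt
  have h2 := (hφ.differentiable (by simp) x).hasFDerivAt.inner ℂ
    (hχ.differentiable (by simp) x).hasFDerivAt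
  have h3 : HasFDerivAt (weighted w φ χ) _ x := h1.mul h2
  rw [h3.fderiv]
  simp [fderivInnerCLM_apply]
  ring

variable {A : Space d → Space d} {u v : Space d → Spinor d} {Du Dv : Fin d → Space d → Spinor d}

/-- `A` is real, so the two contributions `∓iA_j⟨φ, χ⟩` cancel: the magnetic connection is
compatible with the inner product. -/
theorem inner_magDeriv_add (φ χ : Space d → Spinor d) (j : Fin d) (x : Space d) :
    inner ℂ (magDeriv A φ j x) (χ x) + inner ℂ (φ x) (magDeriv A χ j x)
      = inner ℂ (fderiv ℝ φ x (EuclideanSpace.single j 1)) (χ x)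
        + inner ℂ (φ x) (fderiv ℝ χ x (EuclideanSpace.single j 1)) := by
  simp only [magDeriv, inner_sub_left, inner_sub_right, inner_smul_left, inner_smul_right,
    Complex.conj_I, Complex.conj_ofReal]
  ring

/-- Integration by parts for magnetic derivatives. -/
theorem MagSobolev.integral_by_parts (hA : ∀ j, IsMultiplier fun x => A x j)
    (hu : MagSobolev A u Du) (hv : MagSobolev A v Dv) {w : Space d → ℝ} (hw : ContDiff ℝ ∞ w)
    {C C' : ℝ} (hC : ∀ x, |w x| ≤ C) (hC' : ∀ j x, |pderiv j w x| ≤ C') (j : Fin d) :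
    Integrable (fun x => (w x : ℂ) * inner ℂ (Du j x) (v x) + (w x : ℂ) * inner ℂ (u x) (Dv j x)
      + (pderiv j w x : ℂ) * inner ℂ (u x) (v x)) ∧
    ∫ x, ((w x : ℂ) * inner ℂ (Du j x) (v x) + (w x : ℂ) * inner ℂ (u x) (Dv j x)
      + (pderiv j w x : ℂ) * inner ℂ (u x) (v x)) = 0 := by
  have mw : AEStronglyMeasurable w volume := hw.continuous.aestronglyMeasurable
  have mw' : AEStronglyMeasurable (pderiv j w) volume := (continuous_pderiv hw j).aestronglyMeasurable
  have ig : ∀ {u v : Space d → Spinor d} {Du Dv : Fin d → Space d → Spinor d},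
      MagSobolev A u Du → MagSobolev A v Dv →
      Integrable (fun x => (w x : ℂ) * inner ℂ (Du j x) (v x)) ∧
      Integrable (fun x => (w x : ℂ) * inner ℂ (u x) (Dv j x)) ∧
      Integrable (fun x => (pderiv j w x : ℂ) * inner ℂ (u x) (v x)) := fun hu hv =>
    ⟨integrable_mul_inner (hu.memLp_deriv j) hv.memLp mw hC,
      integrable_mul_inner hu.memLp (hv.memLp_deriv j) mw hC,
      integrable_mul_inner hu.memLp hv.memLp mw' (hC' j)⟩
  obtain ⟨i1, i2, i3⟩ := ig hu hv
  refine ⟨(i1.add i2).add i3, ?_⟩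
  rw [integral_add_add i1 i2 i3]
  obtain ⟨φ, p1, p2, p3, p4⟩ := hu.exists_approx hA
  obtain ⟨χ, q1, q2, q3, q4⟩ := hv.exists_approx hA
  have hφ := fun n => MagSobolev.of_contDiff hA (p1 n) (p2 n)
  have hχ := fun n => MagSobolev.of_contDiff hA (q1 n) (q2 n)
  have t1 := tendsto_integral_mul_inner (fun n => (hφ n).memLp_deriv j) (fun n => (hχ n).memLp)
    (hu.memLp_deriv j) hv.memLp mw hC (p4 j) q3
  have t2 := tendsto_integral_mul_inner (fun n => (hφ n).memLp) (fun n => (hχ n).memLp_deriv j)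
    hu.memLp (hv.memLp_deriv j) mw hC p3 (q4 j)
  have t3 := tendsto_integral_mul_inner (fun n => (hφ n).memLp) (fun n => (hχ n).memLp)
    hu.memLp hv.memLp mw' (hC' j) p3 q3
  -- For test functions the integrand is the full derivative of `w ⟨φ, χ⟩`, whose integral vanishes.
  refine tendsto_nhds_unique ((t1.add t2).add t3) (tendsto_const_nhds.congr fun n => ?_)
  obtain ⟨j1, j2, j3⟩ := ig (hφ n) (hχ n)
  rw [← integral_add_add j1 j2 j3, ← integral_fderiv_eq_zero (contDiff_weighted hw (p1 n) (q1 n))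
    (hasCompactSupport_weighted w (χ n) (p2 n)) (EuclideanSpace.single j 1)]
  refine integral_congr_ae (Eventually.of_forall fun x => ?_)
  simp only [fderiv_weighted hw (p1 n) (q1 n), ← mul_add, inner_magDeriv_add, pderiv]

/-- The weight `|x| b(x)` is bounded relatively to the magnetic gradient, with constant `ε`. -/
structure HardyBound (A : Space d → Space d) (b : Space d → ℝ) (ε : ℝ) : Prop where
  aestronglyMeasurable : AEStronglyMeasurable b volume
  bound : ∀ (f : Space d → Spinor d) (D : Fin d → Space d → Spinor d), MagSobolev A f D →
    ∫⁻ x, ‖(‖x‖ * b x) • f x‖ₑ ^ 2 ≤ ENNReal.ofReal (ε ^ 2) * ∫⁻ x, ∑ j, ‖D j x‖ₑ ^ 2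

theorem HardyBound.aestronglyMeasurable_mul {b : Space d → ℝ} {ε : ℝ} (hb : HardyBound A b ε) :
    AEStronglyMeasurable (fun x => ‖x‖ * b x) volume :=
  continuous_norm.aestronglyMeasurable.mul hb.aestronglyMeasurable

theorem HardyBound.aestronglyMeasurable_smul {b : Space d → ℝ} {ε : ℝ} (hb : HardyBound A b ε)
    {f : Space d → Spinor d} (h : MemLp f 2 volume) :
    AEStronglyMeasurable (fun x => (‖x‖ * b x) • f x) volume :=
  hb.aestronglyMeasurable_mul.smul h.1

theorem HardyBound.eLpNorm_sq_le {b : Space d → ℝ} {ε : ℝ} (hb : HardyBound A b ε)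
    (h : MagSobolev A u Du) : eLpNorm (fun x => (‖x‖ * b x) • u x) 2 volume ^ 2
      ≤ ENNReal.ofReal (ε ^ 2) * ∑ j, eLpNorm (Du j) 2 volume ^ 2 := by
  rw [eLpNorm_two_sq]
  refine (hb.bound u Du h).trans ?_
  rw [lintegral_finsetSum' _ fun j _ => (h.memLp_deriv j).1.enorm.pow_const 2]
  simp only [eLpNorm_two_sq, le_refl]

theorem HardyBound.memLp {b : Space d → ℝ} {ε : ℝ} (hb : HardyBound A b ε)
    (h : MagSobolev A u Du) : MemLp (fun x => (‖x‖ * b x) • u x) 2 volume := by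
  refine ⟨hb.aestronglyMeasurable_smul h.memLp, ?_⟩
  have h2 : eLpNorm (fun x => (‖x‖ * b x) • u x) 2 volume ^ 2 < ⊤ :=
    (hb.eLpNorm_sq_le h).trans_lt (ENNReal.mul_lt_top ENNReal.ofReal_lt_top
      (ENNReal.sum_lt_top.2 fun j _ => ENNReal.pow_lt_top (h.memLp_deriv j).2))
  by_contra h3
  rw [not_lt, top_le_iff] at h3
  simp [h3] at h2

theorem HardyBound.tendsto {b : Space d → ℝ} {ε : ℝ} (hb : HardyBound A b ε)
    {f : ℕ → Space d → Spinor d} {D : ℕ → Fin d → Space d → Spinor d}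
    (h : ∀ n, MagSobolev A (f n) (D n)) (hu : MagSobolev A u Du)
    (hD : ∀ j, Tendsto (fun n => eLpNorm (D n j - Du j) 2 volume) atTop (𝓝 0)) :
    Tendsto (fun n => eLpNorm (fun x => (‖x‖ * b x) • (f n x - u x)) 2 volume) atTop (𝓝 0) := by
  have h1 : Tendsto (fun n => ENNReal.ofReal (ε ^ 2) * ∑ j, eLpNorm (D n j - Du j) 2 volume ^ 2)
      atTop (𝓝 0) := by
    have : Tendsto (fun n => ∑ j, eLpNorm (D n j - Du j) 2 volume ^ 2) atTop (𝓝 0) := by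
      rw [show (0 : ℝ≥0∞) = ∑ _j : Fin d, 0 ^ 2 by simp]
      exact tendsto_finsetSum _ fun j _ => ENNReal.Tendsto.pow (hD j)
    have := ENNReal.Tendsto.const_mul (a := ENNReal.ofReal (ε ^ 2)) this
      (Or.inr ENNReal.ofReal_ne_top)
    simpa using this
  have h2 := tendsto_of_tendsto_of_tendsto_of_le_of_le tendsto_const_nhds h1 (fun _ => zero_le)
    fun n => hb.eLpNorm_sq_le ((h n).sub hu)
  have h3 := (ENNReal.continuous_rpow_const (y := (1 / 2 : ℝ))).tendsto 0 |>.comp h2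
  rw [ENNReal.zero_rpow_of_pos (by norm_num)] at h3
  refine h3.congr fun n => ?_
  rw [Function.comp_apply, ← ENNReal.rpow_two, ← ENNReal.rpow_mul]
  norm_num

theorem MemL2loc.locallyIntegrable {E : Type*} [NormedAddCommGroup E] {f : Space d → E}
    (h : MemL2loc f) : LocallyIntegrable f volume :=
  (locallyIntegrable_iff).2 fun K hK => by
    have : IsFiniteMeasure (volume.restrict K) := ⟨by simpa using hK.measure_lt_top⟩
    exact (h K hK).integrable (by norm_num)

theorem MemL2loc.coord (hA : MemL2loc A) (j : Fin d) : MemL2loc fun x => A x j := fun K hK =>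
  (EuclideanSpace.proj j : Space d →L[ℝ] ℝ).comp_memLp' (hA K hK)

theorem MemL2loc.integrable_mul {a : Space d → ℝ} (ha : MemL2loc a) {ζ : Space d → ℂ}
    (hζ : Continuous ζ) (hs : HasCompactSupport ζ) : Integrable fun x => (a x : ℂ) * ζ x := by
  have h := ha.locallyIntegrable.integrable_smul_right_of_hasCompactSupport hζ hs
  refine h.congr (Eventually.of_forall fun x => ?_)
  simp

/-- The distributional identity for the magnetic field, for complex test functions. -/
theorem IsMagneticField.integral_complex {B : Space d → Matrix (Fin d) (Fin d) ℝ}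
    (hAB : IsMagneticField A B) (hA : MemL2loc A) (hB : ∀ j k, MemL2loc fun x => B x j k)
    (j k : Fin d) {ζ : Space d → ℂ} (hζ : ContDiff ℝ ∞ ζ) (hs : HasCompactSupport ζ) :
    ∫ x, ((A x k : ℂ) * fderiv ℝ ζ x (EuclideanSpace.single j 1)
      - (A x j : ℂ) * fderiv ℝ ζ x (EuclideanSpace.single k 1) + (B x j k : ℂ) * ζ x) = 0 := by
  have hc : ∀ l : Fin d, Continuous fun x => fderiv ℝ ζ x (EuclideanSpace.single l 1) := fun l =>
    (hζ.continuous_fderiv (by simp)).clm_apply continuous_const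
  have hcs : ∀ l : Fin d, HasCompactSupport fun x => fderiv ℝ ζ x (EuclideanSpace.single l 1) :=
    fun l => hs.fderiv_apply ℝ _
  have i1 := (hA.coord k).integrable_mul (hc j) (hcs j)
  have i2 := (hA.coord j).integrable_mul (hc k) (hcs k)
  have i3 := (hB j k).integrable_mul hζ.continuous hs
  -- The magnetic field is defined through real test functions, so the identity is applied to the
  -- real and imaginary parts of `ζ`.
  have key : ∀ L : ℂ →L[ℝ] ℝ, (∀ (r : ℝ) (z : ℂ), L (r * z) = r * L z) →
      L (∫ x, ((A x k : ℂ) * fderiv ℝ ζ x (EuclideanSpace.single j 1)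
      - (A x j : ℂ) * fderiv ℝ ζ x (EuclideanSpace.single k 1) + (B x j k : ℂ) * ζ x)) = 0 := by
    intro L hL
    have hp : ∀ (l : Fin d) x, pderiv l (fun x => L (ζ x)) x
        = L (fderiv ℝ ζ x (EuclideanSpace.single l 1)) := by
      intro l x
      have : HasFDerivAt (fun x => L (ζ x)) (L.comp (fderiv ℝ ζ x)) x :=
        L.hasFDerivAt.comp x (hζ.differentiable (by simp) x).hasFDerivAt
      rw [pderiv, this.fderiv]; rfl
    have h1 := hAB j k (fun x => L (ζ x)) (L.contDiff.comp hζ) (hs.comp_left (map_zero L))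
    simp only [hp, ← hL] at h1
    have e := integral_add (i1.sub i2) i3
    simp only [Pi.sub_apply] at e
    have e2 := L.integral_comp_comm (i1.sub i2)
    simp only [Pi.sub_apply, map_sub] at e2
    rw [e, map_add, ← L.integral_comp_comm i3, h1, ← e2]
    exact add_neg_cancel _
  refine Complex.ext ?_ ?_
  · exact key Complex.reCLM (fun r z => by simp)
  · exact key Complex.imCLM (fun r z => by simp)

theorem fderiv_fderiv_comm {F : Type*} [NormedAddCommGroup F] [NormedSpace ℝ F] {φ : Space d → F}
    (h : ContDiff ℝ ∞ φ) (x a b : Space d) :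
    fderiv ℝ (fun y => fderiv ℝ φ y a) x b = fderiv ℝ (fun y => fderiv ℝ φ y b) x a := by
  have hd : DifferentiableAt ℝ (fderiv ℝ φ) x :=
    (h.fderiv_right (m := 1) (by norm_cast)).differentiable (by simp) x
  have e : ∀ a b : Space d, fderiv ℝ (fun y => fderiv ℝ φ y a) x b = fderiv ℝ (fderiv ℝ φ) x b a := by
    intro a b
    rw [fderiv_clm_apply hd (differentiableAt_const a)]
    simp
  rw [e, e]
  exact (h.contDiffAt.isSymmSndFDerivAt (by
    simp only [minSmoothness_of_isRCLikeNormedField]; exact WithTop.coe_le_coe.2 (le_top (a := (2 : ℕ∞))))) b a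

theorem contDiff_fderiv_apply {F : Type*} [NormedAddCommGroup F] [NormedSpace ℝ F] {φ : Space d → F}
    (h : ContDiff ℝ ∞ φ) (a : Space d) :
    ContDiff ℝ ∞ fun y => fderiv ℝ φ y a :=
  (h.fderiv_right (m := ∞) (by simp)).clm_apply contDiff_const

/-- Interchange of two magnetic derivatives. -/
theorem MagSobolev.integral_commutator (hA : ∀ j, IsMultiplier fun x => A x j) (hAl : MemL2loc A)
    {B : Space d → Matrix (Fin d) (Fin d) ℝ} (hAB : IsMagneticField A B)
    (hB : ∀ j k, MemL2loc fun x => B x j k) {b : Space d → ℝ} {ε : ℝ} (hb : HardyBound A b ε)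
    (hBb : ∀ x j k, |B x j k| ≤ b x)
    (hu : MagSobolev A u Du) (hv : MagSobolev A v Dv) {w : Space d → ℝ} (hw : ContDiff ℝ ∞ w)
    {C C' C'' : ℝ} (hC : ∀ x, |w x| ≤ C) (hC' : ∀ j x, |pderiv j w x| ≤ C')
    (hC'' : ∀ x, |w x| ≤ C'' * ‖x‖) (j k : Fin d) :
    Integrable (fun x => (w x : ℂ) * inner ℂ (Du j x) (Dv k x)
      - (w x : ℂ) * inner ℂ (Du k x) (Dv j x) + (pderiv j w x : ℂ) * inner ℂ (u x) (Dv k x)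
      - (pderiv k w x : ℂ) * inner ℂ (u x) (Dv j x)
      - Complex.I * ((w x * B x j k : ℝ) * inner ℂ (u x) (v x))) ∧
    ∫ x, ((w x : ℂ) * inner ℂ (Du j x) (Dv k x)
      - (w x : ℂ) * inner ℂ (Du k x) (Dv j x) + (pderiv j w x : ℂ) * inner ℂ (u x) (Dv k x)
      - (pderiv k w x : ℂ) * inner ℂ (u x) (Dv j x)
      - Complex.I * ((w x * B x j k : ℝ) * inner ℂ (u x) (v x))) = 0 := by
  have mw : AEStronglyMeasurable w volume := hw.continuous.aestronglyMeasurable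
  have mw' : ∀ l, AEStronglyMeasurable (pderiv l w) volume := fun l =>
    (continuous_pderiv hw l).aestronglyMeasurable
  have mB : AEStronglyMeasurable (fun x => w x * B x j k) volume :=
    mw.mul (hB j k).locallyIntegrable.aestronglyMeasurable
  -- `B` is controlled only in the combination `|x| |B|`. The assumption `|w| ≤ C''‖x‖` is there so
  -- that `w B_{jk}` is dominated by it.
  have hle : ∀ x (s : Spinor d), ‖(w x * B x j k) • s‖ ≤ C'' * ‖(‖x‖ * b x) • s‖ := by
    intro x s
    have hb0 : 0 ≤ b x := (abs_nonneg _).trans (hBb x j k)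
    rw [norm_smul, norm_smul, ← mul_assoc, Real.norm_eq_abs, Real.norm_eq_abs, abs_mul, abs_mul,
      abs_norm, abs_of_nonneg hb0, ← mul_assoc]
    refine mul_le_mul_of_nonneg_right ?_ (norm_nonneg s)
    exact mul_le_mul (hC'' x) (hBb x j k) (abs_nonneg _) ((abs_nonneg _).trans (hC'' x))
  have mem : ∀ {v : Space d → Spinor d} {Dv : Fin d → Space d → Spinor d}, MagSobolev A v Dv →
      MemLp (fun x => (w x * B x j k) • v x) 2 volume := fun hv =>
    (hb.memLp hv).of_le_mul (mB.smul hv.memLp.1) (Eventually.of_forall fun x => hle x _)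
  have ig : ∀ {u v : Space d → Spinor d} {Du Dv : Fin d → Space d → Spinor d},
      MagSobolev A u Du → MagSobolev A v Dv →
      Integrable (fun x => (w x : ℂ) * inner ℂ (Du j x) (Dv k x)) ∧
      Integrable (fun x => (w x : ℂ) * inner ℂ (Du k x) (Dv j x)) ∧
      Integrable (fun x => (pderiv j w x : ℂ) * inner ℂ (u x) (Dv k x)) ∧
      Integrable (fun x => (pderiv k w x : ℂ) * inner ℂ (u x) (Dv j x)) ∧
      Integrable (fun x => Complex.I * ((w x * B x j k : ℝ) * inner ℂ (u x) (v x))) := fun hu hv =>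
    ⟨integrable_mul_inner (hu.memLp_deriv j) (hv.memLp_deriv k) mw hC,
      integrable_mul_inner (hu.memLp_deriv k) (hv.memLp_deriv j) mw hC,
      integrable_mul_inner hu.memLp (hv.memLp_deriv k) (mw' j) (hC' j),
      integrable_mul_inner hu.memLp (hv.memLp_deriv j) (mw' k) (hC' k),
      Integrable.const_mul (by
        simp only [← inner_real_smul_right]
        exact integrable_inner_of_memLp hu.memLp (mem hv)) _⟩
  obtain ⟨i1, i2, i3, i4, i5⟩ := ig hu hv
  refine ⟨(((i1.sub i2).add i3).sub i4).sub i5, ?_⟩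
  rw [integral_sub_add_sub_sub i1 i2 i3 i4 i5, integral_const_mul]
  obtain ⟨φ, p1, p2, p3, p4⟩ := hu.exists_approx hA
  obtain ⟨χ, q1, q2, q3, q4⟩ := hv.exists_approx hA
  have hφ := fun n => MagSobolev.of_contDiff hA (p1 n) (p2 n)
  have hχ := fun n => MagSobolev.of_contDiff hA (q1 n) (q2 n)
  have t1 := tendsto_integral_mul_inner (fun n => (hφ n).memLp_deriv j)
    (fun n => (hχ n).memLp_deriv k) (hu.memLp_deriv j) (hv.memLp_deriv k) mw hC (p4 j) (q4 k)
  have t2 := tendsto_integral_mul_inner (fun n => (hφ n).memLp_deriv k)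
    (fun n => (hχ n).memLp_deriv j) (hu.memLp_deriv k) (hv.memLp_deriv j) mw hC (p4 k) (q4 j)
  have t3 := tendsto_integral_mul_inner (fun n => (hφ n).memLp) (fun n => (hχ n).memLp_deriv k)
    hu.memLp (hv.memLp_deriv k) (mw' j) (hC' j) p3 (q4 k)
  have t4 := tendsto_integral_mul_inner (fun n => (hφ n).memLp) (fun n => (hχ n).memLp_deriv j)
    hu.memLp (hv.memLp_deriv j) (mw' k) (hC' k) p3 (q4 j)
  have t5 : Tendsto (fun n => ∫ x, ((w x * B x j k : ℝ) : ℂ) * inner ℂ (φ n x) (χ n x)) atTop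
      (𝓝 (∫ x, ((w x * B x j k : ℝ) : ℂ) * inner ℂ (u x) (v x))) := by
    simp only [← inner_real_smul_right]
    refine tendsto_integral_inner (fun n => (hφ n).memLp) (fun n => mem (hχ n)) hu.memLp (mem hv)
      p3 (tendsto_eLpNorm_of_le C'' (fun n => Eventually.of_forall fun x => ?_)
        (hb.tendsto hχ hv q4))
    simp only [Pi.sub_apply]
    rw [← smul_sub]
    exact hle x _
  refine tendsto_nhds_unique ((((t1.sub t2).add t3).sub t4).sub (t5.const_mul Complex.I))
    (tendsto_const_nhds.congr fun n => ?_)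
  obtain ⟨j1, j2, j3, j4, j5⟩ := ig (hφ n) (hχ n)
  rw [← integral_const_mul, ← integral_sub_add_sub_sub j1 j2 j3 j4 j5]
  have ck := contDiff_fderiv_apply (q1 n) (EuclideanSpace.single k 1)
  have cj := contDiff_fderiv_apply (q1 n) (EuclideanSpace.single j 1)
  have z1 := integral_fderiv_eq_zero (contDiff_weighted hw (p1 n) ck)
    (hasCompactSupport_weighted w _ (p2 n)) (EuclideanSpace.single j 1)
  have z2 := integral_fderiv_eq_zero (contDiff_weighted hw (p1 n) cj)
    (hasCompactSupport_weighted w _ (p2 n)) (EuclideanSpace.single k 1)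
  have hζ := contDiff_weighted hw (p1 n) (q1 n)
  have hζs := hasCompactSupport_weighted w (χ n) (p2 n)
  have z3 := hAB.integral_complex hAl hB j k hζ hζs
  have gi : ∀ {ξ : Space d → ℂ}, ContDiff ℝ ∞ ξ → HasCompactSupport ξ → ∀ a,
      Integrable fun x => fderiv ℝ ξ x a := fun h hs a =>
    ((h.continuous_fderiv (by simp)).clm_apply continuous_const).integrable_of_hasCompactSupport
      (hs.fderiv_apply ℝ a)
  have g1 := gi (contDiff_weighted hw (p1 n) ck) (hasCompactSupport_weighted w _ (p2 n))
    (EuclideanSpace.single j 1)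
  have g2 := gi (contDiff_weighted hw (p1 n) cj) (hasCompactSupport_weighted w _ (p2 n))
    (EuclideanSpace.single k 1)
  have hc : ∀ l : Fin d, Continuous fun x => fderiv ℝ (weighted w (φ n) (χ n)) x
      (EuclideanSpace.single l 1) := fun l =>
    (hζ.continuous_fderiv (by simp)).clm_apply continuous_const
  have g3 := (((hAl.coord k).integrable_mul (hc j) (hζs.fderiv_apply ℝ _)).sub
    ((hAl.coord j).integrable_mul (hc k) (hζs.fderiv_apply ℝ _))).add
    ((hB j k).integrable_mul hζ.continuous hζs)
  -- On test functions the claimed integrand is `∂_j(w⟨φ, ∂_kχ⟩) - ∂_k(w⟨φ, ∂_jχ⟩)` minus `i` times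
  -- the defining integrand of `B` tested with `ζ = w⟨φ, χ⟩`. The second derivatives of `χ` cancel
  -- by symmetry, and each of the three pieces integrates to zero.
  have z4 : (0 : ℂ) = ∫ x, (fderiv ℝ (weighted w (φ n) fun y => fderiv ℝ (χ n) y
        (EuclideanSpace.single k 1)) x (EuclideanSpace.single j 1)
      - fderiv ℝ (weighted w (φ n) fun y => fderiv ℝ (χ n) y
        (EuclideanSpace.single j 1)) x (EuclideanSpace.single k 1)
      - Complex.I * ((A x k : ℂ) * fderiv ℝ (weighted w (φ n) (χ n)) x (EuclideanSpace.single j 1)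
      - (A x j : ℂ) * fderiv ℝ (weighted w (φ n) (χ n)) x (EuclideanSpace.single k 1)
      + (B x j k : ℂ) * weighted w (φ n) (χ n) x)) := by
    have g3' := g3.const_mul Complex.I
    simp only [Pi.add_apply, Pi.sub_apply] at g3'
    have e := integral_sub (g1.sub g2) g3'
    simp only [Pi.sub_apply] at e
    rw [e, integral_sub g1 g2, z1, z2, integral_const_mul, z3]
    simp
  rw [z4]
  refine integral_congr_ae (Eventually.of_forall fun x => ?_)
  simp only [fderiv_weighted hw (p1 n) (q1 n), fderiv_weighted hw (p1 n) ck,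
    fderiv_weighted hw (p1 n) cj, fderiv_fderiv_comm (q1 n) x (EuclideanSpace.single k 1)
      (EuclideanSpace.single j 1), pderiv, weighted, magDeriv, inner_sub_left, inner_sub_right,
    inner_smul_left, inner_smul_right, Complex.conj_I, Complex.conj_ofReal, Complex.ofReal_mul]
  ring

end IntegrationByParts

/-! ### The magnetic Hardy inequality and the dilation generator -/

section Hardy

variable {d : ℕ}

theorem contDiff_coord (k : Fin d) : ContDiff ℝ ∞ (fun x : Space d => x k) :=
  (EuclideanSpace.proj k : Space d →L[ℝ] ℝ).contDiff

theorem pderiv_coord (j k : Fin d) (x : Space d) :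
    pderiv j (fun x : Space d => x k) x = if j = k then 1 else 0 := by
  have : HasFDerivAt (fun x : Space d => x k) (EuclideanSpace.proj k : Space d →L[ℝ] ℝ) x :=
    (EuclideanSpace.proj k : Space d →L[ℝ] ℝ).hasFDerivAt
  rw [pderiv, this.fderiv]
  simp [eq_comm]

theorem abs_coord_le (x : Space d) (k : Fin d) : |x k| ≤ ‖x‖ := by
  simpa using PiLp.norm_apply_le x k

theorem sum_coord_sq (x : Space d) : ∑ k, x k ^ 2 = ‖x‖ ^ 2 := by
  rw [EuclideanSpace.norm_sq_eq]; simp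

theorem contDiff_inv_norm_sq_add {δ : ℝ} (hδ : 0 < δ) :
    ContDiff ℝ ∞ (fun x : Space d => (‖x‖ ^ 2 + δ)⁻¹) :=
  ((contDiff_norm_sq ℝ).add contDiff_const).inv fun x => by positivity

theorem pderiv_inv_norm_sq_add {δ : ℝ} (hδ : 0 < δ) (j : Fin d) (x : Space d) :
    pderiv j (fun x : Space d => (‖x‖ ^ 2 + δ)⁻¹) x = -(2 * x j) / (‖x‖ ^ 2 + δ) ^ 2 := by
  have h0 : ‖x‖ ^ 2 + δ ≠ 0 := by positivity
  have h1 : HasFDerivAt (fun x : Space d => ‖x‖ ^ 2 + δ) (2 • innerSL ℝ x) x :=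
    (hasStrictFDerivAt_norm_sq x).hasFDerivAt.add_const δ
  have h2 : HasFDerivAt (fun x : Space d => (‖x‖ ^ 2 + δ)⁻¹) _ x :=
    (hasDerivAt_inv h0).comp_hasFDerivAt x h1
  rw [pderiv, h2.fderiv]
  simp [EuclideanSpace.inner_single_right]
  ring

/-- The pointwise length of a gradient. -/
noncomputable def gradLen (D : Fin d → Space d → Spinor d) (x : Space d) : ℝ :=
  √(∑ j, ‖D j x‖ ^ 2)

theorem gradLen_nonneg (D : Fin d → Space d → Spinor d) (x : Space d) : 0 ≤ gradLen D x :=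
  Real.sqrt_nonneg _

theorem gradLen_sq (D : Fin d → Space d → Spinor d) (x : Space d) :
    gradLen D x ^ 2 = ∑ j, ‖D j x‖ ^ 2 :=
  Real.sq_sqrt (Finset.sum_nonneg fun _ _ => by positivity)

/-- The contraction `w·D` of a vector field and a gradient. -/
noncomputable def contract (D : Fin d → Space d → Spinor d) (w x : Space d) : Spinor d :=
  ∑ j, w j • D j x

theorem norm_contract_le (D : Fin d → Space d → Spinor d) (w x : Space d) :
    ‖contract D w x‖ ≤ ‖w‖ * gradLen D x := by
  have h1 : ‖contract D w x‖ ≤ ∑ j, |w j| * ‖D j x‖ := by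
    refine (norm_sum_le _ _).trans (le_of_eq ?_)
    simp only [norm_smul, Real.norm_eq_abs]
  refine h1.trans ((Real.sum_mul_le_sqrt_mul_sqrt _ _ _).trans (le_of_eq ?_))
  simp only [sq_abs, sum_coord_sq, Real.sqrt_sq (norm_nonneg w)]
  rfl

variable {A : Space d → Space d} {f : Space d → Spinor d} {D : Fin d → Space d → Spinor d}

theorem MagSobolev.memLp_gradLen (h : MagSobolev A f D) : MemLp (gradLen D) 2 volume := by
  have hm : AEStronglyMeasurable (gradLen D) volume := by
    refine Real.continuous_sqrt.comp_aestronglyMeasurable ?_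
    exact Finset.aestronglyMeasurable_fun_sum _ fun j _ => ((h.memLp_deriv j).1.norm.pow 2)
  rw [memLp_two_iff_integrable_sq hm]
  simp only [gradLen_sq]
  exact integrable_finsetSum _ fun j _ => integrable_norm_sq (h.memLp_deriv j)

/-- The magnetic energy norm `‖∇_A f‖`. -/
noncomputable def energy (D : Fin d → Space d → Spinor d) : ℝ := l2norm volume (gradLen D)

theorem energy_sq (D : Fin d → Space d → Spinor d) :
    energy D ^ 2 = ∫ x, ∑ j, ‖D j x‖ ^ 2 := by
  rw [energy, l2norm_sq]
  simp only [Real.norm_eq_abs, sq_abs, gradLen_sq]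

theorem energy_nonneg (D : Fin d → Space d → Spinor d) : 0 ≤ energy D := l2norm_nonneg _

/-- The integrand of the regularized radial identity. -/
noncomputable def radialIntegrand (f : Space d → Spinor d) (D : Fin d → Space d → Spinor d)
    (δ : ℝ) (x : Space d) : ℝ :=
  2 * (‖x‖ ^ 2 + δ)⁻¹ * (inner ℂ (f x) (contract D x x)).re
    + (d * (‖x‖ ^ 2 + δ)⁻¹ - 2 * ‖x‖ ^ 2 / (‖x‖ ^ 2 + δ) ^ 2) * ‖f x‖ ^ 2

theorem MagSobolev.integral_radialIntegrand (hA : ∀ j, IsMultiplier fun x => A x j)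
    (h : MagSobolev A f D) {δ : ℝ} (hδ : 0 < δ) :
    Integrable (radialIntegrand f D δ) ∧ ∫ x, radialIntegrand f D δ x = 0 := by
  -- The vector field `x/|x|²` is regularized to `x/(|x|² + δ)`, which is smooth and bounded with
  -- bounded derivatives. Integration by parts with its components as weights, summed over the
  -- components, gives the claim.
  let g : Space d → ℝ := fun x => (‖x‖ ^ 2 + δ)⁻¹
  have hg : ContDiff ℝ ∞ g := contDiff_inv_norm_sq_add hδ
  have hg0 : ∀ x : Space d, 0 < ‖x‖ ^ 2 + δ := fun x => by positivity
  have hw : ∀ j, ContDiff ℝ ∞ (fun x : Space d => x j * g x) := fun j => (contDiff_coord j).mul hg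
  have hd : ∀ j l x, pderiv l (fun x : Space d => x j * g x) x
      = x j * (-(2 * x l) / (‖x‖ ^ 2 + δ) ^ 2) + (if l = j then 1 else 0) * g x := by
    intro j l x
    rw [pderiv_mul (contDiff_coord j) hg, pderiv_coord, pderiv_inv_norm_sq_add hδ]
  have hgδ : ∀ x, g x ≤ δ⁻¹ := fun x =>
    inv_anti₀ hδ (by have := sq_nonneg ‖x‖; linarith)
  have b1 : ∀ j x, |(fun x : Space d => x j * g x) x| ≤ 1 + δ⁻¹ := by
    intro j x
    have e : |g x| = (‖x‖ ^ 2 + δ)⁻¹ := abs_of_pos (inv_pos.2 (hg0 x))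
    simp only [abs_mul, e]
    rw [← div_eq_mul_inv, div_le_iff₀ (hg0 x)]
    have h1 := abs_coord_le x j
    have h2 : (1 + δ⁻¹) * (‖x‖ ^ 2 + δ) = ‖x‖ ^ 2 + δ + δ⁻¹ * ‖x‖ ^ 2 + 1 := by
      field_simp
      ring
    rw [h2]
    have h3 : 0 ≤ δ⁻¹ * ‖x‖ ^ 2 := by positivity
    nlinarith [sq_nonneg (‖x‖ - 1), norm_nonneg x]
  have b2 : ∀ j l x, |pderiv l (fun x : Space d => x j * g x) x| ≤ 3 * δ⁻¹ := by
    intro j l x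
    rw [hd]
    have e : |g x| = (‖x‖ ^ 2 + δ)⁻¹ := abs_of_pos (inv_pos.2 (hg0 x))
    have h1 : |x j * (-(2 * x l) / (‖x‖ ^ 2 + δ) ^ 2)| ≤ 2 * δ⁻¹ := by
      have e2 : x j * (-(2 * x l) / (‖x‖ ^ 2 + δ) ^ 2) = -(2 * (x j * x l * g x * g x)) := by
        simp only [g]; field_simp
      rw [e2, abs_neg, abs_mul, abs_two]
      gcongr 2 * ?_
      rw [abs_mul, abs_mul, abs_mul, e]
      have : |x j| * |x l| * (‖x‖ ^ 2 + δ)⁻¹ ≤ 1 := by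
        rw [← div_eq_mul_inv, div_le_one (hg0 x)]
        have := mul_le_mul (abs_coord_le x j) (abs_coord_le x l) (abs_nonneg _) (norm_nonneg _)
        nlinarith
      calc _ ≤ 1 * (‖x‖ ^ 2 + δ)⁻¹ := mul_le_mul_of_nonneg_right this (inv_pos.2 (hg0 x)).le
        _ ≤ δ⁻¹ := by rw [one_mul]; exact hgδ x
    have h2 : |(if l = j then 1 else 0) * g x| ≤ δ⁻¹ := by
      rw [abs_mul, e]
      split_ifs
      · simpa using hgδ x
      · simp [hδ.le]
    calc _ ≤ _ := abs_add_le _ _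
      _ ≤ 2 * δ⁻¹ + δ⁻¹ := add_le_add h1 h2
      _ = _ := by ring
  have key := fun j => h.integral_by_parts hA h (hw j) (b1 j) (b2 j) j
  have hpt : ∀ x, radialIntegrand f D δ x = Complex.reCLM (∑ j,
      (((x j * g x : ℝ) : ℂ) * inner ℂ (D j x) (f x) + ((x j * g x : ℝ) : ℂ) * inner ℂ (f x) (D j x)
      + (pderiv j (fun x : Space d => x j * g x) x : ℂ) * inner ℂ (f x) (f x))) := by
    intro x
    have e1 : ∀ j, (inner ℂ (D j x) (f x)).re = (inner ℂ (f x) (D j x)).re := fun j => by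
      rw [← inner_conj_symm, Complex.conj_re]
    have e2 : (inner ℂ (f x) (f x) : ℂ).re = ‖f x‖ ^ 2 := by
      rw [inner_self_eq_norm_sq_to_K]; norm_cast
    simp only [Complex.re_sum, Complex.reCLM_apply, Complex.add_re, Complex.re_ofReal_mul, e1, e2,
      hd]
    simp only [Finset.sum_add_distrib, ← Finset.sum_mul, if_true]
    simp only [radialIntegrand, contract, inner_sum, inner_real_smul_right, Complex.re_sum,
      Complex.re_ofReal_mul]
    have e3 : ∑ j, x j * (-(2 * x j) / (‖x‖ ^ 2 + δ) ^ 2) = -(2 * ‖x‖ ^ 2 / (‖x‖ ^ 2 + δ) ^ 2) := by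
      rw [← sum_coord_sq, Finset.mul_sum, Finset.sum_div, ← Finset.sum_neg_distrib]
      refine Finset.sum_congr rfl fun j _ => ?_
      ring
    have e4 : ∑ j, x j * g x * (inner ℂ (f x) (D j x)).re
        = (‖x‖ ^ 2 + δ)⁻¹ * ∑ j, x j * (inner ℂ (f x) (D j x)).re := by
      rw [Finset.mul_sum]
      refine Finset.sum_congr rfl fun j _ => ?_
      simp only [g]; ring
    rw [e3, e4]
    simp [g]
    ring
  have hint := integrable_finsetSum Finset.univ fun j _ => (key j).1
  have h0 : ∫ x, ∑ j,
      (((x j * g x : ℝ) : ℂ) * inner ℂ (D j x) (f x) + ((x j * g x : ℝ) : ℂ) * inner ℂ (f x) (D j x)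
      + (pderiv j (fun x : Space d => x j * g x) x : ℂ) * inner ℂ (f x) (f x)) = 0 := by
    rw [integral_finsetSum _ fun j _ => (key j).1]
    exact Finset.sum_eq_zero fun j _ => (key j).2
  constructor
  · exact (Complex.reCLM.integrable_comp hint).congr (Eventually.of_forall fun x => (hpt x).symm)
  · simp only [hpt]
    rw [ContinuousLinearMap.integral_comp_comm _ hint, h0, map_zero]

/-- The function `f / |x|`. -/
noncomputable def divNorm (f : Space d → Spinor d) (x : Space d) : Spinor d := ‖x‖⁻¹ • f x

theorem aestronglyMeasurable_divNorm (hf : AEStronglyMeasurable f volume) :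
    AEStronglyMeasurable (divNorm f) volume :=
  (measurable_norm.inv.aestronglyMeasurable).smul hf

/-- With `q = f/√(|x|² + δ)` the radial identity gives `(d-2)‖q‖² ≤ 2‖q‖ ‖∇_A f‖`, and one factor
`‖q‖` is divided out. The bound does not depend on `δ`. -/
theorem MagSobolev.integral_regularized_le (hA : ∀ j, IsMultiplier fun x => A x j) (hd : 3 ≤ d)
    (h : MagSobolev A f D) {δ : ℝ} (hδ : 0 < δ) :
    Integrable (fun x => (‖x‖ ^ 2 + δ)⁻¹ * ‖f x‖ ^ 2) ∧
    ∫ x, (‖x‖ ^ 2 + δ)⁻¹ * ‖f x‖ ^ 2 ≤ (2 / ((d : ℝ) - 2) * energy D) ^ 2 := by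
  have hd2 : (0 : ℝ) < (d : ℝ) - 2 := by
    have : (3 : ℝ) ≤ d := by exact_mod_cast hd
    linarith
  have hg0 : ∀ x : Space d, 0 < ‖x‖ ^ 2 + δ := fun x => by positivity
  obtain ⟨i0, e0⟩ := h.integral_radialIntegrand hA hδ
  let q : Space d → Spinor d := fun x => √((‖x‖ ^ 2 + δ)⁻¹) • f x
  have hqc : Continuous fun x : Space d => √((‖x‖ ^ 2 + δ)⁻¹) :=
    Real.continuous_sqrt.comp (contDiff_inv_norm_sq_add hδ).continuous
  have hq : MemLp q 2 volume := by
    refine memLp_smul_of_bdd hqc.aestronglyMeasurable (C := √(δ⁻¹)) (fun x => ?_) h.memLp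
    rw [abs_of_nonneg (Real.sqrt_nonneg _)]
    exact Real.sqrt_le_sqrt (inv_anti₀ hδ (by have := sq_nonneg ‖x‖; linarith))
  have hqn : ∀ x, ‖q x‖ ^ 2 = (‖x‖ ^ 2 + δ)⁻¹ * ‖f x‖ ^ 2 := fun x => by
    simp only [q]
    rw [norm_smul, mul_pow, Real.norm_of_nonneg (Real.sqrt_nonneg _),
      Real.sq_sqrt (inv_pos.2 (hg0 x)).le]
  have iq := integrable_norm_sq hq
  have hqi : ∫ x, ‖q x‖ ^ 2 = l2norm volume q ^ 2 := (l2norm_sq q).symm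
  simp only [hqn] at iq hqi
  refine ⟨iq, ?_⟩
  have hG := h.memLp_gradLen
  -- The divergence of the regularized field is at least `(d-2)/(|x|² + δ)`, and `|x|/(|x|² + δ) ≤
  -- 1/√(|x|² + δ)`.
  have hpt : ∀ x, ((d : ℝ) - 2) * ((‖x‖ ^ 2 + δ)⁻¹ * ‖f x‖ ^ 2) ≤
      radialIntegrand f D δ x + 2 * (‖q x‖ * ‖gradLen D x‖) := by
    intro x
    have hi := hg0 x
    have a1 : -(‖q x‖ * ‖gradLen D x‖) ≤ (‖x‖ ^ 2 + δ)⁻¹ * (inner ℂ (f x) (contract D x x)).re := by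
      have b1 : |(inner ℂ (f x) (contract D x x)).re| ≤ ‖f x‖ * (‖x‖ * gradLen D x) :=
        (Complex.abs_re_le_norm _).trans ((norm_inner_le_norm _ _).trans
          (mul_le_mul_of_nonneg_left (norm_contract_le D x x) (norm_nonneg _)))
      have b2 : (‖x‖ ^ 2 + δ)⁻¹ * ‖x‖ ≤ √((‖x‖ ^ 2 + δ)⁻¹) := by
        refine Real.le_sqrt_of_sq_le ?_
        rw [mul_pow]
        have : (‖x‖ ^ 2 + δ)⁻¹ * ‖x‖ ^ 2 ≤ 1 := by
          rw [inv_mul_le_iff₀ hi]; linarith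
        calc _ = (‖x‖ ^ 2 + δ)⁻¹ * ((‖x‖ ^ 2 + δ)⁻¹ * ‖x‖ ^ 2) := by ring
          _ ≤ (‖x‖ ^ 2 + δ)⁻¹ * 1 := mul_le_mul_of_nonneg_left this (inv_pos.2 hi).le
          _ = _ := mul_one _
      have b3 : ‖q x‖ = √((‖x‖ ^ 2 + δ)⁻¹) * ‖f x‖ := by
        simp only [q]
        rw [norm_smul, Real.norm_of_nonneg (Real.sqrt_nonneg _)]
      rw [b3, Real.norm_of_nonneg (gradLen_nonneg _ _)]
      have b4 := (abs_le.1 b1).1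
      have b5 := mul_le_mul_of_nonneg_left b4 (inv_pos.2 hi).le
      have b6 : (‖x‖ ^ 2 + δ)⁻¹ * ‖x‖ * (‖f x‖ * gradLen D x)
          ≤ √((‖x‖ ^ 2 + δ)⁻¹) * (‖f x‖ * gradLen D x) :=
        mul_le_mul_of_nonneg_right b2 (mul_nonneg (norm_nonneg _) (gradLen_nonneg _ _))
      nlinarith
    have a2 : 2 * ‖x‖ ^ 2 / (‖x‖ ^ 2 + δ) ^ 2 ≤ 2 * (‖x‖ ^ 2 + δ)⁻¹ := by
      rw [div_le_iff₀ (by positivity), pow_two (‖x‖ ^ 2 + δ), ← mul_assoc, mul_assoc 2,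
        inv_mul_cancel₀ hi.ne']
      linarith
    have a3 := mul_le_mul_of_nonneg_right a2 (sq_nonneg ‖f x‖)
    simp only [radialIntegrand]
    nlinarith
  have i1 := integrable_norm_mul_norm hq hG
  have e1 : ∫ x, (radialIntegrand f D δ x + 2 * (‖q x‖ * ‖gradLen D x‖))
      = 2 * ∫ x, ‖q x‖ * ‖gradLen D x‖ := by
    rw [integral_add i0 (i1.const_mul 2), e0, zero_add, integral_const_mul]
  have h1 := integral_mono (iq.const_mul ((d : ℝ) - 2)) (i0.add (i1.const_mul 2)) hpt
  simp only [Pi.add_apply] at h1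
  rw [integral_const_mul, e1, hqi] at h1
  have h2 := integral_norm_mul_norm_le hq hG
  rw [hqi]
  have h3 : l2norm volume q ≤ 2 / ((d : ℝ) - 2) * energy D := by
    rcases (l2norm_nonneg (μ := volume) q).eq_or_lt with h0 | h0
    · rw [← h0]
      exact mul_nonneg (by positivity) (energy_nonneg D)
    · rw [div_mul_eq_mul_div, le_div_iff₀ hd2]
      have : l2norm volume q * (l2norm volume q * ((d : ℝ) - 2))
          ≤ l2norm volume q * (2 * energy D) := by
        rw [energy]; nlinarith
      exact le_of_mul_le_mul_left this h0
  exact pow_le_pow_left₀ (l2norm_nonneg _) h3 2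

/-- The magnetic Hardy inequality. -/
theorem MagSobolev.hardy (hA : ∀ j, IsMultiplier fun x => A x j) (hd : 3 ≤ d)
    (h : MagSobolev A f D) :
    MemLp (divNorm f) 2 volume ∧ l2norm volume (divNorm f) ≤ 2 / ((d : ℝ) - 2) * energy D := by
  have hd2 : (0 : ℝ) < (d : ℝ) - 2 := by
    have : (3 : ℝ) ≤ d := by exact_mod_cast hd
    linarith
  have hC : 0 ≤ 2 / ((d : ℝ) - 2) * energy D := mul_nonneg (by positivity) (energy_nonneg D)
  let δ : ℕ → ℝ := fun n => 1 / ((n : ℝ) + 1)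
  have hδ : ∀ n, 0 < δ n := fun n => by positivity
  have hm := aestronglyMeasurable_divNorm h.memLp.1
  -- Fatou's lemma as `δ = 1/(n+1)` tends to zero. At `x = 0` the left integrand vanishes because
  -- `0⁻¹ = 0`.
  have key : ∫⁻ x, ‖divNorm f x‖ₑ ^ 2 ≤ ENNReal.ofReal ((2 / ((d : ℝ) - 2) * energy D) ^ 2) := by
    calc ∫⁻ x, ‖divNorm f x‖ₑ ^ 2
        ≤ ∫⁻ x, liminf (fun n => ENNReal.ofReal ((‖x‖ ^ 2 + δ n)⁻¹ * ‖f x‖ ^ 2)) atTop := by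
          refine lintegral_mono fun x => ?_
          rcases eq_or_ne x 0 with rfl | hx
          · simp [divNorm]
          · refine le_of_eq (Tendsto.liminf_eq ?_).symm
            have e : ‖divNorm f x‖ₑ ^ 2 = ENNReal.ofReal ((‖x‖ ^ 2 + 0)⁻¹ * ‖f x‖ ^ 2) := by
              rw [← ofReal_norm, ← ENNReal.ofReal_pow (norm_nonneg _), divNorm, norm_smul, mul_pow,
                norm_inv, norm_norm, inv_pow, add_zero]
            rw [e]
            refine ENNReal.tendsto_ofReal (Tendsto.mul_const _ (Tendsto.inv₀ ?_ ?_))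
            · exact tendsto_const_nhds.add tendsto_one_div_add_atTop_nhds_zero_nat
            · simpa using hx
      _ ≤ liminf (fun n => ∫⁻ x, ENNReal.ofReal ((‖x‖ ^ 2 + δ n)⁻¹ * ‖f x‖ ^ 2)) atTop := by
          refine lintegral_liminf_le' fun n => ?_
          exact (h.integral_regularized_le hA hd (hδ n)).1.1.aemeasurable.ennreal_ofReal
      _ ≤ _ := by
          refine liminf_le_of_frequently_le' (Eventually.frequently (Eventually.of_forall fun n => ?_))
          obtain ⟨i1, i2⟩ := h.integral_regularized_le hA hd (hδ n)
          rw [← ofReal_integral_eq_lintegral_ofReal i1 (Eventually.of_forall fun x => by positivity)]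
          exact ENNReal.ofReal_le_ofReal i2
  have hmem : MemLp (divNorm f) 2 volume := by
    refine ⟨hm, ?_⟩
    rw [← eLpNorm_two_sq] at key
    have h2 := key.trans_lt ENNReal.ofReal_lt_top
    by_contra h3
    rw [not_lt, top_le_iff] at h3
    simp [h3] at h2
  refine ⟨hmem, l2norm_le_of_sq_le hC ?_⟩
  have i := integrable_norm_sq hmem
  have e := ofReal_integral_eq_lintegral_ofReal i (Eventually.of_forall fun x => by positivity)
  have e2 : ∀ x, ENNReal.ofReal (‖divNorm f x‖ ^ 2) = ‖divNorm f x‖ₑ ^ 2 := fun x => by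
    rw [← ofReal_norm, ← ENNReal.ofReal_pow (norm_nonneg _)]
  simp only [e2] at e
  rw [← e] at key
  exact (ENNReal.ofReal_le_ofReal_iff (sq_nonneg _)).1 key

theorem ae_ne_zero (hd : 3 ≤ d) : ∀ᵐ x : Space d, x ≠ 0 := by
  have : Nonempty (Fin d) := ⟨⟨0, by omega⟩⟩
  exact Measure.ae_ne volume 0

theorem MagSobolev.norm_divNorm_contract_le (D : Fin d → Space d → Spinor d) (x : Space d) :
    ‖divNorm (fun x => contract D x x) x‖ ≤ ‖gradLen D x‖ := by
  rw [divNorm, norm_smul, norm_inv, norm_norm, Real.norm_of_nonneg (gradLen_nonneg _ _)]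
  rcases eq_or_ne x 0 with rfl | hx
  · simpa using gradLen_nonneg D 0
  · rw [inv_mul_le_iff₀ (norm_pos_iff.2 hx)]
    exact norm_contract_le D x x

theorem MagSobolev.memLp_divNorm_contract (h : MagSobolev A f D) :
    MemLp (divNorm fun x => contract D x x) 2 volume := by
  refine h.memLp_gradLen.of_le (aestronglyMeasurable_divNorm ?_)
    (Eventually.of_forall fun x => norm_divNorm_contract_le D x)
  exact Finset.aestronglyMeasurable_fun_sum _ fun j _ =>
    (contDiff_coord j).continuous.aestronglyMeasurable.smul (h.memLp_deriv j).1

/-- The radial identity underlying the Hardy inequality. -/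
theorem MagSobolev.integral_radial (hA : ∀ j, IsMultiplier fun x => A x j) (hd : 3 ≤ d)
    (h : MagSobolev A f D) :
    2 * ∫ x, (inner ℂ (divNorm f x) (divNorm (fun x => contract D x x) x)).re
      = -((d : ℝ) - 2) * ∫ x, ‖divNorm f x‖ ^ 2 := by
  obtain ⟨hN, -⟩ := h.hardy hA hd
  have hR := h.memLp_divNorm_contract
  let δ : ℕ → ℝ := fun n => 1 / ((n : ℝ) + 1)
  have hδ : ∀ n, 0 < δ n := fun n => by positivity
  have i1 : Integrable fun x => (inner ℂ (divNorm f x) (divNorm (fun x => contract D x x) x)).re :=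
    Complex.reCLM.integrable_comp (integrable_inner_of_memLp hN hR)
  have i2 := integrable_norm_sq hN
  have t : Tendsto (fun n => ∫ x, radialIntegrand f D (δ n) x) atTop
      (𝓝 (∫ x, (2 * (inner ℂ (divNorm f x) (divNorm (fun x => contract D x x) x)).re
        + ((d : ℝ) - 2) * ‖divNorm f x‖ ^ 2))) := by
    -- An equality is wanted, so Fatou does not suffice; the Hardy inequality just proved makes the
    -- majorant integrable.
    refine tendsto_integral_of_dominated_convergence
      (fun x => 2 * (‖divNorm f x‖ * ‖divNorm (fun x => contract D x x) x‖)
        + ((d : ℝ) + 2) * ‖divNorm f x‖ ^ 2)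
      (fun n => (h.integral_radialIntegrand hA (hδ n)).1.1)
      (((integrable_norm_mul_norm hN hR).const_mul 2).add (i2.const_mul _)) (fun n => ?_) ?_
    · filter_upwards [ae_ne_zero hd] with x hx
      have hx0 : 0 < ‖x‖ := norm_pos_iff.2 hx
      have hi : 0 < ‖x‖ ^ 2 + δ n := by have := hδ n; positivity
      have c1 : (‖x‖ ^ 2 + δ n)⁻¹ ≤ ‖x‖⁻¹ ^ 2 := by
        rw [inv_pow]
        exact inv_anti₀ (by positivity) (by have := hδ n; linarith)
      have c0 : 0 < (‖x‖ ^ 2 + δ n)⁻¹ := inv_pos.2 hi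
      have c2 : |2 * ‖x‖ ^ 2 / (‖x‖ ^ 2 + δ n) ^ 2| ≤ 2 * ‖x‖⁻¹ ^ 2 := by
        rw [abs_of_nonneg (by positivity)]
        have : 2 * ‖x‖ ^ 2 / (‖x‖ ^ 2 + δ n) ^ 2 ≤ 2 * (‖x‖ ^ 2 + δ n)⁻¹ := by
          rw [div_le_iff₀ (by positivity), pow_two (‖x‖ ^ 2 + δ n), ← mul_assoc, mul_assoc 2,
            inv_mul_cancel₀ hi.ne']
          have := hδ n
          linarith
        linarith
      have c3 : |(inner ℂ (f x) (contract D x x)).re| ≤ ‖f x‖ * ‖contract D x x‖ :=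
        (Complex.abs_re_le_norm _).trans (norm_inner_le_norm _ _)
      simp only [radialIntegrand, divNorm, norm_smul, norm_inv, norm_norm]
      refine (norm_add_le _ _).trans (add_le_add ?_ ?_)
      · rw [norm_mul, norm_mul, Real.norm_eq_abs, Real.norm_eq_abs, Real.norm_eq_abs, abs_two,
          abs_of_pos c0]
        calc _ ≤ 2 * ‖x‖⁻¹ ^ 2 * (‖f x‖ * ‖contract D x x‖) := by gcongr
          _ = _ := by ring
      · rw [norm_mul, Real.norm_eq_abs, Real.norm_eq_abs, abs_of_nonneg (sq_nonneg ‖f x‖), mul_pow,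
          ← mul_assoc]
        refine mul_le_mul_of_nonneg_right ((abs_sub _ _).trans ?_) (sq_nonneg _)
        rw [add_mul]
        refine add_le_add ?_ c2
        rw [abs_of_nonneg (by positivity)]
        gcongr
    · filter_upwards [ae_ne_zero hd] with x hx
      have hx0 : ‖x‖ ^ 2 + 0 ≠ 0 := by simpa using hx
      have td : Tendsto (fun n => ‖x‖ ^ 2 + δ n) atTop (𝓝 (‖x‖ ^ 2 + 0)) :=
        tendsto_const_nhds.add tendsto_one_div_add_atTop_nhds_zero_nat
      have e : 2 * (inner ℂ (divNorm f x) (divNorm (fun x => contract D x x) x)).re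
          + ((d : ℝ) - 2) * ‖divNorm f x‖ ^ 2
          = 2 * (‖x‖ ^ 2 + 0)⁻¹ * (inner ℂ (f x) (contract D x x)).re
          + (d * (‖x‖ ^ 2 + 0)⁻¹ - 2 * ‖x‖ ^ 2 / (‖x‖ ^ 2 + 0) ^ 2) * ‖f x‖ ^ 2 := by
        simp only [divNorm, inner_real_smul_left, inner_real_smul_right, Complex.re_ofReal_mul,
          norm_smul, norm_inv, norm_norm]
        have : ‖x‖ ≠ 0 := norm_ne_zero_iff.2 hx
        field_simp
        ring
      rw [e]
      have ti := td.inv₀ hx0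
      exact ((ti.const_mul 2).mul_const _).add (((ti.const_mul _).sub
        (tendsto_const_nhds.div (td.pow 2) (pow_ne_zero 2 hx0))).mul_const _)
  have e0 : ∀ n, ∫ x, radialIntegrand f D (δ n) x = 0 := fun n =>
    (h.integral_radialIntegrand hA (hδ n)).2
  simp only [e0] at t
  have := tendsto_nhds_unique t tendsto_const_nhds
  rw [integral_add (i1.const_mul 2) (i2.const_mul _), integral_const_mul, integral_const_mul] at this
  linarith

/-- The dilation generator `x·∇_A f + (d/2) f`. -/
noncomputable def dilation (f : Space d → Spinor d) (D : Fin d → Space d → Spinor d)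
    (x : Space d) : Spinor d := contract D x x + ((d : ℝ) / 2) • f x

theorem divNorm_dilation (f : Space d → Spinor d) (D : Fin d → Space d → Spinor d) (x : Space d) :
    divNorm (dilation f D) x
      = divNorm (fun x => contract D x x) x + ((d : ℝ) / 2) • divNorm f x := by
  simp only [divNorm, dilation, smul_add, smul_comm ‖x‖⁻¹]

theorem MagSobolev.memLp_divNorm_dilation (hA : ∀ j, IsMultiplier fun x => A x j) (hd : 3 ≤ d)
    (h : MagSobolev A f D) : MemLp (divNorm (dilation f D)) 2 volume := by
  have := h.memLp_divNorm_contract.add ((h.hardy hA hd).1.const_smul ((d : ℝ) / 2))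
  exact this.ae_eq (Eventually.of_forall fun x => (divNorm_dilation f D x).symm)

/-- A bound for the dilation generator, sharper than what the triangle inequality gives. -/
theorem MagSobolev.l2norm_divNorm_dilation_le (hA : ∀ j, IsMultiplier fun x => A x j) (hd : 3 ≤ d)
    (h : MagSobolev A f D) :
    l2norm volume (divNorm (dilation f D)) ≤ (if d = 3 then 2 else 1) * energy D := by
  have hρ : (0 : ℝ) ≤ if d = 3 then 2 else 1 := by split_ifs <;> norm_num
  refine l2norm_le_of_sq_le (mul_nonneg hρ (energy_nonneg D)) ?_
  obtain ⟨hN, hN2⟩ := h.hardy hA hd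
  have hR := h.memLp_divNorm_contract
  have i1 : Integrable fun x => (inner ℂ (divNorm f x) (divNorm (fun x => contract D x x) x)).re :=
    Complex.reCLM.integrable_comp (integrable_inner_of_memLp hN hR)
  have i2 := integrable_norm_sq hN
  have i3 := integrable_norm_sq hR
  have e : ∀ x, ‖divNorm (dilation f D) x‖ ^ 2
      = ‖divNorm (fun x => contract D x x) x‖ ^ 2
        + (d * (inner ℂ (divNorm f x) (divNorm (fun x => contract D x x) x)).re
        + (d : ℝ) ^ 2 / 4 * ‖divNorm f x‖ ^ 2) := by
    intro x
    have e1 := norm_add_sq (𝕜 := ℂ) (divNorm (fun x => contract D x x) x)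
      (((d : ℝ) / 2) • divNorm f x)
    have e2 : (inner ℂ (divNorm (fun x => contract D x x) x) (divNorm f x)).re
        = (inner ℂ (divNorm f x) (divNorm (fun x => contract D x x) x)).re := by
      rw [← inner_conj_symm, Complex.conj_re]
    rw [divNorm_dilation, e1, inner_real_smul_right, norm_smul, mul_pow]
    simp only [RCLike.re_eq_complex_re, Complex.re_ofReal_mul, e2, Real.norm_eq_abs, sq_abs]
    ring
  simp only [e]
  have i4 := (i1.const_mul (d : ℝ)).add (i2.const_mul ((d : ℝ) ^ 2 / 4))
  simp only [Pi.add_def] at i4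
  rw [integral_add i3 i4, integral_add (i1.const_mul _) (i2.const_mul _), integral_const_mul,
    integral_const_mul]
  have hrad := h.integral_radial hA hd
  have hX : ∫ x, ‖divNorm (fun x => contract D x x) x‖ ^ 2 ≤ energy D ^ 2 := by
    have := l2norm_mono hR h.memLp_gradLen (Eventually.of_forall fun x =>
      norm_divNorm_contract_le D x)
    rw [← l2norm_sq]
    exact pow_le_pow_left₀ (l2norm_nonneg _) this 2
  rw [← l2norm_sq] at hrad ⊢
  rw [← l2norm_sq] at hX
  rw [← l2norm_sq (divNorm f)]
  set N := l2norm volume (divNorm f)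
  have hN0 : 0 ≤ N := l2norm_nonneg _
  set I := ∫ x, (inner ℂ (divNorm f x) (divNorm (fun x => contract D x x) x)).re
  -- The radial identity evaluates the cross term exactly, so with `R = x·∇_A f/|x|` the square is
  -- `‖R‖² - d(d-4)/4 · N²`. For `d ≥ 4` the last term is dropped; for `d = 3` it is `+3/4 · N² ≤ 3
  -- · energy²`, for a total of `4 · energy²`.
  have hI : (d : ℝ) * I = -(d * ((d : ℝ) - 2) / 2) * N ^ 2 := by
    linear_combination (d : ℝ) / 2 * hrad
  rw [hI, mul_pow]
  have hd3 : (3 : ℝ) ≤ d := by exact_mod_cast hd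
  split_ifs with h3
  · subst h3
    have : N ≤ 2 * energy D := by norm_num at hN2; exact hN2
    have : N ^ 2 ≤ (2 * energy D) ^ 2 := pow_le_pow_left₀ hN0 this 2
    push_cast
    nlinarith
  · have h4 : (4 : ℝ) ≤ d := by exact_mod_cast (by omega : 4 ≤ d)
    have : 0 ≤ (d : ℝ) * (d - 4) * N ^ 2 :=
      mul_nonneg (mul_nonneg (by linarith) (by linarith)) (sq_nonneg _)
    nlinarith

end Hardy

/-! ### Cutoffs to annuli -/

section Annulus

variable {d : ℕ}

/-- A smooth cutoff to the annulus `1 / (n + 1) ≤ |x| ≤ 2 (n + 1)`. -/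
noncomputable def annulus (n : ℕ) (x : Space d) : ℝ :=
  cutoff d ((1 / ((n : ℝ) + 1)) • x) - cutoff d (((n : ℝ) + 1) • x)

theorem contDiff_annulus (n : ℕ) : ContDiff ℝ ∞ (annulus n : Space d → ℝ) :=
  (contDiff_cutoff _).sub (contDiff_cutoff _)

theorem hasCompactSupport_annulus (n : ℕ) : HasCompactSupport (annulus n : Space d → ℝ) := by
  have h : ∀ c : ℝ, 0 < c → HasCompactSupport (fun x : Space d => cutoff d (c • x)) := fun c hc =>
    (cutoff d).hasCompactSupport.comp_homeomorph (Homeomorph.smulOfNeZero c hc.ne')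
  exact (h _ (by positivity)).sub (h _ (by positivity))

theorem abs_annulus_le (n : ℕ) (x : Space d) : |annulus n x| ≤ 1 := by
  have h1 := (cutoff d).nonneg (x := (1 / ((n : ℝ) + 1)) • x)
  have h2 := (cutoff d).le_one (x := (1 / ((n : ℝ) + 1)) • x)
  have h3 := (cutoff d).nonneg (x := ((n : ℝ) + 1) • x)
  have h4 := (cutoff d).le_one (x := ((n : ℝ) + 1) • x)
  rw [annulus, abs_le]
  constructor <;> linarith

theorem annulus_eq_zero_of_norm_le (n : ℕ) {x : Space d} (hx : ((n : ℝ) + 1) * ‖x‖ ≤ 1) :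
    annulus n x = 0 := by
  have hn : (1 : ℝ) ≤ (n : ℝ) + 1 := by have := Nat.cast_nonneg (α := ℝ) n; linarith
  have h1 : ((n : ℝ) + 1) • x ∈ Metric.closedBall (0 : Space d) (cutoff d).rIn := by
    rw [mem_closedBall_zero_iff, norm_smul, Real.norm_of_nonneg (by positivity)]
    exact hx
  have h2 : (1 / ((n : ℝ) + 1)) • x ∈ Metric.closedBall (0 : Space d) (cutoff d).rIn := by
    rw [mem_closedBall_zero_iff, norm_smul, Real.norm_of_nonneg (by positivity)]
    refine le_trans ?_ hx
    gcongr
    exact ((div_le_one (by positivity)).2 hn).trans hn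
  rw [annulus, (cutoff d).one_of_mem_closedBall h1, (cutoff d).one_of_mem_closedBall h2, sub_self]

theorem annulus_eq_zero_of_le_norm (n : ℕ) {x : Space d} (hx : 2 * ((n : ℝ) + 1) ≤ ‖x‖) :
    annulus n x = 0 := by
  have hn : (1 : ℝ) ≤ (n : ℝ) + 1 := by have := Nat.cast_nonneg (α := ℝ) n; linarith
  have h1 : (cutoff d).rOut ≤ dist (((n : ℝ) + 1) • x) 0 := by
    rw [dist_zero_right, norm_smul, Real.norm_of_nonneg (by positivity)]
    change 2 ≤ _
    nlinarith
  have h2 : (cutoff d).rOut ≤ dist ((1 / ((n : ℝ) + 1)) • x) 0 := by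
    rw [dist_zero_right, norm_smul, Real.norm_of_nonneg (by positivity), one_div,
      ← div_eq_inv_mul, le_div_iff₀ (by positivity)]
    exact hx
  rw [annulus, (cutoff d).zero_of_le_dist h1, (cutoff d).zero_of_le_dist h2, sub_self]

theorem annulus_eq_one (n : ℕ) {x : Space d} (h1 : 2 ≤ ((n : ℝ) + 1) * ‖x‖)
    (h2 : ‖x‖ ≤ (n : ℝ) + 1) : annulus n x = 1 := by
  have h3 : (1 / ((n : ℝ) + 1)) • x ∈ Metric.closedBall (0 : Space d) (cutoff d).rIn := by
    rw [mem_closedBall_zero_iff, norm_smul, Real.norm_of_nonneg (by positivity), one_div,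
      inv_mul_le_iff₀ (by positivity)]
    change ‖x‖ ≤ ((n : ℝ) + 1) * 1
    linarith
  have h4 : (cutoff d).rOut ≤ dist (((n : ℝ) + 1) • x) 0 := by
    rw [dist_zero_right, norm_smul, Real.norm_of_nonneg (by positivity)]
    exact h1
  rw [annulus, (cutoff d).one_of_mem_closedBall h3, (cutoff d).zero_of_le_dist h4, sub_zero]

theorem annulus_eventuallyEq_one (n : ℕ) {x : Space d} (h1 : 2 < ((n : ℝ) + 1) * ‖x‖)
    (h2 : ‖x‖ < (n : ℝ) + 1) : annulus n =ᶠ[𝓝 x] fun _ => 1 := by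
  have c : Continuous fun y : Space d => ‖y‖ := continuous_norm
  filter_upwards [(continuous_const.mul c).continuousAt.eventually (lt_mem_nhds h1),
    c.continuousAt.eventually (gt_mem_nhds h2)] with y hy1 hy2
  exact annulus_eq_one n hy1.le hy2.le

theorem eventually_annulus {x : Space d} (hx : x ≠ 0) :
    ∀ᶠ n : ℕ in atTop, annulus n x = 1 ∧ ∀ j, pderiv j (annulus n) x = 0 := by
  have hx0 : 0 < ‖x‖ := norm_pos_iff.2 hx
  have t : Tendsto (fun n : ℕ => (n : ℝ) + 1) atTop atTop :=
    tendsto_atTop_add_const_right _ _ tendsto_natCast_atTop_atTop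
  filter_upwards [t.eventually (eventually_gt_atTop ‖x‖),
    t.eventually (eventually_gt_atTop (2 / ‖x‖))] with n h1 h2
  have h := annulus_eventuallyEq_one n ((div_lt_iff₀ hx0).1 h2) h1
  refine ⟨h.eq_of_nhds, fun j => ?_⟩
  rw [pderiv, h.fderiv_eq]
  simp

/-- Vanishing near the origin makes the cutoff admissible as a weight in
`MagSobolev.integral_commutator`. The constant may depend on `n`, since it enters only
qualitatively. -/
theorem abs_annulus_le_mul_norm (n : ℕ) (x : Space d) : |annulus n x| ≤ ((n : ℝ) + 1) * ‖x‖ := by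
  rcases le_total (((n : ℝ) + 1) * ‖x‖) 1 with h | h
  · rw [annulus_eq_zero_of_norm_le n h, abs_zero]
    positivity
  · exact (abs_annulus_le n x).trans h

theorem tsupport_annulus_subset (n : ℕ) :
    tsupport (annulus n : Space d → ℝ)
      ⊆ {x | 1 ≤ ((n : ℝ) + 1) * ‖x‖ ∧ ‖x‖ ≤ 2 * ((n : ℝ) + 1)} := by
  refine closure_minimal (fun x hx => ?_) ?_
  · rw [Function.mem_support] at hx
    constructor
    · by_contra h
      exact hx (annulus_eq_zero_of_norm_le n (not_le.1 h).le)
    · by_contra h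
      exact hx (annulus_eq_zero_of_le_norm n (not_le.1 h).le)
  · exact (isClosed_le continuous_const (continuous_const.mul continuous_norm)).inter
      (isClosed_le continuous_norm continuous_const)

theorem abs_fderiv_single_le (w : Space d → ℝ) (x : Space d) (j : Fin d) :
    |fderiv ℝ w x (EuclideanSpace.single j 1)| ≤ ‖fderiv ℝ w x‖ := by
  simpa using (fderiv ℝ w x).le_opNorm (EuclideanSpace.single j 1)

/-- Both parts of the annular cutoff are dilates of one function, and `|x| |∇·|` is dilation
invariant, so `C` is independent of `n`. Gradient terms are thus dominated by quantities with a
weight `1/|x|`. -/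
theorem exists_abs_pderiv_annulus_le (d : ℕ) : ∃ C, 0 ≤ C ∧
    ∀ (n : ℕ) (j : Fin d) (x : Space d), ‖x‖ * |pderiv j (annulus n) x| ≤ C := by
  obtain ⟨C, hC0, hC⟩ := exists_norm_fderiv_cutoff_le d
  refine ⟨C + C, add_nonneg hC0 hC0, fun n j x => ?_⟩
  have key : ∀ c : ℝ, 0 < c → ‖x‖ * |c * fderiv ℝ (cutoff d) (c • x) (EuclideanSpace.single j 1)|
      ≤ C := by
    intro c hc
    have h1 : |fderiv ℝ (cutoff d) (c • x) (EuclideanSpace.single j 1)|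
        ≤ ‖fderiv ℝ (cutoff d) (c • x)‖ := abs_fderiv_single_le _ _ _
    have h2 := (hC (c • x)).2
    rw [norm_smul, Real.norm_of_nonneg hc.le] at h2
    rw [abs_mul, abs_of_pos hc]
    calc _ = c * ‖x‖ * |fderiv ℝ (cutoff d) (c • x) (EuclideanSpace.single j 1)| := by ring
      _ ≤ c * ‖x‖ * ‖fderiv ℝ (cutoff d) (c • x)‖ := by gcongr
      _ ≤ C := h2
  have e : pderiv j (annulus n) x
      = 1 / ((n : ℝ) + 1) * fderiv ℝ (cutoff d) ((1 / ((n : ℝ) + 1)) • x) (EuclideanSpace.single j 1)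
      - ((n : ℝ) + 1) * fderiv ℝ (cutoff d) (((n : ℝ) + 1) • x) (EuclideanSpace.single j 1) := by
    have hs : (annulus n : Space d → ℝ) = fun x => cutoff d ((1 / ((n : ℝ) + 1)) • x)
        - cutoff d (((n : ℝ) + 1) • x) := rfl
    rw [pderiv, hs, fderiv_fun_sub ((contDiff_cutoff _).differentiable (by simp) x)
      ((contDiff_cutoff _).differentiable (by simp) x), fderiv_cutoff_smul, fderiv_cutoff_smul]
    simp
  rw [e]
  refine (mul_le_mul_of_nonneg_left (abs_sub _ _) (norm_nonneg x)).trans ?_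
  rw [mul_add]
  exact add_le_add (key _ (by positivity)) (key _ (by positivity))

theorem exists_abs_le_of_hasCompactSupport {w : Space d → ℝ} (hw : ContDiff ℝ ∞ w)
    (hs : HasCompactSupport w) :
    ∃ C, (∀ x, |w x| ≤ C) ∧ ∀ j x, |pderiv j w x| ≤ C := by
  obtain ⟨C, hC⟩ := hs.exists_bound_of_continuous hw.continuous
  obtain ⟨C', hC'⟩ := (hs.fderiv ℝ).exists_bound_of_continuous (hw.continuous_fderiv (by simp))
  refine ⟨max C C', fun x => (hC x).trans (le_max_left _ _), fun j x => ?_⟩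
  exact (abs_fderiv_single_le w x j).trans ((hC' x).trans (le_max_right _ _))

end Annulus

/-! ### Comparison of the Dirac energy with the magnetic energy -/

section DiracEnergy

variable {d : ℕ} {A : Space d → Space d} {u v f : Space d → Spinor d}
  {Du Dv D : Fin d → Space d → Spinor d}

theorem HardyBound.l2norm_le {b : Space d → ℝ} {ε : ℝ} (hε : 0 ≤ ε) (hb : HardyBound A b ε)
    (h : MagSobolev A f D) :
    l2norm volume (fun x => (‖x‖ * b x) • f x) ≤ ε * energy D := by
  refine l2norm_le_of_sq_le (mul_nonneg hε (energy_nonneg D)) ?_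
  have i1 := integrable_norm_sq (hb.memLp h)
  have i2 : Integrable fun x => ∑ j, ‖D j x‖ ^ 2 :=
    integrable_finsetSum _ fun j _ => integrable_norm_sq (h.memLp_deriv j)
  have e1 := ofReal_integral_eq_lintegral_ofReal i1 (Eventually.of_forall fun x => by positivity)
  have e2 := ofReal_integral_eq_lintegral_ofReal i2 (Eventually.of_forall fun x =>
    Finset.sum_nonneg fun j _ => by positivity)
  have e3 : ∀ s : Spinor d, ENNReal.ofReal (‖s‖ ^ 2) = ‖s‖ₑ ^ 2 := fun s => by
    rw [← ofReal_norm, ← ENNReal.ofReal_pow (norm_nonneg _)]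
  have e4 : ∀ x, ENNReal.ofReal (∑ j, ‖D j x‖ ^ 2) = ∑ j, ‖D j x‖ₑ ^ 2 := fun x => by
    rw [ENNReal.ofReal_sum_of_nonneg fun j _ => by positivity]
    simp only [e3]
  simp only [e3] at e1
  simp only [e4] at e2
  have := hb.bound f D h
  rw [← e1, ← e2, ← ENNReal.ofReal_mul (sq_nonneg _)] at this
  rw [mul_pow, energy_sq]
  exact (ENNReal.ofReal_le_ofReal_iff (mul_nonneg (sq_nonneg _) (integral_nonneg fun x =>
    Finset.sum_nonneg fun j _ => by positivity))).1 this

/-- Interchange of two magnetic derivatives, without a weight. -/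
theorem MagSobolev.integral_commutator_one (hd : 3 ≤ d) (hA : ∀ j, IsMultiplier fun x => A x j)
    (hAl : MemL2loc A) {B : Space d → Matrix (Fin d) (Fin d) ℝ} (hAB : IsMagneticField A B)
    (hB : ∀ j k, MemL2loc fun x => B x j k) {b : Space d → ℝ} {ε : ℝ} (hb : HardyBound A b ε)
    (hBb : ∀ x j k, |B x j k| ≤ b x) (hu : MagSobolev A u Du) (hv : MagSobolev A v Dv)
    (j k : Fin d) :
    Integrable (fun x => inner ℂ (Du j x) (Dv k x) - inner ℂ (Du k x) (Dv j x)
      - Complex.I * ((B x j k : ℂ) * inner ℂ (u x) (v x))) ∧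
    ∫ x, (inner ℂ (Du j x) (Dv k x) - inner ℂ (Du k x) (Dv j x)
      - Complex.I * ((B x j k : ℂ) * inner ℂ (u x) (v x))) = 0 := by
  obtain ⟨C, hC0, hC⟩ := exists_abs_pderiv_annulus_le d
  choose C' hC' using fun n : ℕ => exists_abs_le_of_hasCompactSupport
    (contDiff_annulus (d := d) n) (hasCompactSupport_annulus n)
  have hloc := fun n : ℕ => MagSobolev.integral_commutator hA hAl hAB hB hb hBb hu hv
    (contDiff_annulus n) (hC' n).1 (hC' n).2 (abs_annulus_le_mul_norm n) j k
  have hNu := (hu.hardy hA hd).1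
  have hNv := (hv.hardy hA hd).1
  have hbu := hb.memLp hu
  -- A majorant independent of `n`: a derivative of the cutoff costs `C/|x|`, absorbed in `divNorm
  -- u`, and the field term is split as `|x| |B| |u| · |v|/|x|`.
  let bound : Space d → ℝ := fun x => ‖Du j x‖ * ‖Dv k x‖ + ‖Du k x‖ * ‖Dv j x‖
    + C * (‖divNorm u x‖ * ‖Dv k x‖) + C * (‖divNorm u x‖ * ‖Dv j x‖)
    + ‖(‖x‖ * b x) • u x‖ * ‖divNorm v x‖
  have ibound : Integrable bound :=
    ((((integrable_norm_mul_norm (hu.memLp_deriv j) (hv.memLp_deriv k)).add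
      (integrable_norm_mul_norm (hu.memLp_deriv k) (hv.memLp_deriv j))).add
      ((integrable_norm_mul_norm hNu (hv.memLp_deriv k)).const_mul C)).add
      ((integrable_norm_mul_norm hNu (hv.memLp_deriv j)).const_mul C)).add
      (integrable_norm_mul_norm hbu hNv)
  have hbd : ∀ n : ℕ, ∀ᵐ x, ‖((annulus n x : ℝ) : ℂ) * inner ℂ (Du j x) (Dv k x)
      - (annulus n x : ℂ) * inner ℂ (Du k x) (Dv j x)
      + (pderiv j (annulus n) x : ℂ) * inner ℂ (u x) (Dv k x)
      - (pderiv k (annulus n) x : ℂ) * inner ℂ (u x) (Dv j x)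
      - Complex.I * ((annulus n x * B x j k : ℝ) * inner ℂ (u x) (v x))‖ ≤ bound x := by
    intro n
    filter_upwards [ae_ne_zero hd] with x hx
    have hx0 : 0 < ‖x‖ := norm_pos_iff.2 hx
    have a1 : ∀ s t : Spinor d, ‖((annulus n x : ℝ) : ℂ) * inner ℂ s t‖ ≤ ‖s‖ * ‖t‖ := by
      intro s t
      rw [norm_mul, Complex.norm_real, Real.norm_eq_abs]
      exact (mul_le_of_le_one_left (norm_nonneg _) (abs_annulus_le n x)).trans
        (norm_inner_le_norm _ _)
    have a2 : ∀ (l : Fin d) (t : Spinor d), ‖(pderiv l (annulus n) x : ℂ) * inner ℂ (u x) t‖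
        ≤ C * (‖divNorm u x‖ * ‖t‖) := by
      intro l t
      rw [norm_mul, Complex.norm_real, Real.norm_eq_abs, divNorm, norm_smul, norm_inv, norm_norm]
      have h1 := hC n l x
      rw [← le_div_iff₀' hx0] at h1
      calc _ ≤ C / ‖x‖ * (‖u x‖ * ‖t‖) :=
            mul_le_mul h1 (norm_inner_le_norm _ _) (norm_nonneg _) (by positivity)
        _ = _ := by ring
    have a3 : ‖Complex.I * ((annulus n x * B x j k : ℝ) * inner ℂ (u x) (v x))‖
        ≤ ‖(‖x‖ * b x) • u x‖ * ‖divNorm v x‖ := by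
      have hb0 : 0 ≤ b x := (abs_nonneg _).trans (hBb x j k)
      rw [norm_mul, Complex.norm_I, one_mul, norm_mul, Complex.norm_real, Real.norm_eq_abs, abs_mul,
        divNorm, norm_smul, norm_smul, norm_inv, norm_norm, norm_mul, norm_norm,
        Real.norm_of_nonneg hb0]
      calc _ ≤ 1 * b x * (‖u x‖ * ‖v x‖) :=
            mul_le_mul (mul_le_mul (abs_annulus_le n x) (hBb x j k) (abs_nonneg _) zero_le_one)
              (norm_inner_le_norm _ _) (norm_nonneg _) (by positivity)
        _ = _ := by field_simp
    refine (norm_sub_le _ _).trans (add_le_add ?_ a3)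
    refine (norm_sub_le _ _).trans (add_le_add ?_ (a2 k _))
    refine (norm_add_le _ _).trans (add_le_add ?_ (a2 j _))
    exact (norm_sub_le _ _).trans (add_le_add (a1 _ _) (a1 _ _))
  have hlim : ∀ᵐ x, Tendsto (fun n : ℕ => ((annulus n x : ℝ) : ℂ) * inner ℂ (Du j x) (Dv k x)
      - (annulus n x : ℂ) * inner ℂ (Du k x) (Dv j x)
      + (pderiv j (annulus n) x : ℂ) * inner ℂ (u x) (Dv k x)
      - (pderiv k (annulus n) x : ℂ) * inner ℂ (u x) (Dv j x)
      - Complex.I * ((annulus n x * B x j k : ℝ) * inner ℂ (u x) (v x))) atTop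
      (𝓝 (inner ℂ (Du j x) (Dv k x) - inner ℂ (Du k x) (Dv j x)
      - Complex.I * ((B x j k : ℂ) * inner ℂ (u x) (v x)))) := by
    filter_upwards [ae_ne_zero hd] with x hx
    refine tendsto_const_nhds.congr' ?_
    filter_upwards [eventually_annulus hx] with n hn
    simp [hn.1, hn.2]
  have hmeas := aestronglyMeasurable_of_tendsto_ae atTop (fun n => (hloc n).1.1) hlim
  refine ⟨ibound.mono' hmeas ?_, ?_⟩
  · filter_upwards [hlim, ae_all_iff.2 hbd] with x h1 h2
    exact le_of_tendsto h1.norm (Eventually.of_forall h2)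
  · have t := tendsto_integral_of_dominated_convergence bound (fun n => (hloc n).1.1) ibound hbd hlim
    simp only [(hloc _).2] at t
    exact (tendsto_nhds_unique t tendsto_const_nhds)

/-- The Dirac operator `-i α·D` applied to a gradient. -/
noncomputable def diracField (α : Fin d → SpinMatrix d) (D : Fin d → Space d → Spinor d)
    (x : Space d) : Spinor d := (-Complex.I) • ∑ j, act (α j) (D j x)

theorem MagSobolev.memLp_diracField (α : Fin d → SpinMatrix d) (h : MagSobolev A f D) :
    MemLp (diracField α D) 2 volume :=
  (memLp_finsetSum _ fun j _ => memLp_act (α j) (h.memLp_deriv j)).const_smul (-Complex.I)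

theorem sum_act_eq (α : Fin d → SpinMatrix d) (D : Fin d → Space d → Spinor d) (x : Space d) :
    ∑ j, act (α j) (D j x) = Complex.I • diracField α D x := by
  rw [diracField, smul_smul, mul_neg, Complex.I_mul_I, neg_neg, one_smul]

/-- The spin part `∑ B_{jk} α_k α_j` of the squared magnetic Dirac operator. -/
noncomputable def spinTerm (α : Fin d → SpinMatrix d) (M : Matrix (Fin d) (Fin d) ℝ)
    (s : Spinor d) : Spinor d := ∑ j, ∑ k, (M j k : ℂ) • act (α k) (act (α j) s)

variable {α : Fin d → SpinMatrix d} {β : SpinMatrix d}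

/-- The Lichnerowicz (Pauli) formula in weak form. Moving `α_k α_j` across the inner product turns
the first sum into `‖α·D‖²`; the anticommutation relations turn the second into `2|D|² - ‖α·D‖²`. -/
theorem IsDiracMatrices.sum_commutator (hαβ : IsDiracMatrices d α β)
    (M : Matrix (Fin d) (Fin d) ℝ) (D : Fin d → Space d → Spinor d) (x : Space d) (s t : Spinor d) :
    ∑ j, ∑ k, (inner ℂ (act (α k) (act (α j) (D j x))) (D k x)
      - inner ℂ (act (α k) (act (α j) (D k x))) (D j x)
      - Complex.I * ((M j k : ℂ) * inner ℂ (act (α k) (act (α j) s)) t))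
    = 2 * ((‖diracField α D x‖ ^ 2 : ℝ) : ℂ) - 2 * ((gradLen D x ^ 2 : ℝ) : ℂ)
      - Complex.I * inner ℂ (spinTerm α M s) t := by
  have e0 : ∑ j, ∑ k, inner ℂ (act (α j) (D j x)) (act (α k) (D k x))
      = ((‖diracField α D x‖ ^ 2 : ℝ) : ℂ) := by
    have : ∑ j, ∑ k, inner ℂ (act (α j) (D j x)) (act (α k) (D k x))
        = (inner ℂ (∑ j, act (α j) (D j x)) (∑ k, act (α k) (D k x)) : ℂ) := by
      simp only [sum_inner, inner_sum]
      exact Finset.sum_comm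
    rw [this, inner_self_eq_norm_sq_to_K, sum_act_eq, norm_smul, Complex.norm_I, one_mul]
    norm_cast
  have e1 : ∑ j, ∑ k, inner ℂ (act (α k) (act (α j) (D j x))) (D k x)
      = ((‖diracField α D x‖ ^ 2 : ℝ) : ℂ) := by
    rw [← e0]
    simp only [(hαβ.hermitian_alpha _).inner_act]
  have e2 : ∑ j, ∑ k, inner ℂ (act (α k) (act (α j) (D k x))) (D j x)
      = 2 * ((gradLen D x ^ 2 : ℝ) : ℂ) - ((‖diracField α D x‖ ^ 2 : ℝ) : ℂ) := by
    have p : ∀ j k, (inner ℂ (act (α k) (act (α j) (D k x))) (D j x) : ℂ)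
        = (if k = j then 2 * ((‖D j x‖ ^ 2 : ℝ) : ℂ) else 0)
          - inner ℂ (act (α k) (D k x)) (act (α j) (D j x)) := by
      intro j k
      have a := hαβ.anticomm_act k j (D k x)
      rw [eq_sub_of_add_eq a, inner_sub_left, (hαβ.hermitian_alpha j).inner_act]
      congr 1
      split_ifs with h
      · subst h
        rw [inner_smul_left, inner_self_eq_norm_sq_to_K, map_ofNat]
        simp
      · exact inner_zero_left _
    simp only [p, Finset.sum_sub_distrib, Finset.sum_ite_eq', Finset.mem_univ, if_true]
    rw [Finset.sum_comm, e0, ← Finset.mul_sum, gradLen_sq, Complex.ofReal_sum]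
  have e3 : ∑ j, ∑ k, (Complex.I * ((M j k : ℂ) * inner ℂ (act (α k) (act (α j) s)) t))
      = Complex.I * inner ℂ (spinTerm α M s) t := by
    simp only [spinTerm, sum_inner, inner_smul_left, Complex.conj_ofReal, Finset.mul_sum]
  simp only [Finset.sum_sub_distrib]
  rw [e1, e2, e3]
  ring

/-- The weight is split as `b|f|² = (|x| b|f|) · (|f|/|x|)`: the first factor is bounded by
hypothesis, the second by the Hardy inequality. -/
theorem HardyBound.integral_le {b : Space d → ℝ} {ε : ℝ} (hd : 3 ≤ d)
    (hA : ∀ j, IsMultiplier fun x => A x j) (hε : 0 ≤ ε) (hb : HardyBound A b ε)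
    (hb0 : ∀ x, 0 ≤ b x) (h : MagSobolev A f D) :
    Integrable (fun x => b x * ‖f x‖ ^ 2) ∧
    ∫ x, b x * ‖f x‖ ^ 2 ≤ ε * (2 / ((d : ℝ) - 2)) * energy D ^ 2 := by
  obtain ⟨hN, hN2⟩ := h.hardy hA hd
  have i := integrable_norm_mul_norm (hb.memLp h) hN
  have e : ∀ᵐ x, ‖(‖x‖ * b x) • f x‖ * ‖divNorm f x‖ = b x * ‖f x‖ ^ 2 := by
    filter_upwards [ae_ne_zero hd] with x hx
    have : ‖x‖ ≠ 0 := norm_ne_zero_iff.2 hx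
    rw [divNorm, norm_smul, norm_smul, norm_inv, norm_norm, norm_mul, norm_norm,
      Real.norm_of_nonneg (hb0 x)]
    field_simp
  refine ⟨i.congr e, ?_⟩
  rw [← integral_congr_ae e]
  refine (integral_norm_mul_norm_le (hb.memLp h) hN).trans ?_
  calc _ ≤ ε * energy D * (2 / ((d : ℝ) - 2) * energy D) :=
        mul_le_mul (hb.l2norm_le hε h) hN2 (l2norm_nonneg _) (mul_nonneg hε (energy_nonneg D))
    _ = _ := by ring

/-- Comparison of the energies of the Dirac operator and of the magnetic gradient. -/
theorem MagSobolev.energy_sq_le (hd : 3 ≤ d) (hαβ : IsDiracMatrices d α β)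
    (hA : ∀ j, IsMultiplier fun x => A x j)
    (hAl : MemL2loc A) {B : Space d → Matrix (Fin d) (Fin d) ℝ} (hAB : IsMagneticField A B)
    (hB : ∀ j k, MemL2loc fun x => B x j k) {b : Space d → ℝ} {ε : ℝ} (hε : 0 ≤ ε)
    (hb : HardyBound A b ε) (hBb : ∀ x j k, |B x j k| ≤ b x) {c : ℝ}
    (hc0 : 0 ≤ c) (hc : ∀ᵐ x, ∀ s : Spinor d, ‖spinTerm α (B x) s‖ ≤ 2 * c * b x * ‖s‖)
    (h : MagSobolev A f D) :
    energy D ^ 2 ≤ l2norm volume (diracField α D) ^ 2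
      + c * ε * (2 / ((d : ℝ) - 2)) * energy D ^ 2 := by
  -- The commutator is tested on the pair `α_k α_j f`, `f` and summed over `j` and `k`, which is the
  -- left side of `IsDiracMatrices.sum_commutator`.
  have key := fun j k => MagSobolev.integral_commutator_one hd hA hAl hAB hB hb hBb
    ((h.act (α j)).act (α k)) h j k
  have hb0 : ∀ x, 0 ≤ b x := fun x => (abs_nonneg _).trans (hBb x ⟨0, by omega⟩ ⟨0, by omega⟩)
  have hi := integrable_finsetSum Finset.univ fun j _ =>
    integrable_finsetSum Finset.univ fun k _ => (key j k).1
  have h0 : ∫ x, (2 * ((‖diracField α D x‖ ^ 2 : ℝ) : ℂ) - 2 * ((gradLen D x ^ 2 : ℝ) : ℂ)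
      - Complex.I * inner ℂ (spinTerm α (B x) (f x)) (f x)) = 0 := by
    rw [← integral_congr_ae (Eventually.of_forall fun x => hαβ.sum_commutator (B x) D x (f x) (f x)),
      integral_finsetSum _ fun j _ => integrable_finsetSum Finset.univ fun k _ => (key j k).1]
    refine Finset.sum_eq_zero fun j _ => ?_
    rw [integral_finsetSum _ fun k _ => (key j k).1]
    exact Finset.sum_eq_zero fun k _ => (key j k).2
  have hi2 : Integrable fun x => 2 * ((‖diracField α D x‖ ^ 2 : ℝ) : ℂ)
      - 2 * ((gradLen D x ^ 2 : ℝ) : ℂ) - Complex.I * inner ℂ (spinTerm α (B x) (f x)) (f x) :=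
    hi.congr (Eventually.of_forall fun x => hαβ.sum_commutator (B x) D x (f x) (f x))
  have hre : ∫ x, Complex.reCLM (2 * ((‖diracField α D x‖ ^ 2 : ℝ) : ℂ)
      - 2 * ((gradLen D x ^ 2 : ℝ) : ℂ)
      - Complex.I * inner ℂ (spinTerm α (B x) (f x)) (f x)) = 0 := by
    rw [ContinuousLinearMap.integral_comp_comm _ hi2, h0, map_zero]
  obtain ⟨ib, hbi⟩ := hb.integral_le hd hA hε hb0 h
  have iY := integrable_norm_sq (h.memLp_diracField α)
  have iX := integrable_norm_sq h.memLp_gradLen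
  have hle : ∀ᵐ x, Complex.reCLM (2 * ((‖diracField α D x‖ ^ 2 : ℝ) : ℂ)
      - 2 * ((gradLen D x ^ 2 : ℝ) : ℂ) - Complex.I * inner ℂ (spinTerm α (B x) (f x)) (f x))
      ≤ 2 * ‖diracField α D x‖ ^ 2 - 2 * ‖gradLen D x‖ ^ 2 + 2 * c * (b x * ‖f x‖ ^ 2) := by
    filter_upwards [hc] with x hx
    have h1 : |(Complex.I * inner ℂ (spinTerm α (B x) (f x)) (f x)).re|
        ≤ 2 * c * (b x * ‖f x‖ ^ 2) := by
      refine (Complex.abs_re_le_norm _).trans ?_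
      rw [norm_mul, Complex.norm_I, one_mul]
      refine (norm_inner_le_norm _ _).trans ?_
      calc _ ≤ 2 * c * b x * ‖f x‖ * ‖f x‖ := mul_le_mul_of_nonneg_right (hx _) (norm_nonneg _)
        _ = _ := by ring
    have h2 := (abs_le.1 h1).1
    have e1 : (2 * ((‖diracField α D x‖ ^ 2 : ℝ) : ℂ)).re = 2 * ‖diracField α D x‖ ^ 2 := by
      rw [← Complex.ofReal_ofNat, Complex.re_ofReal_mul, Complex.ofReal_re]
    have e2 : (2 * ((gradLen D x ^ 2 : ℝ) : ℂ)).re = 2 * ‖gradLen D x‖ ^ 2 := by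
      rw [← Complex.ofReal_ofNat, Complex.re_ofReal_mul, Complex.ofReal_re, Real.norm_eq_abs, sq_abs]
    rw [Complex.reCLM_apply, Complex.sub_re, Complex.sub_re, e1, e2]
    linarith
  have iR : Integrable fun x => 2 * ‖diracField α D x‖ ^ 2 - 2 * ‖gradLen D x‖ ^ 2
      + 2 * c * (b x * ‖f x‖ ^ 2) := ((iY.const_mul 2).sub (iX.const_mul 2)).add (ib.const_mul _)
  have h3 := integral_mono_ae (Complex.reCLM.integrable_comp hi2) iR hle
  rw [hre] at h3
  have e4 := integral_add ((iY.const_mul 2).sub (iX.const_mul 2)) (ib.const_mul (2 * c))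
  simp only [Pi.sub_apply] at e4
  rw [e4, integral_sub (iY.const_mul 2) (iX.const_mul 2), integral_const_mul, integral_const_mul,
    integral_const_mul, ← l2norm_sq, ← l2norm_sq] at h3
  have h4 := mul_le_mul_of_nonneg_left hbi hc0
  change 0 ≤ 2 * l2norm volume (diracField α D) ^ 2 - 2 * energy D ^ 2 + _ at h3
  nlinarith

end DiracEnergy

/-! ### The localized virial identity -/

section Virial

variable {d : ℕ} {A : Space d → Space d} {f s : Space d → Spinor d}
  {D E : Fin d → Space d → Spinor d} {α : Fin d → SpinMatrix d} {β : SpinMatrix d}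

theorem IsDiracMatrices.sum_inner_act (hαβ : IsDiracMatrices d α β)
    (D : Fin d → Space d → Spinor d) (x : Space d) (t : Spinor d) :
    ∑ j, inner ℂ (act (α j) t) (D j x) = Complex.I * inner ℂ t (diracField α D x) := by
  simp only [(hαβ.hermitian_alpha _).inner_act]
  rw [← inner_sum, sum_act_eq, inner_smul_right]

theorem inner_diracField (E : Fin d → Space d → Spinor d) (x : Space d) (t : Spinor d) :
    inner ℂ (diracField α E x) t = Complex.I * ∑ j, inner ℂ (act (α j) (E j x)) t := by
  rw [diracField, inner_smul_left, sum_inner]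
  simp

theorem inner_clifford_left (p : Fin d → ℝ) (s t : Spinor d) :
    inner ℂ (clifford α p s) t = ∑ j, (p j : ℂ) * inner ℂ (act (α j) s) t := by
  simp only [clifford, sum_inner, inner_smul_left, Complex.conj_ofReal]

theorem inner_contract_right (D : Fin d → Space d → Spinor d) (w x : Space d) (t : Spinor d) :
    inner ℂ t (contract D w x) = ∑ k, (w k : ℂ) * inner ℂ t (D k x) := by
  simp only [contract, inner_sum, inner_real_smul_right]

/-- Pointwise algebra of the commutator identities with weights `x_k θ`, tested on `α_j s` and `f`.
The sum over `j` assembles Dirac operators and the sum over `k` the radial derivative; the Kronecker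
term comes from `∂_j x_k`, and `p` stands for `∇θ`. -/
theorem IsDiracMatrices.sum_commutator_coord (hαβ : IsDiracMatrices d α β)
    (M : Matrix (Fin d) (Fin d) ℝ) (D E : Fin d → Space d → Spinor d) (x : Space d)
    (s t : Spinor d) (θ : ℝ) (p : Fin d → ℝ) :
    Complex.I * ∑ j, ∑ k, (((x k * θ : ℝ) : ℂ) * inner ℂ (act (α j) (E j x)) (D k x)
      - ((x k * θ : ℝ) : ℂ) * inner ℂ (act (α j) (E k x)) (D j x)
      + ((x k * p j + (if j = k then 1 else 0) * θ : ℝ) : ℂ) * inner ℂ (act (α j) s) (D k x)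
      - ((x k * p k + 1 * θ : ℝ) : ℂ) * inner ℂ (act (α j) s) (D j x)
      - Complex.I * (((x k * θ * M j k : ℝ) : ℂ) * inner ℂ (act (α j) s) t))
    = (θ : ℂ) * inner ℂ (diracField α E x) (contract D x x)
      + (θ : ℂ) * ∑ k, (x k : ℂ) * inner ℂ (E k x) (diracField α D x)
      + Complex.I * inner ℂ (clifford α p s) (contract D x x)
      - (θ : ℂ) * inner ℂ s (diracField α D x)
      + ((∑ k, x k * p k + d * θ : ℝ) : ℂ) * inner ℂ s (diracField α D x)
      + (θ : ℂ) * inner ℂ (clifford α (fun j => ∑ k, M j k * x k) s) t := by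
  have s1 : ∑ j, ∑ k, ((x k * θ : ℝ) : ℂ) * inner ℂ (act (α j) (E j x)) (D k x)
      = (θ : ℂ) * ∑ j, inner ℂ (act (α j) (E j x)) (contract D x x) := by
    rw [Finset.mul_sum]
    refine Finset.sum_congr rfl fun j _ => ?_
    rw [inner_contract_right, Finset.mul_sum]
    refine Finset.sum_congr rfl fun k _ => ?_
    push_cast; ring
  have s2 : ∑ j, ∑ k, ((x k * θ : ℝ) : ℂ) * inner ℂ (act (α j) (E k x)) (D j x)
      = Complex.I * ((θ : ℂ) * ∑ k, (x k : ℂ) * inner ℂ (E k x) (diracField α D x)) := by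
    rw [Finset.sum_comm, Finset.mul_sum, Finset.mul_sum]
    refine Finset.sum_congr rfl fun k _ => ?_
    rw [← Finset.mul_sum, hαβ.sum_inner_act]
    push_cast; ring
  have s3 : ∑ j, ∑ k, ((x k * p j + (if j = k then 1 else 0) * θ : ℝ) : ℂ)
        * inner ℂ (act (α j) s) (D k x)
      = inner ℂ (clifford α p s) (contract D x x)
        + (θ : ℂ) * (Complex.I * inner ℂ s (diracField α D x)) := by
    rw [inner_clifford_left, ← hαβ.sum_inner_act, Finset.mul_sum, ← Finset.sum_add_distrib]
    refine Finset.sum_congr rfl fun j _ => ?_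
    rw [inner_contract_right, Finset.mul_sum]
    have : ∀ k, ((x k * p j + (if j = k then 1 else 0) * θ : ℝ) : ℂ) * inner ℂ (act (α j) s) (D k x)
        = (p j : ℂ) * ((x k : ℂ) * inner ℂ (act (α j) s) (D k x))
          + if j = k then (θ : ℂ) * inner ℂ (act (α j) s) (D k x) else 0 := by
      intro k
      split_ifs <;> push_cast <;> ring
    simp only [this, Finset.sum_add_distrib, Finset.sum_ite_eq, Finset.mem_univ, if_true]
  have s4 : ∑ j, ∑ k, ((x k * p k + 1 * θ : ℝ) : ℂ)
        * inner ℂ (act (α j) s) (D j x)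
      = ((∑ k, x k * p k + d * θ : ℝ) : ℂ) * (Complex.I * inner ℂ s (diracField α D x)) := by
    rw [← hαβ.sum_inner_act, Finset.mul_sum]
    refine Finset.sum_congr rfl fun j _ => ?_
    rw [← Finset.sum_mul]
    congr 1
    rw [← Complex.ofReal_sum]
    congr 1
    simp [Finset.sum_add_distrib]
  have s5 : ∑ j, ∑ k, Complex.I * (((x k * θ * M j k : ℝ) : ℂ) * inner ℂ (act (α j) s) t)
      = Complex.I * ((θ : ℂ) * inner ℂ (clifford α (fun j => ∑ k, M j k * x k) s) t) := by
    rw [inner_clifford_left, Finset.mul_sum, Finset.mul_sum]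
    refine Finset.sum_congr rfl fun j _ => ?_
    rw [Complex.ofReal_sum, Finset.sum_mul, Finset.mul_sum, Finset.mul_sum]
    refine Finset.sum_congr rfl fun k _ => ?_
    push_cast; ring
  simp only [Finset.sum_sub_distrib, Finset.sum_add_distrib]
  rw [s1, s2, s3, s4, s5, inner_diracField]
  linear_combination (-(θ : ℂ) * ∑ k, (x k : ℂ) * inner ℂ (E k x) (diracField α D x)
    + (θ : ℂ) * inner ℂ s (diracField α D x)
    - ((∑ k, x k * p k + d * θ : ℝ) : ℂ) * inner ℂ s (diracField α D x)
    - (θ : ℂ) * inner ℂ (clifford α (fun j => ∑ k, M j k * x k) s) t) * Complex.I_mul_I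

/-- The integrand of the localized virial identity. -/
noncomputable def virialIntegrand (α : Fin d → SpinMatrix d)
    (B : Space d → Matrix (Fin d) (Fin d) ℝ) (θ : Space d → ℝ) (f : Space d → Spinor d)
    (D E : Fin d → Space d → Spinor d) (x : Space d) : ℝ :=
  2 * θ x * (inner ℂ (diracField α E x) (dilation f D x)).re
    + ((∑ k, x k * pderiv k θ x) - 2 * θ x) * ‖diracField α D x‖ ^ 2
    + 2 * θ x * (inner ℂ (clifford α (fun j => ∑ k, B x j k * x k) (diracField α D x)) (f x)).re
    + 2 * (Complex.I * inner ℂ (clifford α (fun j => pderiv j θ x) (diracField α D x))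
        (dilation f D x)).re

theorem inner_dilation_right (f : Space d → Spinor d) (D : Fin d → Space d → Spinor d)
    (x : Space d) (t : Spinor d) :
    inner ℂ t (dilation f D x) = inner ℂ t (contract D x x) + (d : ℂ) / 2 * inner ℂ t (f x) := by
  rw [dilation, inner_add_right, inner_real_smul_right]
  push_cast
  rfl

theorem exists_bounds_coord_mul {θ : Space d → ℝ} (hθ : ContDiff ℝ ∞ θ)
    (hs : HasCompactSupport θ) : ∃ C, (∀ k x, |x k * θ x| ≤ C) ∧
      (∀ k j x, |pderiv j (fun x : Space d => x k * θ x) x| ≤ C) ∧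
      ∀ (k : Fin d) x, |x k * θ x| ≤ C * ‖x‖ := by
  choose C hC using fun k : Fin d => exists_abs_le_of_hasCompactSupport
    ((contDiff_coord k).mul hθ) (hs.mul_left (f := fun x : Space d => x k))
  obtain ⟨C', hC', -⟩ := exists_abs_le_of_hasCompactSupport hθ hs
  have hle : ∀ k, C k ≤ (∑ k, |C k|) + |C'| := fun k => by
    have h1 := Finset.single_le_sum (f := fun k => |C k|) (fun i _ => abs_nonneg _)
      (Finset.mem_univ k)
    have h2 := le_abs_self (C k)
    have h3 := abs_nonneg C'

    linarith
  refine ⟨(∑ k, |C k|) + |C'|, fun k x => ((hC k).1 x).trans (hle k),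
    fun k j x => ((hC k).2 j x).trans (hle k), fun k x => ?_⟩
  rw [abs_mul, mul_comm]
  refine mul_le_mul ?_ (abs_coord_le x k) (abs_nonneg _) ?_
  · have h0 : 0 ≤ ∑ k, |C k| := Finset.sum_nonneg fun i _ => abs_nonneg _
    exact (hC' x).trans ((le_abs_self C').trans (le_add_of_nonneg_left h0))
  · exact add_nonneg (Finset.sum_nonneg fun i _ => abs_nonneg _) (abs_nonneg _)

theorem pderiv_eq_zero_of_notMem_tsupport {θ : Space d → ℝ} {x : Space d} (hx : x ∉ tsupport θ)
    (j : Fin d) : pderiv j θ x = 0 := by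
  rw [pderiv, fderiv_of_notMem_tsupport ℝ hx]
  rfl

theorem re_inner_comm (u v : Spinor d) : (inner ℂ u v : ℂ).re = (inner ℂ v u : ℂ).re := by
  rw [← inner_conj_symm, Complex.conj_re]

theorem inner_self_re_eq (u : Spinor d) : (inner ℂ u u : ℂ).re = ‖u‖ ^ 2 := by
  rw [inner_self_eq_norm_sq_to_K]
  norm_cast

/-- The localized virial identity for a field `s` in `H¹` that agrees with the Dirac operator
applied to `f` on the support of the weight. -/
theorem integral_virialIntegrand (hαβ : IsDiracMatrices d α β)
    (hA : ∀ j, IsMultiplier fun x => A x j) (hAl : MemL2loc A)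
    {B : Space d → Matrix (Fin d) (Fin d) ℝ} (hAB : IsMagneticField A B)
    (hB : ∀ j k, MemL2loc fun x => B x j k) {b : Space d → ℝ} {ε : ℝ} (hb : HardyBound A b ε)
    (hBb : ∀ x j k, |B x j k| ≤ b x) (h : MagSobolev A f D) (hs : MagSobolev A s E)
    {θ : Space d → ℝ} (hθ : ContDiff ℝ ∞ θ) (hθs : HasCompactSupport θ)
    (heq : ∀ᵐ x, x ∈ tsupport θ → s x = diracField α D x) :
    Integrable (virialIntegrand α B θ f D E) ∧ ∫ x, virialIntegrand α B θ f D E x = 0 := by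
  obtain ⟨C, hC1, hC2, hC3⟩ := exists_bounds_coord_mul hθ hθs
  obtain ⟨C', hC'1, hC'2⟩ := exists_abs_le_of_hasCompactSupport hθ hθs
  have hw : ∀ k, ContDiff ℝ ∞ (fun x : Space d => x k * θ x) := fun k => (contDiff_coord k).mul hθ
  have hpd : ∀ k j x, pderiv j (fun x : Space d => x k * θ x) x
      = x k * pderiv j θ x + (if j = k then 1 else 0) * θ x := fun k j x => by
    rw [pderiv_mul (contDiff_coord k) hθ, pderiv_coord]
  -- The identity is the real part of `2 kA - kB + d · kC`, summed over indices, with a factor `i`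
  -- on `kA` and `kC`. `kA` commutes the Dirac operator with `x·∇_A`; `kB` removes the terms `⟨E_k,
  -- s⟩`; `kC` supplies the summand `(d/2) f` of the dilation generator and cancels the remaining
  -- multiple `d θ|η|²`.
  have kA := fun j k => (hs.act (α j)).integral_commutator hA hAl hAB hB hb hBb h (hw k)
    (hC1 k) (hC2 k) (hC3 k) j k
  have kB := fun k => hs.integral_by_parts hA hs (hw k) (hC1 k) (hC2 k) k
  have kC := fun j => (hs.act (α j)).integral_by_parts hA h hθ hC'1 hC'2 j
  simp only [hpd, if_true] at kA kB
  have iA := (integrable_finsetSum Finset.univ fun j _ =>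
    integrable_finsetSum Finset.univ fun k _ => (kA j k).1).const_mul Complex.I
  have iB := integrable_finsetSum Finset.univ fun k _ => (kB k).1
  have iC := (integrable_finsetSum Finset.univ fun j _ => (kC j).1).const_mul Complex.I
  have zA := integral_const_mul (μ := (volume : Measure (Space d))) Complex.I fun x => ∑ j, ∑ k,
    (((x k * θ x : ℝ) : ℂ) * inner ℂ (act (α j) (E j x)) (D k x)
      - ((x k * θ x : ℝ) : ℂ) * inner ℂ (act (α j) (E k x)) (D j x)
      + ((x k * pderiv j θ x + (if j = k then 1 else 0) * θ x : ℝ) : ℂ)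
        * inner ℂ (act (α j) (s x)) (D k x)
      - ((x k * pderiv k θ x + 1 * θ x : ℝ) : ℂ)
        * inner ℂ (act (α j) (s x)) (D j x)
      - Complex.I * (((x k * θ x * B x j k : ℝ) : ℂ) * inner ℂ (act (α j) (s x)) (f x)))
  rw [integral_finsetSum _ fun j _ => integrable_finsetSum Finset.univ fun k _ => (kA j k).1,
    Finset.sum_eq_zero fun j _ => by
      rw [integral_finsetSum _ fun k _ => (kA j k).1]
      exact Finset.sum_eq_zero fun k _ => (kA j k).2, mul_zero] at zA
  have zB := integral_finsetSum Finset.univ fun k _ => (kB k).1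
  rw [Finset.sum_eq_zero fun k _ => (kB k).2] at zB
  have zC := integral_const_mul (μ := (volume : Measure (Space d))) Complex.I fun x => ∑ j,
    ((θ x : ℂ) * inner ℂ (act (α j) (E j x)) (f x) + (θ x : ℂ) * inner ℂ (act (α j) (s x)) (D j x)
      + (pderiv j θ x : ℂ) * inner ℂ (act (α j) (s x)) (f x))
  rw [integral_finsetSum _ fun j _ => (kC j).1, Finset.sum_eq_zero fun j _ => (kC j).2,
    mul_zero] at zC
  have iT := ((iA.const_mul 2).sub iB).add (iC.const_mul (d : ℂ))
  have zT := integral_add ((iA.const_mul 2).sub iB) (iC.const_mul (d : ℂ))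
  have zT2 := integral_sub (iA.const_mul 2) iB
  simp only [Pi.sub_apply] at zT zT2
  rw [zT2, integral_const_mul (2 : ℂ), integral_const_mul (d : ℂ), zA, zB, zC] at zT
  simp only [mul_zero, sub_zero, add_zero] at zT
  have hpt : ∀ᵐ x, virialIntegrand α B θ f D E x = Complex.reCLM
      (2 * (Complex.I * ∑ j, ∑ k, (((x k * θ x : ℝ) : ℂ) * inner ℂ (act (α j) (E j x)) (D k x)
      - ((x k * θ x : ℝ) : ℂ) * inner ℂ (act (α j) (E k x)) (D j x)
      + ((x k * pderiv j θ x + (if j = k then 1 else 0) * θ x : ℝ) : ℂ)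
        * inner ℂ (act (α j) (s x)) (D k x)
      - ((x k * pderiv k θ x + 1 * θ x : ℝ) : ℂ)
        * inner ℂ (act (α j) (s x)) (D j x)
      - Complex.I * (((x k * θ x * B x j k : ℝ) : ℂ) * inner ℂ (act (α j) (s x)) (f x))))
      - ∑ k, (((x k * θ x : ℝ) : ℂ) * inner ℂ (E k x) (s x)
        + ((x k * θ x : ℝ) : ℂ) * inner ℂ (s x) (E k x)
        + ((x k * pderiv k θ x + 1 * θ x : ℝ) : ℂ) * inner ℂ (s x) (s x))
      + (d : ℂ) * (Complex.I * ∑ j,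
        ((θ x : ℂ) * inner ℂ (act (α j) (E j x)) (f x)
        + (θ x : ℂ) * inner ℂ (act (α j) (s x)) (D j x)
        + (pderiv j θ x : ℂ) * inner ℂ (act (α j) (s x)) (f x)))) := by
    filter_upwards [heq] with x hx
    -- Outside the support of `θ` both sides vanish, so nothing is required of `s` there.
    by_cases hxs : x ∈ tsupport θ
    · have hsx := hx hxs
      have eC : Complex.I * ∑ j, ((θ x : ℂ) * inner ℂ (act (α j) (E j x)) (f x)
          + (θ x : ℂ) * inner ℂ (act (α j) (s x)) (D j x)
          + (pderiv j θ x : ℂ) * inner ℂ (act (α j) (s x)) (f x))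
          = (θ x : ℂ) * inner ℂ (diracField α E x) (f x)
            - (θ x : ℂ) * inner ℂ (s x) (diracField α D x)
            + Complex.I * inner ℂ (clifford α (fun j => pderiv j θ x) (s x)) (f x) := by
        rw [Finset.sum_add_distrib, Finset.sum_add_distrib, ← Finset.mul_sum, ← Finset.mul_sum,
          hαβ.sum_inner_act, inner_diracField, inner_clifford_left]
        linear_combination ((θ x : ℂ) * inner ℂ (s x) (diracField α D x)) * Complex.I_mul_I
      have eB : (∑ k, (((x k * θ x : ℝ) : ℂ) * inner ℂ (E k x) (s x)
          + ((x k * θ x : ℝ) : ℂ) * inner ℂ (s x) (E k x)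
          + ((x k * pderiv k θ x + 1 * θ x : ℝ) : ℂ)
            * inner ℂ (s x) (s x))).re
          = 2 * θ x * (∑ k, (x k : ℂ) * inner ℂ (E k x) (s x)).re
            + (∑ k, x k * pderiv k θ x + d * θ x) * ‖s x‖ ^ 2 := by
        have e2 : ∑ k : Fin d, (x k * pderiv k θ x + 1 * θ x)
            = ∑ k, x k * pderiv k θ x + d * θ x := by
          simp [Finset.sum_add_distrib]
        simp only [Complex.re_sum, Complex.add_re, Complex.re_ofReal_mul,
          re_inner_comm (s x) (E _ x), Finset.sum_add_distrib, ← Finset.sum_mul]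
        rw [← Finset.sum_add_distrib, ← Complex.ofReal_sum, Complex.re_ofReal_mul,
          inner_self_re_eq, e2, Finset.mul_sum]
        congr 1
        refine Finset.sum_congr rfl fun k _ => ?_
        ring
      rw [hαβ.sum_commutator_coord (B x) D E x (s x) (f x) (θ x) (fun j => pderiv j θ x), eC,
        Complex.reCLM_apply, Complex.add_re, Complex.sub_re, eB, hsx, virialIntegrand,
        inner_dilation_right, inner_dilation_right]
      have c2 : ∀ z : ℂ, (2 * z).re = 2 * z.re := fun z => by simp
      have cd : ∀ z : ℂ, ((d : ℂ) * z).re = d * z.re := fun z => by simp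
      have cd2 : ∀ z : ℂ, ((d : ℂ) / 2 * z).re = d / 2 * z.re := fun z => by
        rw [show (d : ℂ) / 2 = ((d / 2 : ℝ) : ℂ) by push_cast; rfl, Complex.re_ofReal_mul]
      have cI : ∀ z w : ℂ, (Complex.I * (z + (d : ℂ) / 2 * w)).re
          = (Complex.I * z).re + d / 2 * (Complex.I * w).re := fun z w => by
        rw [mul_add, Complex.add_re, mul_left_comm, cd2]
      simp only [c2, cd, cd2, cI, Complex.add_re, Complex.sub_re, Complex.re_ofReal_mul,
        inner_self_re_eq]
      ring
    · have h0 : θ x = 0 := image_eq_zero_of_notMem_tsupport hxs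
      have h1 : ∀ j, pderiv j θ x = 0 := pderiv_eq_zero_of_notMem_tsupport hxs
      simp [virialIntegrand, h0, h1, clifford]
  refine ⟨(Complex.reCLM.integrable_comp iT).congr ?_, ?_⟩
  · filter_upwards [hpt] with x hx using hx.symm
  · rw [integral_congr_ae hpt]
    have := ContinuousLinearMap.integral_comp_comm Complex.reCLM iT
    simp only [Pi.sub_apply, Pi.add_apply] at this
    rw [this, zT, map_zero]

end Virial

/-! ### The squared eigenvalue equation -/

section Remainder

variable {d : ℕ} {α : Fin d → SpinMatrix d} {β : SpinMatrix d}

theorem clifford_smul (α : Fin d → SpinMatrix d) (p : Fin d → ℝ) (c : ℂ) (u : Spinor d) :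
    clifford α p (c • u) = c • clifford α p u := by
  simp only [clifford, act_smul, Finset.smul_sum]
  exact Finset.sum_congr rfl fun j _ => smul_comm _ _ _

theorem clifford_sub (α : Fin d → SpinMatrix d) (p : Fin d → ℝ) (u v : Spinor d) :
    clifford α p (u - v) = clifford α p u - clifford α p v := by
  simp only [clifford, act_sub, smul_sub, Finset.sum_sub_distrib]

theorem IsDiracMatrices.act_beta_clifford (h : IsDiracMatrices d α β) (p : Fin d → ℝ)
    (u : Spinor d) : act β (clifford α p u) = -clifford α p (act β u) := by
  simp only [clifford, act_sum, act_smul, h.act_beta_alpha, smul_neg, Finset.sum_neg_distrib]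

/-- Moving `α_k` past `α·p` costs the anticommutator `2p_k`, and summation over `k` turns it into `2
p·D`. -/
theorem IsDiracMatrices.sum_alpha_clifford (h : IsDiracMatrices d α β) (p : Space d)
    (D : Fin d → Space d → Spinor d) (x : Space d) :
    ∑ k, ∑ j, (p j : ℂ) • act (α k) (act (α j) (D k x))
      = (2 : ℂ) • contract D p x - clifford α p (∑ k, act (α k) (D k x)) := by
  have e : ∀ k j, (p j : ℂ) • act (α k) (act (α j) (D k x))
      = (if k = j then (2 : ℂ) • p j • D k x else 0) - (p j : ℂ) • act (α j) (act (α k) (D k x)) := by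
    intro k j
    rw [eq_sub_of_add_eq (h.anticomm_act k j (D k x)), smul_sub]
    congr 1
    split_ifs
    · rw [smul_comm]; rfl
    · exact smul_zero _
  simp only [e, Finset.sum_sub_distrib, Finset.sum_ite_eq, Finset.mem_univ, if_true]
  rw [← Finset.smul_sum, Finset.sum_comm]
  simp only [contract, clifford, act_sum, Finset.smul_sum]

/-- Only the symmetric part of `α_k α_j` survives. With `H` the Hessian of the potential this leaves
the Laplacian. -/
theorem IsDiracMatrices.sum_symm_act (h : IsDiracMatrices d α β) {H : Fin d → Fin d → ℝ}
    (hH : ∀ j k, H j k = H k j) (u : Spinor d) :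
    ∑ k, ∑ j, (H k j : ℂ) • act (α k) (act (α j) u) = ((∑ j, H j j : ℝ) : ℂ) • u := by
  have e' : ∑ k, ∑ j, (H k j : ℂ) • act (α k) (act (α j) u)
      = ∑ k, ∑ j, (H k j : ℂ) • act (α j) (act (α k) u) := by
    rw [Finset.sum_comm]
    simp only [hH]
  refine smul_right_injective _ (two_ne_zero (α := ℂ)) ?_
  change (2 : ℂ) • _ = (2 : ℂ) • _
  rw [two_smul]
  nth_rw 2 [e']
  simp only [← Finset.sum_add_distrib, ← smul_add, h.anticomm_act, smul_ite, smul_zero,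
    Finset.sum_ite_eq, Finset.mem_univ, if_true]
  rw [Complex.ofReal_sum, Finset.sum_smul, Finset.smul_sum]
  exact Finset.sum_congr rfl fun j _ => smul_comm _ _ _

/-- The terms which the potential contributes to the squared Dirac operator. -/
noncomputable def virialRemainder (α : Fin d → SpinMatrix d) (β : SpinMatrix d) (p : Space d)
    (τ : ℝ) (u η c : Spinor d) : Spinor d :=
  ((‖p‖ ^ 2 : ℝ) : ℂ) • u - (τ : ℂ) • act β u
    + act β ((2 : ℂ) • clifford α p (Complex.I • η) - (2 : ℂ) • c)

theorem IsDiracMatrices.norm_virialRemainder_le (h : IsDiracMatrices d α β) (p : Space d) (τ : ℝ)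
    (u η c : Spinor d) : ‖virialRemainder α β p τ u η c‖
      ≤ ‖p‖ ^ 2 * ‖u‖ + |τ| * ‖u‖ + (2 * (‖p‖ * ‖η‖) + 2 * ‖c‖) := by
  refine (norm_add_le _ _).trans (add_le_add ((norm_sub_le _ _).trans (add_le_add ?_ ?_)) ?_)
  · rw [norm_smul, Complex.norm_real, Real.norm_of_nonneg (by positivity)]
  · rw [norm_smul, Complex.norm_real, h.norm_act_beta, Real.norm_eq_abs]
  · rw [h.norm_act_beta]
    refine (norm_sub_le _ _).trans (le_of_eq ?_)
    rw [norm_smul, norm_smul, h.norm_clifford, norm_smul]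
    simp

/-- Applying the Dirac operator to `s = (l - mβ - iβ α·p)u` leaves `lη + mβη` and terms in `p`. The
equation for `η` is then used again: the mass cross terms cancel, while `lβ(α·p)u + m(α·p)u` is
recognized as `β(α·p)η` up to `i|p|²u`. Thus `l` and `m` survive only in `l² - m²`, which is why the
smallness condition does not involve them. -/
theorem IsDiracMatrices.diracField_eq (h : IsDiracMatrices d α β) {m l : ℝ} {p x : Space d}
    {H : Fin d → Fin d → ℝ} (hH : ∀ j k, H j k = H k j) {u : Spinor d}
    {D E : Fin d → Space d → Spinor d}
    (heq : diracField α D x + (m : ℂ) • act β u + Complex.I • act β (clifford α p u) = (l : ℂ) • u)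
    (hE : ∀ k, E k x = (l : ℂ) • D k x - (m : ℂ) • act β (D k x)
      - ∑ j, Complex.I • act β (act (α j) (p j • D k x + H k j • u))) :
    diracField α E x = ((l ^ 2 - m ^ 2 : ℝ) : ℂ) • u
      - virialRemainder α β p (∑ j, H j j) u (diracField α D x) (contract D p x) := by
  have h1 : ∑ k, act (α k) (E k x) = (l : ℂ) • ∑ k, act (α k) (D k x)
      + (m : ℂ) • act β (∑ k, act (α k) (D k x))
      + Complex.I • act β ((∑ k, ∑ j, (p j : ℂ) • act (α k) (act (α j) (D k x)))
        + ∑ k, ∑ j, (H k j : ℂ) • act (α k) (act (α j) u)) := by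
    simp only [act_sum, Finset.smul_sum, act_add, smul_add, ← Finset.sum_add_distrib]
    refine Finset.sum_congr rfl fun k _ => ?_
    rw [hE, act_sub, act_sub, act_smul, act_smul, act_sum]
    have a1 : ∀ v, act (α k) (act β v) = -act β (act (α k) v) := fun v => by
      rw [h.act_beta_alpha, neg_neg]
    simp only [act_smul, a1, act_add, act_real_smul, smul_neg, smul_add, sub_neg_eq_add,
      Finset.sum_neg_distrib, Finset.sum_add_distrib]
    rw [sub_eq_add_neg, neg_add, neg_neg, neg_neg]
    rfl
  rw [h.sum_alpha_clifford, h.sum_symm_act hH, sum_act_eq α E, sum_act_eq α D] at h1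
  set η := diracField α D x with hη
  have hη2 : η = (l : ℂ) • u - (m : ℂ) • act β u - Complex.I • act β (clifford α p u) := by
    rw [← heq]; abel
  have hcc := h.clifford_clifford p u
  have b1 : act β η = (l : ℂ) • act β u - (m : ℂ) • u - Complex.I • clifford α p u := by
    rw [hη2]; simp only [act_sub, act_smul, h.act_beta_beta]
  have b2 : act β (clifford α p η) = (l : ℂ) • act β (clifford α p u)
      + (m : ℂ) • clifford α p u + Complex.I • ((‖p‖ ^ 2 : ℝ) : ℂ) • u := by
    rw [h.act_beta_clifford, b1, clifford_sub, clifford_sub, clifford_smul, clifford_smul,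
      clifford_smul, hcc, h.act_beta_clifford, ← sum_coord_sq]
    module
  have key : diracField α E x = (l : ℂ) • η + (m : ℂ) • act β η
      + act β ((2 : ℂ) • contract D p x - clifford α p (Complex.I • η)
        + ((∑ j, H j j : ℝ) : ℂ) • u) := by
    refine smul_right_injective _ Complex.I_ne_zero ?_
    change Complex.I • _ = Complex.I • _
    rw [h1, act_smul]
    module
  rw [key, virialRemainder]
  simp only [act_add, act_sub, act_smul, clifford_smul]
  rw [b1, b2]
  nth_rw 1 [hη2]
  linear_combination (norm := module) Complex.I_mul_I • ((‖p‖ ^ 2 : ℝ) : ℂ) • u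

end Remainder

/-! ### Localization away from the origin -/

section Localization

variable {d : ℕ} {A : Space d → Space d} {f : Space d → Spinor d}
  {D : Fin d → Space d → Spinor d} {α : Fin d → SpinMatrix d} {β : SpinMatrix d}
  {φ : Space d → ℝ}

/-- The gradient, as a vector of partial derivatives. -/
noncomputable def gradVec (φ : Space d → ℝ) (x : Space d) : Space d :=
  WithLp.toLp 2 fun j => pderiv j φ x

/-- The Laplacian, as a sum of second partial derivatives. -/
noncomputable def lap (φ : Space d → ℝ) (x : Space d) : ℝ := ∑ j, pderiv j (pderiv j φ) x

theorem pderiv_eventuallyEq {φ ψ : Space d → ℝ} {x : Space d} (h : φ =ᶠ[𝓝 x] ψ) (j : Fin d) :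
    pderiv j φ =ᶠ[𝓝 x] pderiv j ψ := by
  filter_upwards [h.fderiv (𝕜 := ℝ)] with y hy
  rw [pderiv, pderiv, hy]

/-- The potential may be singular at the origin. Equality holds on neighbourhoods, not only at
points, so that first and second derivatives agree as well. -/
theorem exists_contDiff_eventuallyEq (hφ : ContDiffOn ℝ ∞ φ {0}ᶜ) (n : ℕ) :
    ∃ χ : Space d → ℝ, ContDiff ℝ ∞ χ ∧ HasCompactSupport χ ∧
      ∀ x ∈ tsupport (annulus n : Space d → ℝ), χ =ᶠ[𝓝 x] φ := by
  have hn : (0 : ℝ) ≤ n := Nat.cast_nonneg n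
  -- The index is chosen so that this cutoff is one for `1/(2(n+1)) ≤ ‖x‖ ≤ 4(n+1)`, which contains
  -- a neighbourhood of the support `1/(n+1) ≤ ‖x‖ ≤ 2(n+1)` of `annulus n`.
  refine ⟨fun x => annulus (4 * n + 3) x * φ x, contDiff_iff_contDiffAt.2 fun x => ?_,
    (hasCompactSupport_annulus _).mul_right, fun x hx => ?_⟩
  · rcases eq_or_ne x 0 with rfl | hx
    · have c : Continuous fun y : Space d => (((4 * n + 3 : ℕ) : ℝ) + 1) * ‖y‖ :=
        continuous_const.mul continuous_norm
      have h0 : (fun x : Space d => annulus (4 * n + 3) x * φ x) =ᶠ[𝓝 0] fun _ => 0 := by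
        filter_upwards [c.continuousAt.eventually (gt_mem_nhds (by simp :
          (((4 * n + 3 : ℕ) : ℝ) + 1) * ‖(0 : Space d)‖ < 1))] with y hy
        rw [annulus_eq_zero_of_norm_le _ hy.le, zero_mul]
      exact contDiffAt_const.congr_of_eventuallyEq h0
    · exact (contDiff_annulus _).contDiffAt.mul
        (hφ.contDiffAt (isOpen_compl_singleton.mem_nhds hx))
  · obtain ⟨h1, h2⟩ := tsupport_annulus_subset n hx
    have e := annulus_eventuallyEq_one (4 * n + 3) (x := x) (by push_cast; linarith)
      (by push_cast; linarith)
    filter_upwards [e] with y hy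
    rw [hy, one_mul]

/-- `η` itself need not lie in `H¹`, because `∇φ` may be singular. Replacing `φ` by a smooth
compactly supported `χ` in the eigenvalue equation gives a field in `H¹` that coincides with `η` on
the annulus. -/
theorem exists_virialField (hαβ : IsDiracMatrices d α β) (h : MagSobolev A f D) {m l : ℝ}
    (hφ : ContDiffOn ℝ ∞ φ {0}ᶜ)
    (heq : ∀ᵐ x, diracField α D x + (m : ℂ) • act β (f x)
      + Complex.I • act β (clifford α (gradVec φ x) (f x)) = (l : ℂ) • f x) (n : ℕ) :
    ∃ (s : Space d → Spinor d) (E : Fin d → Space d → Spinor d), MagSobolev A s E ∧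
      ∀ᵐ x, x ∈ tsupport (annulus n : Space d → ℝ) → s x = diracField α D x ∧
        diracField α E x = ((l ^ 2 - m ^ 2 : ℝ) : ℂ) • f x
          - virialRemainder α β (gradVec φ x) (lap φ x) (f x) (diracField α D x)
            (contract D (gradVec φ x) x) := by
  obtain ⟨χ, hχ, hχs, hχφ⟩ := exists_contDiff_eventuallyEq hφ n
  have hp : ∀ j : Fin d, ContDiff ℝ ∞ (pderiv j χ) := fun j => contDiff_fderiv_apply hχ _
  have hps : ∀ j : Fin d, HasCompactSupport (pderiv j χ) := fun j => hasCompactSupport_pderiv hχs j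
  choose C hC using fun j => exists_abs_le_of_hasCompactSupport (hp j) (hps j)
  have hs := ((h.const_smul (l : ℂ)).sub ((h.act β).const_smul (m : ℂ))).sub
    (MagSobolev.sum Finset.univ fun j =>
      (((h.mul (hp j) (hC j).1 (hC j).2).act (α j)).act β).const_smul Complex.I)
  refine ⟨_, _, hs, ?_⟩
  filter_upwards [heq] with x hx hxn
  have e1 : ∀ j, pderiv j χ x = gradVec φ x j := fun j =>
    (pderiv_eventuallyEq (hχφ x hxn) j).eq_of_nhds
  have e2 : ∀ j, pderiv j (pderiv j χ) x = pderiv j (pderiv j φ) x := fun j =>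
    (pderiv_eventuallyEq (pderiv_eventuallyEq (hχφ x hxn) j) j).eq_of_nhds
  constructor
  · rw [sub_sub, sub_eq_iff_eq_add, ← hx, add_assoc]
    congr 2
    simp only [clifford, act_sum, act_smul, act_real_smul, Finset.smul_sum, e1]
    rfl
  · rw [lap]
    simp only [← e2]
    exact hαβ.diracField_eq (H := fun k j => pderiv k (pderiv j χ) x)
      (fun j k => fderiv_fderiv_comm hχ x _ _) hx fun k => by simp only [e1]

/-- Skew-symmetry of the dilation generator, in localized form. It removes the term `(l² - m²) f`
from the virial identity. -/
theorem MagSobolev.integral_dilation (hA : ∀ j, IsMultiplier fun x => A x j)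
    (h : MagSobolev A f D) {θ : Space d → ℝ} (hθ : ContDiff ℝ ∞ θ) (hθs : HasCompactSupport θ) :
    Integrable (fun x => 2 * θ x * (inner ℂ (f x) (dilation f D x)).re
      + (∑ k, x k * pderiv k θ x) * ‖f x‖ ^ 2) ∧
    ∫ x, (2 * θ x * (inner ℂ (f x) (dilation f D x)).re
      + (∑ k, x k * pderiv k θ x) * ‖f x‖ ^ 2) = 0 := by
  obtain ⟨C, hC1, hC2, -⟩ := exists_bounds_coord_mul hθ hθs
  have hpd : ∀ k j x, pderiv j (fun x : Space d => x k * θ x) x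
      = x k * pderiv j θ x + (if j = k then 1 else 0) * θ x := fun k j x => by
    rw [pderiv_mul (contDiff_coord k) hθ, pderiv_coord]
  have kB := fun k => h.integral_by_parts hA h ((contDiff_coord k).mul hθ) (hC1 k) (hC2 k) k
  have iB := integrable_finsetSum Finset.univ fun k _ => (kB k).1
  have zB := integral_finsetSum Finset.univ fun k _ => (kB k).1
  rw [Finset.sum_eq_zero fun k _ => (kB k).2] at zB
  have e : ∀ x, Complex.reCLM (∑ k, (((x k * θ x : ℝ) : ℂ) * inner ℂ (D k x) (f x)
      + ((x k * θ x : ℝ) : ℂ) * inner ℂ (f x) (D k x)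
      + (pderiv k (fun x : Space d => x k * θ x) x : ℂ) * inner ℂ (f x) (f x)))
      = 2 * θ x * (inner ℂ (f x) (dilation f D x)).re
        + (∑ k, x k * pderiv k θ x) * ‖f x‖ ^ 2 := by
    intro x
    have cd2 : ∀ z : ℂ, ((d : ℂ) / 2 * z).re = d / 2 * z.re := fun z => by
      rw [show (d : ℂ) / 2 = ((d / 2 : ℝ) : ℂ) by push_cast; rfl, Complex.re_ofReal_mul]
    have e2 : ∑ k : Fin d, (x k * pderiv k θ x + 1 * θ x)
        = ∑ k, x k * pderiv k θ x + d * θ x := by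
      simp [Finset.sum_add_distrib]
    rw [Complex.reCLM_apply, inner_dilation_right, inner_contract_right]
    simp only [hpd, if_true, Complex.re_sum, Complex.add_re, Complex.re_ofReal_mul, cd2,
      re_inner_comm (D _ x) (f x), inner_self_re_eq, Finset.sum_add_distrib]
    rw [← Finset.sum_mul, e2]
    have e3 : ∑ k, x k * θ x * (inner ℂ (f x) (D k x)).re
        = θ x * ∑ k, x k * (inner ℂ (f x) (D k x)).re := by
      rw [Finset.mul_sum]
      exact Finset.sum_congr rfl fun k _ => by ring
    rw [e3]
    ring
  refine ⟨(Complex.reCLM.integrable_comp iB).congr (Eventually.of_forall e), ?_⟩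
  rw [← integral_congr_ae (Eventually.of_forall e), ContinuousLinearMap.integral_comp_comm _ iB, zB,
    map_zero]

end Localization

/-! ### The virial inequality -/

section VirialEstimate

variable {d : ℕ} {A : Space d → Space d} {f : Space d → Spinor d}
  {D : Fin d → Space d → Spinor d} {α : Fin d → SpinMatrix d} {β : SpinMatrix d}
  {φ : Space d → ℝ}

theorem abs_re_inner_le (u v : Spinor d) : |(inner ℂ u v : ℂ).re| ≤ ‖u‖ * ‖v‖ :=
  (Complex.abs_re_le_norm _).trans (norm_inner_le_norm u v)

theorem norm_eq_mul_norm_divNorm (g : Space d → Spinor d) {x : Space d} (hx : x ≠ 0) :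
    ‖g x‖ = ‖x‖ * ‖divNorm g x‖ := by
  rw [divNorm, norm_smul, norm_inv, norm_norm, mul_inv_cancel_left₀ (norm_ne_zero_iff.2 hx)]

theorem IsDiracMatrices.norm_clifford_pderiv_le (hαβ : IsDiracMatrices d α β) {θ : Space d → ℝ}
    {x : Space d} {C : ℝ} (hC : ∀ j, ‖x‖ * |pderiv j θ x| ≤ C) (u : Spinor d) :
    ‖x‖ * ‖clifford α (fun j => pderiv j θ x) u‖ ≤ d * C * ‖u‖ := by
  have h1 : ‖clifford α (fun j => pderiv j θ x) u‖ ≤ ∑ j, |pderiv j θ x| * ‖u‖ := by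
    refine (norm_sum_le _ _).trans (Finset.sum_le_sum fun j _ => le_of_eq ?_)
    rw [norm_smul, Complex.norm_real, hαβ.norm_act_alpha, Real.norm_eq_abs]
  refine (mul_le_mul_of_nonneg_left h1 (norm_nonneg x)).trans ?_
  rw [Finset.mul_sum]
  refine (Finset.sum_le_sum fun j _ => (?_ : _ ≤ C * ‖u‖)).trans (le_of_eq ?_)
  · rw [← mul_assoc]
    exact mul_le_mul_of_nonneg_right (hC j) (norm_nonneg u)
  · simp [mul_assoc]

theorem abs_sum_coord_mul_pderiv_le {θ : Space d → ℝ} {x : Space d} {C : ℝ}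
    (hC : ∀ j, ‖x‖ * |pderiv j θ x| ≤ C) : |∑ k, x k * pderiv k θ x| ≤ d * C := by
  refine (Finset.abs_sum_le_sum_abs _ _).trans
    ((Finset.sum_le_sum fun j _ => (?_ : _ ≤ C)).trans (le_of_eq ?_))
  · rw [abs_mul]
    exact (mul_le_mul_of_nonneg_right (abs_coord_le x j) (abs_nonneg _)).trans (hC j)
  · simp

/-- The integrand of the virial identity for an eigenfunction. -/
noncomputable def virialLimit (α : Fin d → SpinMatrix d) (β : SpinMatrix d)
    (B : Space d → Matrix (Fin d) (Fin d) ℝ) (φ θ : Space d → ℝ) (μ : ℝ) (f : Space d → Spinor d)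
    (D : Fin d → Space d → Spinor d) (x : Space d) : ℝ :=
  -(2 * θ x * (inner ℂ (virialRemainder α β (gradVec φ x) (lap φ x) (f x) (diracField α D x)
        (contract D (gradVec φ x) x)) (dilation f D x)).re)
    - 2 * θ x * ‖diracField α D x‖ ^ 2
    + 2 * θ x * (inner ℂ (clifford α (fun j => ∑ k, B x j k * x k) (diracField α D x)) (f x)).re
    + (∑ k, x k * pderiv k θ x) * (‖diracField α D x‖ ^ 2 - μ * ‖f x‖ ^ 2)
    + 2 * (Complex.I * inner ℂ (clifford α (fun j => pderiv j θ x) (diracField α D x))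
        (dilation f D x)).re

/-- The virial inequality for an eigenfunction. -/
theorem MagSobolev.virial_le (hd : 3 ≤ d) (hαβ : IsDiracMatrices d α β)
    (hA : ∀ j, IsMultiplier fun x => A x j) (hAl : MemL2loc A)
    {B : Space d → Matrix (Fin d) (Fin d) ℝ} (hAB : IsMagneticField A B)
    (hB : ∀ j k, MemL2loc fun x => B x j k) {b : Space d → ℝ} {ε₁ ε₂ ε₃ : ℝ} (hε₁ : 0 ≤ ε₁)
    (hε₂ : 0 ≤ ε₂) (hε₃ : 0 ≤ ε₃) (hb : HardyBound A b ε₁) (hBb : ∀ x j k, |B x j k| ≤ b x)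
    (hBv : ∀ x u, ‖clifford α (fun j => ∑ k, B x j k * x k) u‖ ≤ ‖x‖ * b x * ‖u‖)
    (h : MagSobolev A f D) {m l : ℝ} (hφ : ContDiffOn ℝ ∞ φ {0}ᶜ)
    (heq : ∀ᵐ x, diracField α D x + (m : ℂ) • AnomalousDirac.act β (f x)
      + Complex.I • AnomalousDirac.act β (clifford α (gradVec φ x) (f x)) = (l : ℂ) • f x)
    (hgrad : ∀ x, x ≠ 0 → ‖x‖ * ‖gradVec φ x‖ ≤ ε₂) (hlap : HardyBound A (lap φ) ε₃) :
    2 * l2norm volume (diracField α D) ^ 2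
      ≤ 2 * (ε₁ * energy D * l2norm volume (diracField α D))
        + 2 * ((ε₂ ^ 2 * (2 / ((d : ℝ) - 2)) * energy D + ε₃ * energy D
          + 2 * ε₂ * l2norm volume (diracField α D) + 2 * ε₂ * energy D)
            * ((if d = 3 then 2 else 1) * energy D)) := by
  obtain ⟨C, hC0, hC⟩ := exists_abs_pderiv_annulus_le d
  choose s E hsE hsx using fun n : ℕ => exists_virialField hαβ h hφ heq n
  set μ : ℝ := l ^ 2 - m ^ 2 with hμ
  have h1 := fun n => integral_virialIntegrand hαβ hA hAl hAB hB hb hBb h (hsE n)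
    (contDiff_annulus n) (hasCompactSupport_annulus n) (by
      filter_upwards [hsx n] with x hx hx2 using (hx hx2).1)
  have h2 := fun n : ℕ => h.integral_dilation hA (contDiff_annulus n) (hasCompactSupport_annulus n)
  -- Insertion of the squared equation. Subtracting `μ` times the dilation identity cancels the
  -- pairing of `μ f` with `dilation f D` and leaves `-μ|f|²` only next to `∇θ`.
  have hform : ∀ n : ℕ, ∀ᵐ x, virialIntegrand α B (annulus n) f D (E n) x
      - μ * (2 * annulus n x * (inner ℂ (f x) (dilation f D x)).re
        + (∑ k, x k * pderiv k (annulus n) x) * ‖f x‖ ^ 2)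
      = virialLimit α β B φ (annulus n) μ f D x := by
    intro n
    filter_upwards [hsx n] with x hx
    by_cases hxs : x ∈ tsupport (annulus n : Space d → ℝ)
    · rw [virialIntegrand, virialLimit, (hx hxs).2, inner_sub_left, inner_smul_left,
        Complex.conj_ofReal, Complex.sub_re, Complex.re_ofReal_mul]
      ring
    · have e0 : (annulus n : Space d → ℝ) x = 0 := image_eq_zero_of_notMem_tsupport hxs
      have e1 : ∀ j, pderiv j (annulus n) x = 0 := pderiv_eq_zero_of_notMem_tsupport hxs
      simp [virialIntegrand, virialLimit, e0, e1, clifford]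
  have hint : ∀ n : ℕ, Integrable (virialLimit α β B φ (annulus n) μ f D) ∧
      ∫ x, virialLimit α β B φ (annulus n) μ f D x = 0 := by
    intro n
    refine ⟨((h1 n).1.sub ((h2 n).1.const_mul μ)).congr (hform n), ?_⟩
    rw [← integral_congr_ae (hform n), integral_sub (h1 n).1 ((h2 n).1.const_mul μ), (h1 n).2,
      integral_const_mul, (h2 n).2, mul_zero, sub_zero]
  obtain ⟨hN, hN2⟩ := h.hardy hA hd
  have hR := h.memLp_divNorm_dilation hA hd
  have hR2 := h.l2norm_divNorm_dilation_le hA hd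
  have hη := h.memLp_diracField α
  have hg := h.memLp_gradLen
  have hL := hlap.memLp h
  have hM := hb.memLp h
  have iaN := integrable_norm_mul_norm hN hR
  have iLN := integrable_norm_mul_norm hL hR
  have iyN := integrable_norm_mul_norm hη hR
  have igN := integrable_norm_mul_norm hg hR
  have iMy := integrable_norm_mul_norm hM hη
  have iy2 := integrable_norm_sq hη
  have if2 := integrable_norm_sq h.memLp
  let P : Space d → ℝ := fun x => ε₂ ^ 2 * (‖divNorm f x‖ * ‖divNorm (dilation f D) x‖)
    + ‖(‖x‖ * lap φ x) • f x‖ * ‖divNorm (dilation f D) x‖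
    + 2 * ε₂ * (‖diracField α D x‖ * ‖divNorm (dilation f D) x‖)
    + 2 * ε₂ * (‖gradLen D x‖ * ‖divNorm (dilation f D) x‖)
  let R : Space d → ℝ := fun x => ‖(‖x‖ * b x) • f x‖ * ‖diracField α D x‖
  have iP : Integrable P := (((iaN.const_mul _).add iLN).add (iyN.const_mul _)).add (igN.const_mul _)
  -- The dilation generator is controlled only after division by `|x|`. The compensating factor
  -- `|x|` goes to the remainder, where `|x| |∇φ| ≤ ε₂`; the quadratic term uses this twice and
  -- takes its second `|x|` from `f`.
  have hK : ∀ x, x ≠ 0 → |(inner ℂ (virialRemainder α β (gradVec φ x) (lap φ x) (f x)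
      (diracField α D x) (contract D (gradVec φ x) x)) (dilation f D x)).re| ≤ P x := by
    intro x hx
    refine (abs_re_inner_le _ _).trans ?_
    have hp := hgrad x hx
    have hp0 : 0 ≤ ‖x‖ * ‖gradVec φ x‖ := by positivity
    have hx0 : 0 < ‖x‖ := norm_pos_iff.2 hx
    have k1 := hαβ.norm_virialRemainder_le (gradVec φ x) (lap φ x) (f x) (diracField α D x)
      (contract D (gradVec φ x) x)
    have k2 := norm_contract_le D (gradVec φ x) x
    have k3 : ‖x‖ * (‖gradVec φ x‖ ^ 2 * ‖f x‖) ≤ ε₂ ^ 2 * ‖divNorm f x‖ := by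
      rw [norm_eq_mul_norm_divNorm f hx]
      calc _ = (‖x‖ * ‖gradVec φ x‖) ^ 2 * ‖divNorm f x‖ := by ring
        _ ≤ _ := mul_le_mul_of_nonneg_right (pow_le_pow_left₀ hp0 hp 2) (norm_nonneg _)
    have k4 : ‖x‖ * (|lap φ x| * ‖f x‖) = ‖(‖x‖ * lap φ x) • f x‖ := by
      rw [norm_smul, norm_mul, norm_norm, Real.norm_eq_abs, mul_assoc]
    have k5 : ‖x‖ * (‖gradVec φ x‖ * ‖diracField α D x‖) ≤ ε₂ * ‖diracField α D x‖ := by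
      rw [← mul_assoc]
      exact mul_le_mul_of_nonneg_right hp (norm_nonneg _)
    have k6 : ‖x‖ * ‖contract D (gradVec φ x) x‖ ≤ ε₂ * ‖gradLen D x‖ := by
      rw [Real.norm_of_nonneg (gradLen_nonneg _ _)]
      refine (mul_le_mul_of_nonneg_left k2 hx0.le).trans ?_
      rw [← mul_assoc]
      exact mul_le_mul_of_nonneg_right hp (gradLen_nonneg _ _)
    rw [norm_eq_mul_norm_divNorm (dilation f D) hx, mul_left_comm, ← mul_assoc]
    have k7 := mul_le_mul_of_nonneg_left k1 hx0.le
    have k8 : ‖x‖ * ‖virialRemainder α β (gradVec φ x) (lap φ x) (f x)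
        (diracField α D x) (contract D (gradVec φ x) x)‖ ≤ ε₂ ^ 2 * ‖divNorm f x‖
        + ‖(‖x‖ * lap φ x) • f x‖ + 2 * ε₂ * ‖diracField α D x‖ + 2 * ε₂ * ‖gradLen D x‖ := by
      refine k7.trans ?_
      simp only [mul_add, mul_left_comm ‖x‖ (2 : ℝ)]
      linarith
    refine (mul_le_mul_of_nonneg_right k8 (norm_nonneg _)).trans (le_of_eq ?_)
    simp only [P]
    ring
  have hc : ∀ x, |(inner ℂ (clifford α (fun j => ∑ k, B x j k * x k) (diracField α D x))
      (f x)).re| ≤ R x := by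
    intro x
    have hb0 : 0 ≤ b x := (abs_nonneg _).trans (hBb x ⟨0, by omega⟩ ⟨0, by omega⟩)
    refine (abs_re_inner_le _ _).trans
      ((mul_le_mul_of_nonneg_right (hBv x _) (norm_nonneg _)).trans (le_of_eq ?_))
    simp only [R]
    rw [norm_smul, norm_mul, norm_norm, Real.norm_of_nonneg hb0]
    ring
  -- A majorant independent of `n`. The last two terms dominate those containing `∇θ`, by the
  -- uniform bound `|x| |∂_jθ| ≤ C`; these tend to zero pointwise away from the origin.
  let bound : Space d → ℝ := fun x => 2 * P x + 2 * ‖diracField α D x‖ ^ 2 + 2 * R x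
    + (d * C) * (‖diracField α D x‖ ^ 2 + |μ| * ‖f x‖ ^ 2)
    + 2 * (d * C) * (‖diracField α D x‖ * ‖divNorm (dilation f D) x‖)
  have ibound : Integrable bound := ((((iP.const_mul 2).add (iy2.const_mul 2)).add
    (iMy.const_mul 2)).add ((iy2.add (if2.const_mul _)).const_mul _)).add (iyN.const_mul _)
  have hbd : ∀ n : ℕ, ∀ᵐ x, ‖virialLimit α β B φ (annulus n) μ f D x‖ ≤ bound x := by
    intro n
    filter_upwards [ae_ne_zero hd] with x hx
    have t0 := abs_annulus_le n x
    have q : ∀ a c : ℝ, |a| ≤ c → |2 * annulus n x * a| ≤ 2 * c := fun a c hac => by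
      rw [abs_mul, abs_mul, abs_two, mul_assoc]
      exact mul_le_mul_of_nonneg_left
        ((mul_le_of_le_one_left (abs_nonneg _) t0).trans hac) zero_le_two
    rw [Real.norm_eq_abs, virialLimit]
    refine (abs_add_le _ _).trans (add_le_add ((abs_add_le _ _).trans (add_le_add
      ((abs_add_le _ _).trans (add_le_add ((abs_sub _ _).trans (add_le_add ?_ ?_)) ?_)) ?_)) ?_)
    · rw [abs_neg]
      exact q _ _ (hK x hx)
    · exact q _ _ (abs_of_nonneg (by positivity)).le
    · exact q _ _ (hc x)
    · rw [abs_mul]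
      refine mul_le_mul (abs_sum_coord_mul_pderiv_le fun j => hC n j x)
        ((abs_sub _ _).trans (le_of_eq ?_)) (abs_nonneg _) (by positivity)
      rw [abs_mul, abs_of_nonneg (by positivity : 0 ≤ ‖diracField α D x‖ ^ 2),
        abs_of_nonneg (by positivity : 0 ≤ ‖f x‖ ^ 2)]
    · rw [abs_mul, abs_two, mul_assoc]
      refine mul_le_mul_of_nonneg_left ?_ zero_le_two
      refine (Complex.abs_re_le_norm _).trans ?_
      rw [norm_mul, Complex.norm_I, one_mul]
      refine (norm_inner_le_norm _ _).trans ?_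
      rw [norm_eq_mul_norm_divNorm (dilation f D) hx, mul_left_comm, ← mul_assoc, ← mul_assoc]
      exact mul_le_mul_of_nonneg_right
        (hαβ.norm_clifford_pderiv_le (fun j => hC n j x) _) (norm_nonneg _)
  have hlim : ∀ᵐ x, Tendsto (fun n : ℕ => virialLimit α β B φ (annulus n) μ f D x) atTop
      (𝓝 (virialLimit α β B φ (fun _ => 1) μ f D x)) := by
    filter_upwards [ae_ne_zero hd] with x hx
    refine tendsto_const_nhds.congr' ?_
    filter_upwards [eventually_annulus hx] with n hn
    have e1 : ∀ j : Fin d, pderiv j (fun _ : Space d => (1 : ℝ)) x = 0 := fun j => by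
      simp [pderiv]
    simp only [virialLimit, hn.1, hn.2, e1]
  have hmeas := aestronglyMeasurable_of_tendsto_ae atTop (fun n => (hint n).1.1) hlim
  have iG : Integrable (virialLimit α β B φ (fun _ => 1) μ f D) := by
    refine ibound.mono' hmeas ?_
    filter_upwards [hlim, ae_all_iff.2 hbd] with x g1 g2
    exact le_of_tendsto g1.norm (Eventually.of_forall g2)
  have hG : ∫ x, virialLimit α β B φ (fun _ => 1) μ f D x = 0 := by
    have t := tendsto_integral_of_dominated_convergence bound (fun n => (hint n).1.1) ibound hbd hlim
    simp only [(hint _).2] at t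
    exact tendsto_nhds_unique t tendsto_const_nhds
  have hle : ∀ᵐ x, 2 * ‖diracField α D x‖ ^ 2
      ≤ 2 * P x + 2 * R x - virialLimit α β B φ (fun _ => 1) μ f D x := by
    filter_upwards [ae_ne_zero hd] with x hx
    have e1 : ∀ j : Fin d, pderiv j (fun _ : Space d => (1 : ℝ)) x = 0 := fun j => by
      simp [pderiv]
    have g1 := (abs_le.1 (hK x hx)).1
    have g2 := (abs_le.1 (hc x)).2
    have e2 : clifford α (fun _ => (0 : ℝ)) (diracField α D x) = 0 := by simp [clifford]
    simp only [virialLimit, e1, e2, mul_zero, Finset.sum_const_zero, inner_zero_left,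
      Complex.zero_re, zero_mul, add_zero]
    linarith
  have h3 := integral_mono_ae (iy2.const_mul 2)
    (((iP.const_mul 2).add (iMy.const_mul 2)).sub iG) hle
  have e3 := integral_sub ((iP.const_mul 2).add (iMy.const_mul 2)) iG
  have e4 := integral_add (iP.const_mul 2) (iMy.const_mul 2)
  simp only [Pi.add_apply] at e3 e4
  simp only [Pi.sub_apply, Pi.add_apply] at h3
  rw [integral_const_mul, ← l2norm_sq, e3, hG, e4, integral_const_mul, integral_const_mul,
    sub_zero] at h3
  refine h3.trans ?_
  have eP : ∫ x, P x = ε₂ ^ 2 * (∫ x, ‖divNorm f x‖ * ‖divNorm (dilation f D) x‖)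
    + (∫ x, ‖(‖x‖ * lap φ x) • f x‖ * ‖divNorm (dilation f D) x‖)
    + 2 * ε₂ * (∫ x, ‖diracField α D x‖ * ‖divNorm (dilation f D) x‖)
    + 2 * ε₂ * (∫ x, ‖gradLen D x‖ * ‖divNorm (dilation f D) x‖) := by
    have a1 := integral_add (((iaN.const_mul (ε₂ ^ 2)).add iLN).add (iyN.const_mul (2 * ε₂)))
      (igN.const_mul (2 * ε₂))
    have a2 := integral_add ((iaN.const_mul (ε₂ ^ 2)).add iLN) (iyN.const_mul (2 * ε₂))
    have a3 := integral_add (iaN.const_mul (ε₂ ^ 2)) iLN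
    simp only [Pi.add_apply] at a1 a2 a3
    rw [a1, a2, a3, integral_const_mul, integral_const_mul, integral_const_mul]
  set X := energy D with hX
  have hX0 : 0 ≤ X := energy_nonneg D
  set Y := l2norm volume (diracField α D)
  have hY0 : 0 ≤ Y := l2norm_nonneg _
  have hd3 : (3 : ℝ) ≤ d := by exact_mod_cast hd
  have hκ : 0 ≤ 2 / ((d : ℝ) - 2) := div_nonneg zero_le_two (by linarith)
  have b1 := (integral_norm_mul_norm_le hN hR).trans
    (mul_le_mul hN2 hR2 (l2norm_nonneg _) (by positivity))
  have b2 := (integral_norm_mul_norm_le hL hR).trans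
    (mul_le_mul (hlap.l2norm_le hε₃ h) hR2 (l2norm_nonneg _) (by positivity))
  have b3 := (integral_norm_mul_norm_le hη hR).trans
    (mul_le_mul_of_nonneg_left hR2 (l2norm_nonneg _))
  have b4 := (integral_norm_mul_norm_le hg hR).trans
    (mul_le_mul_of_nonneg_left hR2 (l2norm_nonneg _))
  rw [show l2norm volume (gradLen D) = X from rfl] at b4
  have b5 := (integral_norm_mul_norm_le hM hη).trans
    (mul_le_mul_of_nonneg_right (hb.l2norm_le hε₁ h) (l2norm_nonneg _))
  have c1 := mul_le_mul_of_nonneg_left b1 (sq_nonneg ε₂)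
  have c3 := mul_le_mul_of_nonneg_left b3 (mul_nonneg zero_le_two hε₂)
  have c4 := mul_le_mul_of_nonneg_left b4 (mul_nonneg zero_le_two hε₂)
  have c0 : ∫ x, P x ≤ (ε₂ ^ 2 * (2 / ((d : ℝ) - 2)) * X + ε₃ * X + 2 * ε₂ * Y + 2 * ε₂ * X)
      * ((if d = 3 then 2 else 1) * X) := by
    rw [eP]
    refine (add_le_add (add_le_add (add_le_add c1 b2) c3) c4).trans (le_of_eq ?_)
    ring
  linarith

end VirialEstimate

/-! ### The operator norm of the magnetic field -/

section OperatorNorm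

variable {d : ℕ} {α : Fin d → SpinMatrix d} {β : SpinMatrix d}

theorem norm_mulVec_le_opNorm (M : Matrix (Fin d) (Fin d) ℝ) (v : Space d) :
    ‖(WithLp.toLp 2 (fun j => ∑ k, M j k * v k) : Space d)‖ ≤ opNorm M * ‖v‖ :=
  (Matrix.toEuclideanCLM (𝕜 := ℝ) M).le_opNorm v

theorem opNorm_nonneg (M : Matrix (Fin d) (Fin d) ℝ) : 0 ≤ opNorm M := norm_nonneg _

/-- Applied to its own row `r`, the matrix has `j`-th component `‖r‖²`, which is at most `opNorm M *
‖r‖`. -/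
theorem norm_row_le_opNorm (M : Matrix (Fin d) (Fin d) ℝ) (j : Fin d) :
    ‖(WithLp.toLp 2 (M j) : Space d)‖ ≤ opNorm M := by
  set r : Space d := WithLp.toLp 2 (M j) with hr
  have h1 := abs_coord_le (WithLp.toLp 2 (fun j => ∑ k, M j k * r k) : Space d) j
  have h2 : (WithLp.toLp 2 (fun j => ∑ k, M j k * r k) : Space d) j = ‖r‖ ^ 2 := by
    rw [← sum_coord_sq]
    change ∑ k, M j k * r k = _
    exact Finset.sum_congr rfl fun k _ => (pow_two (r k)).symm
  rw [h2, abs_of_nonneg (sq_nonneg _)] at h1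
  rcases eq_or_lt_of_le (norm_nonneg r) with h | h
  · rw [← h]
    exact opNorm_nonneg M
  · have h3 := h1.trans (norm_mulVec_le_opNorm M r)
    rw [pow_two] at h3
    exact le_of_mul_le_mul_right h3 h

theorem abs_le_opNorm (M : Matrix (Fin d) (Fin d) ℝ) (j k : Fin d) : |M j k| ≤ opNorm M :=
  (abs_coord_le (WithLp.toLp 2 (M j) : Space d) k).trans (norm_row_le_opNorm M j)

theorem aestronglyMeasurable_opNorm {B : Space d → Matrix (Fin d) (Fin d) ℝ}
    (hB : ∀ j k, AEStronglyMeasurable (fun x => B x j k) volume) :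
    AEStronglyMeasurable (fun x => opNorm (B x)) volume := by
  have e : ∀ x, opNorm (B x)
      = ‖∑ j, ∑ k, B x j k • Matrix.toEuclideanCLM (𝕜 := ℝ) (Matrix.single j k (1 : ℝ))‖ := by
    intro x
    rw [opNorm]
    congr 1
    conv_lhs => rw [Matrix.matrix_eq_sum_single (B x)]
    simp only [map_sum, ← map_smul, Matrix.smul_single, smul_eq_mul, mul_one]
  simp only [e]
  exact (Finset.aestronglyMeasurable_fun_sum _ fun j _ =>
    Finset.aestronglyMeasurable_fun_sum _ fun k _ => (hB j k).smul_const _).norm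

theorem IsDiracMatrices.norm_clifford_mulVec_le (hαβ : IsDiracMatrices d α β)
    (M : Matrix (Fin d) (Fin d) ℝ) (x : Space d) (u : Spinor d) :
    ‖clifford α (fun j => ∑ k, M j k * x k) u‖ ≤ ‖x‖ * opNorm M * ‖u‖ := by
  have h := hαβ.norm_clifford (WithLp.toLp 2 (fun j => ∑ k, M j k * x k)) u
  rw [h, mul_comm ‖x‖]
  exact mul_le_mul_of_nonneg_right (norm_mulVec_le_opNorm M x) (norm_nonneg u)

/-- For fixed `j` the sum over `k` is the Clifford action of the `j`-th row, of norm at most `opNorm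
M`. There are `d` rows. -/
theorem IsDiracMatrices.norm_spinTerm_le (hαβ : IsDiracMatrices d α β)
    (M : Matrix (Fin d) (Fin d) ℝ) (s : Spinor d) :
    ‖spinTerm α M s‖ ≤ d * opNorm M * ‖s‖ := by
  refine (norm_sum_le _ _).trans ((Finset.sum_le_sum fun j _ =>
    (?_ : _ ≤ opNorm M * ‖s‖)).trans (le_of_eq ?_))
  · have h := hαβ.norm_clifford (WithLp.toLp 2 (M j)) (act (α j) s)
    rw [hαβ.norm_act_alpha] at h
    exact h.le.trans (mul_le_mul_of_nonneg_right (norm_row_le_opNorm M j) (norm_nonneg s))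
  · simp [mul_assoc]

/-- An antisymmetric `3 × 3` matrix satisfies `M³ = -qM`, so `M² = -q` on the columns of `M`. A
nonzero column gives the bound; if all columns vanish, then `q = 0`. -/
theorem axial_le_opNorm {M : Matrix (Fin 3) (Fin 3) ℝ} (hM : ∀ j k, M j k = -M k j) :
    M 0 1 ^ 2 + M 0 2 ^ 2 + M 1 2 ^ 2 ≤ opNorm M ^ 2 := by
  have h0 : ∀ j, M j j = 0 := fun j => by linarith [hM j j]
  set q := M 0 1 ^ 2 + M 0 2 ^ 2 + M 1 2 ^ 2 with hq
  have hq0 : 0 ≤ q := by positivity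
  have hN := opNorm_nonneg M
  have key : ∀ v : Space 3, (∃ l, v = WithLp.toLp 2 (fun j => M j l)) →
      q * ‖v‖ ≤ opNorm M ^ 2 * ‖v‖ := by
    rintro v ⟨l, rfl⟩
    set v : Space 3 := WithLp.toLp 2 (fun j => M j l) with hv
    set w : Space 3 := WithLp.toLp 2 (fun j => ∑ k, M j k * v k) with hw
    have h1 := norm_mulVec_le_opNorm M v
    have h2 := norm_mulVec_le_opNorm M w
    have h3 : (WithLp.toLp 2 (fun j => ∑ k, M j k * w k) : Space 3) = (-q) • v := by
      have e1 := hM 1 0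
      have e2 := hM 2 0
      have e3 := hM 2 1
      ext i
      simp only [hw, hv, PiLp.smul_apply, Fin.sum_univ_three, smul_eq_mul, hq]
      fin_cases i <;> fin_cases l <;> simp [h0, e1, e2, e3] <;> ring
    rw [h3, norm_smul, norm_neg, Real.norm_of_nonneg hq0] at h2
    calc _ ≤ opNorm M * (opNorm M * ‖v‖) := h2.trans (mul_le_mul_of_nonneg_left h1 hN)
      _ = _ := by ring
  by_contra hlt
  rw [not_le] at hlt
  have hz : ∀ l j, M j l = 0 := by
    intro l j
    have h1 := key _ ⟨l, rfl⟩
    have h2 : ‖(WithLp.toLp 2 (fun j => M j l) : Space 3)‖ = 0 := by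
      by_contra hne
      have hpos := lt_of_le_of_ne (norm_nonneg _) (Ne.symm hne)
      exact absurd (le_of_mul_le_mul_right h1 hpos) (not_le.2 hlt)
    have h3 := abs_coord_le (WithLp.toLp 2 (fun j => M j l) : Space 3) j
    rw [h2] at h3
    exact abs_eq_zero.1 (le_antisymm h3 (abs_nonneg _))
  have : q = 0 := by simp [hq, hz]
  nlinarith

/-- In dimension three the spin term is `-2 α₀α₁α₂ (α·b)` with the axial vector `b` of the field,
and `α₀α₁α₂` is an isometry. The constant is `2`, where the estimate by rows would give `3`. -/
theorem IsDiracMatrices.norm_spinTerm_three_le {α : Fin 3 → SpinMatrix 3} {β : SpinMatrix 3}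
    (hαβ : IsDiracMatrices 3 α β) {M : Matrix (Fin 3) (Fin 3) ℝ} (hM : ∀ j k, M j k = -M k j)
    (s : Spinor 3) : ‖spinTerm α M s‖ ≤ 2 * opNorm M * ‖s‖ := by
  have h0 : ∀ j, M j j = 0 := fun j => by linarith [hM j j]
  have anti : ∀ j k : Fin 3, j ≠ k → ∀ u, act (α j) (act (α k) u) = -act (α k) (act (α j) u) :=
    fun j k hjk u => by
      have := hαβ.anticomm_act j k u
      rw [if_neg hjk] at this
      exact eq_neg_of_add_eq_zero_left this
  have sq := hαβ.act_act_self
  let b : Space 3 := WithLp.toLp 2 ![M 1 2, -M 0 2, M 0 1]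
  have e : spinTerm α M s
      = (-2 : ℂ) • act (α 0) (act (α 1) (act (α 2) (clifford α b s))) := by
    have a1 : ∀ u, act (α 1) (act (α 0) u) = -act (α 0) (act (α 1) u) := anti 1 0 (by decide)
    have a2 : ∀ u, act (α 2) (act (α 0) u) = -act (α 0) (act (α 2) u) := anti 2 0 (by decide)
    have a3 : ∀ u, act (α 2) (act (α 1) u) = -act (α 1) (act (α 2) u) := anti 2 1 (by decide)
    simp only [spinTerm, clifford, Fin.sum_univ_three, hM 1 0, hM 2 0, hM 2 1, h0, b, act_add,
      act_smul, a1, a2, a3, act_neg, sq, neg_neg]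
    simp
    module
  have hb : ‖b‖ ≤ opNorm M := by
    refine (pow_le_pow_iff_left₀ (norm_nonneg _) (opNorm_nonneg M) two_ne_zero).1
      (le_trans (le_of_eq ?_) (axial_le_opNorm hM))
    rw [← sum_coord_sq, Fin.sum_univ_three]
    simp [b]
    ring
  rw [e, norm_smul, hαβ.norm_act_alpha, hαβ.norm_act_alpha, hαβ.norm_act_alpha, hαβ.norm_clifford,
    norm_neg, mul_assoc]
  have : ‖(2 : ℂ)‖ = 2 := by simp
  rw [this]
  exact mul_le_mul_of_nonneg_left (mul_le_mul_of_nonneg_right hb (norm_nonneg s)) zero_le_two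

/-- The distributional formula is antisymmetric in `j` and `k`, but it fixes `B` only almost
everywhere; hence the conclusion has this form. -/
theorem IsMagneticField.antisymm {A : Space d → Space d} {B : Space d → Matrix (Fin d) (Fin d) ℝ}
    (hAB : IsMagneticField A B) (hB : ∀ j k, MemL2loc fun x => B x j k) (j k : Fin d) :
    ∀ᵐ x, B x j k = -B x k j := by
  have hl := fun j k => (hB j k).locallyIntegrable
  have := ae_eq_zero_of_integral_contDiff_smul_eq_zero ((hl j k).add (hl k j)) fun η hη hs => by
    have i := fun j k => (hl j k).integrable_smul_left_of_hasCompactSupport hη.continuous hs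
    have h1 := hAB j k η hη hs
    have h2 := hAB k j η hη hs
    have e : ∫ x, (A x j * pderiv k η x - A x k * pderiv j η x)
        = -∫ x, (A x k * pderiv j η x - A x j * pderiv k η x) := by
      rw [← integral_neg]
      simp only [neg_sub]
    simp only [Pi.add_apply, smul_add]
    rw [integral_add (i j k) (i k j)]
    simp only [smul_eq_mul, mul_comm (η _)]
    rw [h1, h2, e]
    ring
  filter_upwards [this] with x hx
  rw [Pi.add_apply] at hx
  linarith

end OperatorNorm

/-! ### Incompatibility of the two energy inequalities -/

section Arithmetic

/-- Here `t = 1/(d-2)`, `X = ‖∇_A ψ‖` and `Y = ‖α·∇_A ψ‖`. The alternatives for `κ` are `d = 3` and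
`d ≥ 4`. -/
theorem absurd_of_virial_le {t ρ κ ε₁ ε₂ ε₃ X Y : ℝ} (ht : 0 ≤ t) (hρ : ρ ≤ 1 + t)
    (hκ : (t = 1 ∧ κ = 2) ∨ (t ≤ 1 / 2 ∧ κ = 1 + 2 * t))
    (hε₁ : 0 ≤ ε₁) (hε₂ : 0 ≤ ε₂) (hε₃ : 0 ≤ ε₃)
    (hsmall : (4 + 2 * t) * ε₁ + 16 * (1 + t) * ε₂ + 8 * t * (1 + t) * ε₂ ^ 2
      + 4 * (1 + t) * ε₃ < 2) (hX : 0 < X) (hY : 0 ≤ Y)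
    (h1 : X ^ 2 ≤ Y ^ 2 + κ * ε₁ * X ^ 2)
    (h2 : 2 * Y ^ 2 ≤ 2 * (ε₁ * X * Y)
      + 2 * ((ε₂ ^ 2 * (2 * t) * X + ε₃ * X + 2 * ε₂ * Y + 2 * ε₂ * X) * (ρ * X))) : False := by
  -- Both inequalities are homogeneous, so only the ratio `y = Y/X` matters.
  obtain ⟨y, rfl⟩ : ∃ y, Y = y * X := ⟨Y / X, (div_mul_cancel₀ _ hX.ne').symm⟩
  have hy : 0 ≤ y := nonneg_of_mul_nonneg_left hY hX
  have hX2 : 0 < X ^ 2 := by positivity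
  have k1 : 1 ≤ y ^ 2 + κ * ε₁ := by
    refine le_of_mul_le_mul_right ?_ hX2
    linarith
  have k2 : y ^ 2 ≤ ε₁ * y + (ε₂ ^ 2 * (2 * t) + ε₃ + 2 * ε₂ * y + 2 * ε₂) * ρ := by
    refine le_of_mul_le_mul_right ?_ hX2
    linarith
  have k3 : y ^ 2 ≤ ε₁ * y + (ε₂ ^ 2 * (2 * t) + ε₃ + 2 * ε₂ * y + 2 * ε₂) * (1 + t) :=
    k2.trans (by gcongr)
  have hg : 0 ≤ (1 + t) := by linarith
  -- If `y ≥ 1`, the virial inequality alone is contradictory: dividing by `y`, the smallness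
  -- condition gives `y < 1/2`.
  rcases le_or_gt 1 y with hy1 | hy1
  · have a1 : (ε₂ ^ 2 * (2 * t) + ε₃ + 2 * ε₂ * y + 2 * ε₂) * (1 + t)
        ≤ (ε₂ ^ 2 * (2 * t) + ε₃ + 4 * ε₂) * (1 + t) * y := by
      have : ε₂ ^ 2 * (2 * t) + ε₃ + 2 * ε₂ * y + 2 * ε₂
          ≤ (ε₂ ^ 2 * (2 * t) + ε₃ + 4 * ε₂) * y := by
        have : 0 ≤ (ε₂ ^ 2 * (2 * t) + ε₃ + 2 * ε₂) * (y - 1) :=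
          mul_nonneg (by positivity) (by linarith)
        linarith
      calc _ ≤ (ε₂ ^ 2 * (2 * t) + ε₃ + 4 * ε₂) * y * (1 + t) :=
            mul_le_mul_of_nonneg_right this hg
        _ = _ := by ring
    have a2 : y ≤ ε₁ + (ε₂ ^ 2 * (2 * t) + ε₃ + 4 * ε₂) * (1 + t) := by
      refine le_of_mul_le_mul_right ?_ (by linarith : 0 < y)
      nlinarith
    have a3 : 0 ≤ t * ε₁ := mul_nonneg ht hε₁
    linarith
  · have a1 : 0 ≤ 2 * ε₂ * (1 - y) * (1 + t) :=
      mul_nonneg (mul_nonneg (by positivity) (by linarith)) hg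
    -- Since `y < 1`, the terms in `ε₂` and `ε₃` amount to at most half of those in the smallness
    -- condition.
    have a2 : 2 * y ^ 2 < 2 * ε₁ * y + 1 - (2 + t) * ε₁ := by linarith
    have a3 : 0 ≤ (1 + t) * ε₂ := mul_nonneg hg hε₂
    have a4 : 0 ≤ t * (1 + t) * ε₂ ^ 2 := by positivity
    have a5 : 0 ≤ (1 + t) * ε₃ := mul_nonneg hg hε₃
    have a6 : (4 + 2 * t) * ε₁ < 2 := by linarith
    rcases hκ with ⟨rfl, rfl⟩ | ⟨ht2, rfl⟩
    -- For `d = 3`, `y² ≥ 1 - 2ε₁` and `2y² < 1 - ε₁` force `ε₁ > 1/3`, against `6ε₁ < 2`.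
    · have : ε₁ * y ≤ ε₁ := mul_le_of_le_one_right hε₁ hy1.le
      linarith
    · have b1 : 0 ≤ t * ε₁ := mul_nonneg ht hε₁
      -- Using `2y ≤ 2y² + 1/2` to remove the linear term and `y² ≥ 1 - (1+2t)ε₁`, one would get `(1
      -- - 2ε₁)² + (1/2 - t)ε₁(3 - 4ε₁) < 0`, a sum of nonnegative terms.
      have b2 : ε₁ < 1 / 2 := by linarith
      have b3 : 0 ≤ ε₁ * (2 * (y - 1 / 2) ^ 2) := by positivity
      have b4 : 0 ≤ (1 - ε₁) * (y ^ 2 + (1 + 2 * t) * ε₁ - 1) :=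
        mul_nonneg (by linarith) (by linarith)
      have b5 : 0 ≤ (1 / 2 - t) * (ε₁ * (3 - 4 * ε₁)) :=
        mul_nonneg (by linarith) (mul_nonneg hε₁ (by linarith))
      have b6 := sq_nonneg (1 - 2 * ε₁)
      nlinarith

end Arithmetic

/-! ### From the operator formulation to the magnetic Sobolev space -/

section Operators

variable {d : ℕ} {A : Space d → Space d} {f : Space d → Spinor d}
  {D : Fin d → Space d → Spinor d} {α : Fin d → SpinMatrix d} {β : SpinMatrix d}
  {φ : Space d → ℝ}

theorem exists_H1 {g : Fin d → Space d → Spinor d} (hf : MemLp f 2 volume)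
    (hg : ∀ j, MemLp (g j) 2 volume) (h : ∀ j, HasWeakPartial j f (g j)) :
    ∃ ψ : H1 d, (ψ : L2Spinor d) =ᵐ[volume] f ∧ ∀ j, weakPartial j ψ =ᵐ[volume] g j := by
  have hw := fun j => hf.hasWeakPartial_toLp (hg j) (h j)
  let ψ : H1 d := ⟨hf.toLp f, fun j => ⟨_, hw j⟩⟩
  refine ⟨ψ, hf.coeFn_toLp, fun j => ?_⟩
  rw [(hasWeakPartial_weakPartial j ψ).unique (hw j)]
  exact (hg j).coeFn_toLp

theorem MagSobolev.exists_H1 (h : MagSobolev A f D) :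
    ∃ ψ : H1 d, (ψ : L2Spinor d) =ᵐ[volume] f ∧ ∀ j, magPartial A j ψ =ᵐ[volume] D j := by
  obtain ⟨ψ, h1, h2⟩ := AnomalousDirac.exists_H1 h.memLp h.memLp_weak h.weak
  refine ⟨ψ, h1, fun j => ?_⟩
  filter_upwards [h1, h2 j] with x e1 e2
  rw [magPartial, e1, e2, smul_smul, add_sub_cancel_right]

theorem magSobolev_magPartial (hA : ∀ j, IsMultiplier fun x => A x j) (ψ : H1 d) :
    MagSobolev A (ψ : L2Spinor d) (fun j => magPartial A j ψ) := by
  have hp : ∀ j, MemLp (fun x => (A x j : ℂ) • (ψ : L2Spinor d) x) 2 volume := fun j =>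
    hA j _ (fun j => weakPartial j ψ) (Lp.memLp _) (fun j => Lp.memLp _)
      (fun j => hasWeakPartial_weakPartial j ψ)
  refine ⟨Lp.memLp _, fun j => ?_, hp, fun j => ?_⟩
  · have := (Lp.memLp (weakPartial j ψ)).sub ((hp j).const_smul Complex.I)
    refine this.ae_eq (Eventually.of_forall fun x => ?_)
    simp only [Pi.sub_apply, Pi.smul_apply, magPartial, smul_smul]
  · simpa only [magPartial, smul_smul, sub_add_cancel] using hasWeakPartial_weakPartial j ψ

theorem hardyBound_of_H1 {b : Space d → ℝ} {ε : ℝ} (hb : AEStronglyMeasurable b volume)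
    (h : ∀ ψ : H1 d, ∫⁻ x, ENNReal.ofReal (‖x‖ ^ 2 * |b x| ^ 2 * ‖(ψ : L2Spinor d) x‖ ^ 2)
      ≤ ENNReal.ofReal (ε ^ 2) * magEnergy A ψ) : HardyBound A b ε := by
  refine ⟨hb, fun f D hf => ?_⟩
  obtain ⟨ψ, h1, h2⟩ := hf.exists_H1
  refine le_trans (le_of_eq ?_) ((h ψ).trans (le_of_eq ?_))
  · refine lintegral_congr_ae ?_
    filter_upwards [h1] with x hx
    rw [hx, ← ofReal_norm, ← ENNReal.ofReal_pow (norm_nonneg _), norm_smul, norm_mul, norm_norm,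
      Real.norm_eq_abs, mul_pow, mul_pow]
  · rw [magEnergy]
    congr 1
    refine lintegral_congr_ae ?_
    filter_upwards [ae_all_iff.2 h2] with x hx
    simp only [hx]

/-- The magnetic potential multiplies `H¹` into `L²` if the free magnetic Dirac operator is
defined on `H¹`. -/
theorem isMultiplier_of_domain (hαβ : IsDiracMatrices d α β) {m : ℝ} (hA : MemL2loc A)
    (hdom : (diracOp m α β A 0).domain = H1 d) (j : Fin d) : IsMultiplier fun x => A x j := by
  intro f g hf hg h
  obtain ⟨ψ, h1, h2⟩ := exists_H1 hf hg h
  obtain ⟨h3, h4⟩ : ∃ h : (ψ : L2Spinor d) ∈ H1 d,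
      MemLp (diracExpr m α β A 0 ⟨ψ, h⟩) 2 volume := by
    have : (ψ : L2Spinor d) ∈ (diracOp m α β A 0).domain := by rw [hdom]; exact ψ.2
    exact this
  -- `(α·A)f` is the difference of the free Dirac expression, in `L²` since `f ∈ H¹`, and the
  -- magnetic one, in `L²` by the domain hypothesis. As `|(α·A)f| = |A| |f|`, it dominates each `A_j
  -- f`.
  have h5 : MemLp (fun x => clifford α (A x) (f x)) 2 volume := by
    have h6 := ((memLp_finsetSum Finset.univ fun j _ => memLp_act (α j) (hg j)).const_smul
      (-Complex.I)).add ((memLp_act β hf).const_smul (m : ℂ))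
    refine (h6.sub h4).ae_eq ?_
    filter_upwards [h1, ae_all_iff.2 h2] with x e1 e2
    have e3 : ∀ j, act (α j) (magPartial A j ψ x)
        = act (α j) (g j x) - Complex.I • (A x j : ℂ) • act (α j) (f x) := fun j => by
      rw [magPartial, e1, e2, act_sub, act_smul, smul_smul]
    simp only [Pi.sub_apply, Pi.add_apply, Pi.smul_apply, diracExpr, e1, Pi.zero_apply, zero_act]
    rw [show (⟨(ψ : L2Spinor d), h3⟩ : H1 d) = ψ from rfl]
    simp only [e3, Finset.sum_sub_distrib, ← Finset.smul_sum, clifford]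
    linear_combination (norm := module) (-1 : ℂ) • Complex.I_mul_I •
      ∑ j, (A x j : ℂ) • act (α j) (f x)
  have hm : AEStronglyMeasurable (fun x => (A x j : ℂ)) volume :=
    Complex.continuous_ofReal.comp_aestronglyMeasurable
      (hA.coord j).locallyIntegrable.aestronglyMeasurable
  refine h5.of_le (hm.smul hf.1) (Eventually.of_forall fun x => ?_)
  rw [hαβ.norm_clifford, norm_smul, Complex.norm_real, Real.norm_eq_abs]
  exact mul_le_mul_of_nonneg_right (abs_coord_le _ _) (norm_nonneg _)

/-- The free magnetic Dirac operator is symmetric. -/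
theorem MagSobolev.integral_im_inner_diracField (hαβ : IsDiracMatrices d α β)
    (hA : ∀ j, IsMultiplier fun x => A x j) (h : MagSobolev A f D) :
    ∫ x, (inner ℂ (f x) (diracField α D x) : ℂ).im = 0 := by
  have k := fun j => (h.act (α j)).integral_by_parts hA h (w := fun _ => 1) contDiff_const
    (C := 1) (C' := 0) (fun x => by simp) (fun j x => by simp [pderiv]) j
  have e : ∀ x, -2 * (inner ℂ (f x) (diracField α D x) : ℂ).im
      = Complex.reCLM (∑ j, (((1 : ℝ) : ℂ) * inner ℂ (AnomalousDirac.act (α j) (D j x)) (f x)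
        + ((1 : ℝ) : ℂ) * inner ℂ (AnomalousDirac.act (α j) (f x)) (D j x)
        + (pderiv j (fun _ : Space d => (1 : ℝ)) x : ℂ)
          * inner ℂ (AnomalousDirac.act (α j) (f x)) (f x))) := by
    intro x
    have e1 : ∀ j : Fin d, pderiv j (fun _ : Space d => (1 : ℝ)) x = 0 := fun j => by
      simp [pderiv]
    have e2 : (inner ℂ (diracField α D x) (f x) : ℂ).im
        = -(inner ℂ (f x) (diracField α D x) : ℂ).im := by
      rw [← inner_conj_symm, Complex.conj_im]
    simp only [e1, Complex.ofReal_one, one_mul, Complex.ofReal_zero, zero_mul, add_zero,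
      Finset.sum_add_distrib]
    rw [hαβ.sum_inner_act, ← sum_inner, sum_act_eq, inner_smul_left, Complex.conj_I,
      Complex.reCLM_apply, Complex.add_re]
    simp only [neg_mul, Complex.neg_re, Complex.I_mul_re, e2]
    ring
  have i := integrable_finsetSum Finset.univ fun j _ => (k j).1
  have z := integral_finsetSum Finset.univ fun j _ => (k j).1
  rw [Finset.sum_eq_zero fun j _ => (k j).2] at z
  have : ∫ x, -2 * (inner ℂ (f x) (diracField α D x) : ℂ).im = 0 := by
    simp only [e]
    rw [ContinuousLinearMap.integral_comp_comm _ i, z, map_zero]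
  rw [integral_const_mul] at this
  linarith

theorem im_inner_self_eq_zero {T : Spinor d → Spinor d} {u : Spinor d}
    (h : (inner ℂ (T u) u : ℂ) = inner ℂ u (T u)) : (inner ℂ u (T u) : ℂ).im = 0 := by
  rw [← inner_conj_symm] at h
  exact Complex.conj_eq_iff_im.1 h

/-- Eigenvalues are real. -/
theorem MagSobolev.eigenvalue_im_eq_zero (hαβ : IsDiracMatrices d α β)
    (hA : ∀ j, IsMultiplier fun x => A x j) (h : MagSobolev A f D) {m : ℝ} {l : ℂ}
    {p : Space d → Space d}
    (heq : ∀ᵐ x, diracField α D x + (m : ℂ) • AnomalousDirac.act β (f x)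
      + Complex.I • AnomalousDirac.act β (clifford α (p x) (f x)) = l • f x)
    (hf : l2norm volume f ≠ 0) : l.im = 0 := by
  -- The mass term and the potential are Hermitian matrices at each point, so they disappear before
  -- integration; no integrability of the potential term is needed.
  have e : ∀ᵐ x, (inner ℂ (f x) (diracField α D x) : ℂ).im = l.im * ‖f x‖ ^ 2 := by
    filter_upwards [heq] with x hx
    have h1 := congrArg (fun u => (inner ℂ (f x) u : ℂ).im) hx
    simp only [inner_add_right, Complex.add_im] at h1
    have h2 : (inner ℂ (f x) ((m : ℂ) • AnomalousDirac.act β (f x)) : ℂ).im = 0 := by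
      rw [inner_smul_right, Complex.im_ofReal_mul,
        im_inner_self_eq_zero (hαβ.hermitian_beta.inner_act _ _), mul_zero]
    have h3 : (inner ℂ (f x) (Complex.I • AnomalousDirac.act β (clifford α (p x) (f x))) : ℂ).im
        = 0 := by
      refine im_inner_self_eq_zero
        (T := fun u => Complex.I • AnomalousDirac.act β (clifford α (p x) u)) ?_
      rw [inner_smul_left, inner_smul_right, hαβ.hermitian_beta.inner_act, hαβ.inner_clifford,
        hαβ.act_beta_clifford, inner_neg_right, Complex.conj_I]
      ring
    rw [h2, h3, add_zero, add_zero, inner_smul_right, inner_self_eq_norm_sq_to_K] at h1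
    rw [h1]
    have : ((‖f x‖ : ℂ) ^ 2) = ((‖f x‖ ^ 2 : ℝ) : ℂ) := by push_cast; rfl
    change (l * (‖f x‖ : ℂ) ^ 2).im = _
    rw [this, Complex.im_mul_ofReal]
  have h0 := h.integral_im_inner_diracField hαβ hA
  rw [integral_congr_ae e, integral_const_mul, ← l2norm_sq] at h0
  exact (mul_eq_zero.1 h0).resolve_right (pow_ne_zero 2 hf)

theorem act_anomalousPotential (α : Fin d → SpinMatrix d) (β : SpinMatrix d) (φ : Space d → ℝ)
    (x : Space d) (u : Spinor d) :
    act (anomalousPotential α β φ x) u = Complex.I • act β (clifford α (gradVec φ x) u) := by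
  simp only [anomalousPotential, smul_act, mul_act, sum_act, clifford]
  rfl

theorem gradVec_eq_gradient (φ : Space d → ℝ) (x : Space d) : gradVec φ x = gradient φ x := by
  ext j
  have : inner ℝ (EuclideanSpace.single j (1 : ℝ)) (gradient φ x) = gradient φ x j := by
    rw [EuclideanSpace.inner_single_left, map_one, one_mul]
  rw [← this, real_inner_comm, gradient, InnerProductSpace.toDual_symm_apply]
  rfl

/-- The Laplacian is taken in coordinates because a directional `fderiv` is measurable without any
regularity of the function, so the singular point needs no care. -/
theorem measurable_lap (φ : Space d → ℝ) : Measurable (lap φ) :=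
  Finset.measurable_fun_sum _ fun _ _ => measurable_fderiv_apply_const ℝ _ _

theorem lap_eq_laplacian (hφ : ContDiffOn ℝ ∞ φ {0}ᶜ) {x : Space d} (hx : x ≠ 0) :
    lap φ x = Laplacian.laplacian φ x := by
  have hd : DifferentiableAt ℝ (fderiv ℝ φ) x :=
    ((hφ.contDiffAt (isOpen_compl_singleton.mem_nhds hx)).fderiv_right (m := 1)
      (by norm_cast)).differentiableAt (by simp)
  rw [InnerProductSpace.laplacian_eq_iteratedFDeriv_orthonormalBasis φ
    (EuclideanSpace.basisFun (Fin d) ℝ)]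
  refine Finset.sum_congr rfl fun j _ => ?_
  rw [iteratedFDeriv_two_apply, pderiv]
  have : pderiv j φ = fun y => fderiv ℝ φ y (EuclideanSpace.single j 1) := rfl
  rw [this, fderiv_clm_apply hd (differentiableAt_const _)]
  simp

end Operators

end AnomalousDirac

/-! ### The theorem on anomalous magnetic potentials -/

theorem theorem1p10 (d : ℕ) (hd : 3 ≤ d)
    (α : Fin d → AnomalousDirac.SpinMatrix d) (β : AnomalousDirac.SpinMatrix d)
    (hαβ : AnomalousDirac.IsDiracMatrices d α β)
    (m : ℝ) (hm : 0 ≤ m)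
    -- the magnetic potential and its magnetic field
    (A : AnomalousDirac.Space d → AnomalousDirac.Space d) (hA : AnomalousDirac.MemL2loc A)
    (B : AnomalousDirac.Space d → Matrix (Fin d) (Fin d) ℝ)
    (hAB : AnomalousDirac.IsMagneticField A B)
    (hB : ∀ j k, AnomalousDirac.MemL2loc (fun x => B x j k))
    -- `H_m(A) = H_m(A,0)` is self-adjoint with domain `H¹`
    (hdom : (AnomalousDirac.diracOp m α β A 0).domain = AnomalousDirac.H1 d)
    (hsa : IsSelfAdjoint (AnomalousDirac.diracOp m α β A 0))
    -- the potential `φ_am`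
    (φ : AnomalousDirac.Space d → ℝ) (hφ : AnomalousDirac.MemL2loc φ)
    (hφ_smooth : ContDiffOn ℝ ∞ φ {0}ᶜ)
    (ε₁ ε₂ ε₃ : ℝ) (hε₁ : 0 ≤ ε₁) (hε₂ : 0 ≤ ε₂) (hε₃ : 0 ≤ ε₃)
    (hsmall : (4 * (d : ℝ) - 6) / ((d : ℝ) - 2) * ε₁
        + (16 * (d : ℝ) - 16) / ((d : ℝ) - 2) * ε₂
        + (8 * (d : ℝ) - 8) / ((d : ℝ) - 2) ^ 2 * ε₂ ^ 2
        + (4 * (d : ℝ) - 4) / ((d : ℝ) - 2) * ε₃ < 2)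
    (hB_bound : ∀ ψ : AnomalousDirac.H1 d,
      ∫⁻ x, ENNReal.ofReal (‖x‖ ^ 2 * AnomalousDirac.opNorm (B x) ^ 2
          * ‖(ψ : AnomalousDirac.L2Spinor d) x‖ ^ 2)
        ≤ ENNReal.ofReal (ε₁ ^ 2) * AnomalousDirac.magEnergy A ψ)
    (hφ_grad : ∀ x : AnomalousDirac.Space d, x ≠ 0 → ‖x‖ * ‖gradient φ x‖ ≤ ε₂)
    (hφ_lap : ∀ ψ : AnomalousDirac.H1 d,
      ∫⁻ x, ENNReal.ofReal (‖x‖ ^ 2 * |Laplacian.laplacian φ x| ^ 2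
          * ‖(ψ : AnomalousDirac.L2Spinor d) x‖ ^ 2)
        ≤ ENNReal.ofReal (ε₃ ^ 2) * AnomalousDirac.magEnergy A ψ) :
    AnomalousDirac.pointSpectrum
      (AnomalousDirac.diracOp m α β A (AnomalousDirac.anomalousPotential α β φ)) = ∅ := by
  open AnomalousDirac in
  refine Set.eq_empty_iff_forall_notMem.2 fun z => ?_
  rintro ⟨ψ, hψ0, hψ⟩
  obtain ⟨ψ, hψ1, hψ2⟩ := ψ
  have hmul := fun j => isMultiplier_of_domain hαβ hA hdom j
  have h := magSobolev_magPartial hmul ⟨ψ, hψ1⟩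
  set D := fun j => magPartial A j ⟨ψ, hψ1⟩ with hD
  have heq : ∀ᵐ x, diracField α D x + (m : ℂ) • act β (ψ x)
      + Complex.I • act β (clifford α (gradVec φ x) (ψ x)) = z • ψ x := by
    have e1 : hψ2.toLp _ = z • ψ := hψ
    filter_upwards [hψ2.coeFn_toLp, Lp.coeFn_smul z ψ] with x h1 h2
    rw [e1, h2, Pi.smul_apply, diracExpr, act_anomalousPotential] at h1
    exact h1.symm
  have hb : HardyBound A (fun x => opNorm (B x)) ε₁ :=
    hardyBound_of_H1 (aestronglyMeasurable_opNorm fun j k =>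
      (hB j k).locallyIntegrable.aestronglyMeasurable) fun ψ => by
        simpa only [abs_of_nonneg (opNorm_nonneg _)] using hB_bound ψ
  have hlap : HardyBound A (lap φ) ε₃ :=
    hardyBound_of_H1 (measurable_lap φ).aestronglyMeasurable fun ψ => by
      refine le_trans (le_of_eq (lintegral_congr_ae ?_)) (hφ_lap ψ)
      filter_upwards [ae_ne_zero hd] with x hx
      rw [lap_eq_laplacian hφ_smooth hx]
  have hBb : ∀ x j k, |B x j k| ≤ opNorm (B x) := fun x j k => abs_le_opNorm _ j k
  -- Zero energy would make `ψ/|x|`, hence `ψ`, vanish by the Hardy inequality.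
  have hX0 : 0 < energy D := by
    refine lt_of_le_of_ne (energy_nonneg D) fun h0 => hψ0 ?_
    obtain ⟨hN, hN2⟩ := h.hardy hmul hd
    rw [← h0, mul_zero] at hN2
    have h1 : ∫ x, ‖divNorm ψ x‖ ^ 2 = 0 := by
      rw [← l2norm_sq, le_antisymm hN2 (l2norm_nonneg _), zero_pow two_ne_zero]
    rw [integral_eq_zero_iff_of_nonneg (fun x => by positivity) (integrable_norm_sq hN)] at h1
    refine (Lp.eq_zero_iff_ae_eq_zero).2 ?_
    filter_upwards [h1, ae_ne_zero hd] with x h1 hx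
    have h2 : ‖divNorm ψ x‖ = 0 := pow_eq_zero_iff two_ne_zero |>.1 h1
    rw [Pi.zero_apply, ← norm_eq_zero, norm_eq_mul_norm_divNorm _ hx, h2, mul_zero]
  have hz : z.im = 0 := by
    refine h.eigenvalue_im_eq_zero hαβ hmul heq fun h0 => hψ0 ?_
    have h1 : ∫ x, ‖ψ x‖ ^ 2 = 0 := by
      rw [← l2norm_sq, h0, zero_pow two_ne_zero]
    rw [integral_eq_zero_iff_of_nonneg (fun x => by positivity)
      (integrable_norm_sq (Lp.memLp ψ))] at h1
    refine (Lp.eq_zero_iff_ae_eq_zero).2 ?_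
    filter_upwards [h1] with x h1
    exact norm_eq_zero.1 (pow_eq_zero_iff two_ne_zero |>.1 h1)
  have hz2 : ((z.re : ℝ) : ℂ) = z := Complex.ext (by simp) (by simp [hz])
  -- The virial inequality is formulated for a real spectral parameter, which `z.re` now provides.
  rw [← hz2] at heq
  have key := h.virial_le hd hαβ hmul hA hAB hB hε₁ hε₂ hε₃ hb hBb
    (fun x u => hαβ.norm_clifford_mulVec_le (B x) x u) hφ_smooth heq
    (fun x hx => by rw [gradVec_eq_gradient]; exact hφ_grad x hx) hlap
  have hd3 : (3 : ℝ) ≤ d := by exact_mod_cast hd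
  have hd2 : (d : ℝ) - 2 ≠ 0 := by linarith
  have ht : 0 ≤ 1 / ((d : ℝ) - 2) := div_nonneg zero_le_one (by linarith)
  have e2 : 2 / ((d : ℝ) - 2) = 2 * (1 / ((d : ℝ) - 2)) := by ring
  -- The coefficients of the smallness condition in terms of `t = 1/(d-2)`, using `(d-1)/(d-2) = 1 +
  -- t`.
  have hsmall' : (4 + 2 * (1 / ((d : ℝ) - 2))) * ε₁ + 16 * (1 + 1 / ((d : ℝ) - 2)) * ε₂
      + 8 * (1 / ((d : ℝ) - 2)) * (1 + 1 / ((d : ℝ) - 2)) * ε₂ ^ 2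
      + 4 * (1 + 1 / ((d : ℝ) - 2)) * ε₃ < 2 := by
    refine lt_of_eq_of_lt ?_ hsmall
    field_simp
    ring
  -- Dimension three is separate: there `ρ = 2`, and the sharper spin bound gives `κ = 2`. For `d ≥
  -- 4`, `ρ = 1`, and the estimate by rows gives `κ = (d/2) · 2/(d-2) = 1 + 2t`.
  rcases eq_or_lt_of_le hd with h3 | h4
  · subst h3
    have hc : ∀ᵐ x, ∀ s : Spinor 3, ‖spinTerm α (B x) s‖ ≤ 2 * 1 * opNorm (B x) * ‖s‖ := by
      filter_upwards [ae_all_iff.2 fun j => ae_all_iff.2 fun k => hAB.antisymm hB j k] with x hx s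
      rw [mul_one]
      exact hαβ.norm_spinTerm_three_le hx s
    have hE := h.energy_sq_le hd hαβ hmul hA hAB hB hε₁ hb hBb zero_le_one hc
    rw [if_pos rfl, e2] at key
    refine absurd_of_virial_le ht (κ := 2) (by norm_num) (Or.inl (by norm_num)) hε₁ hε₂ hε₃ hsmall'
      hX0 (l2norm_nonneg _) ?_ key
    refine hE.trans (le_of_eq ?_)
    rw [show ((3 : ℕ) : ℝ) - 2 = 1 by norm_num]
    ring
  · have hd4 : (4 : ℝ) ≤ d := by exact_mod_cast h4
    have hc : ∀ᵐ x, ∀ s : Spinor d,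
        ‖spinTerm α (B x) s‖ ≤ 2 * ((d : ℝ) / 2) * opNorm (B x) * ‖s‖ :=
      Filter.Eventually.of_forall fun x s => by
        rw [mul_div_cancel₀ _ two_ne_zero]
        exact hαβ.norm_spinTerm_le (B x) s
    have hE := h.energy_sq_le hd hαβ hmul hA hAB hB hε₁ hb hBb (by positivity) hc
    rw [if_neg (by omega), e2] at key
    refine absurd_of_virial_le ht (κ := 1 + 2 * (1 / ((d : ℝ) - 2))) (by linarith)
      (Or.inr ⟨?_, rfl⟩) hε₁ hε₂ hε₃ hsmall' hX0 (l2norm_nonneg _) ?_ key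
    · exact one_div_le_one_div_of_le two_pos (by linarith)
    · refine hE.trans (le_of_eq ?_)
      field_simp
      ring
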